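/- Let $d\ge1$ be an integer, let $m_1=(d-1)/d$, and let $m\in(m_1,1)$ if $d\ge2$, $m\in(1/3,1)$ if $d=1$. On $\mathbb R^d$ consider the Barenblatt profile $\mathcal B(x)=(1+|x|^2)^{\frac1{m-1}}$, and for a function $v\ge0$ define the relative entropy and the relative Fisher information by $$\mathcal F[v]=\int_{\mathbb R^d}\Big(\mathcal B^{m-1}(v-\mathcal B)-\tfrac1m\,(v^m-\mathcal B^m)\Big)\,dx,\qquad \mathcal I[v]=\int_{\mathbb R^d}v\,\big|\nabla v^{m-1}-2x\big|^2\,dx\in[0,+\infty],$$ where $\nabla$ is the weak gradient and $\mathcal I[v]=+\infty$ if $v^{m-1}$ has no locally integrable weak gradient. Let $\mathcal Q[v]=\mathcal I[v]/\mathcal F[v]\in[0,+\infty]$ whenever $0<\mathcal F[v]<+\infty$. Set $$\eta=2\,d\,(m-m_1)\qquad\text{and}\qquad\chi=\frac{m}{266+56\,m}.$$ Then $\chi\in(0,1)$ and the following holds. Let $v$ be a measurable function on $\mathbb R^d$, not a.e. equal to $\mathcal B$, such that $\int_{\mathbb R^d}v\,dx=\int_{\mathbb R^d}\mathcal B\,dx$,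 $\int_{\mathbb R^d}x\,v\,dx=0$ and, for some $\varepsilon\in(0,\chi\,\eta)$, $$(1-\varepsilon)\,\mathcal B\le v\le(1+\varepsilon)\,\mathcal B\quad\text{a.e. in }\mathbb R^d.$$ Then the integrand of $\mathcal F[v]$ is integrable, $\mathcal F[v]>0$, and $$\mathcal Q[v]\ge4+\eta.$$ -/

import Mathlib

open MeasureTheory
open scoped ENNReal ContDiff

noncomputable section

namespace FastDiffusion

/-- `G` is a weak (distributional) gradient of `f` on `ℝ^d`: both are locally integrable and
`∫ f ∇φ = - ∫ φ G` for every real-valued smooth compactly supported `φ`. -/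
structure HasWeakGradient {d : ℕ} (f : EuclideanSpace ℝ (Fin d) → ℝ)
    (G : EuclideanSpace ℝ (Fin d) → EuclideanSpace ℝ (Fin d)) : Prop where
  locallyIntegrable : LocallyIntegrable f volume
  locallyIntegrable_grad : LocallyIntegrable G volume
  integral_eq : ∀ φ : EuclideanSpace ℝ (Fin d) → ℝ, ContDiff ℝ ∞ φ → HasCompactSupport φ →
    ∫ x, f x • gradient φ x = - ∫ x, φ x • G x

/-- The Barenblatt profile `𝓑(x) = (1 + |x|²)^{1/(m-1)}` on `ℝ^d`. -/
def barenblatt (d : ℕ) (m : ℝ) (x : EuclideanSpace ℝ (Fin d)) : ℝ :=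
  (1 + ‖x‖ ^ 2) ^ (1 / (m - 1))

/-- The integrand `𝓑^{m-1} (v - 𝓑) - (v^m - 𝓑^m) / m` of the relative entropy. -/
def entropyDensity {d : ℕ} (m : ℝ) (v : EuclideanSpace ℝ (Fin d) → ℝ)
    (x : EuclideanSpace ℝ (Fin d)) : ℝ :=
  barenblatt d m x ^ (m - 1) * (v x - barenblatt d m x)
    - 1 / m * (v x ^ m - barenblatt d m x ^ m)

/-- The relative entropy (free energy) `𝓕[v]`. -/
def relEntropy {d : ℕ} (m : ℝ) (v : EuclideanSpace ℝ (Fin d) → ℝ) : ℝ :=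
  ∫ x, entropyDensity m v x

/-- The relative Fisher information `𝓘[v] = ∫ v |∇ v^{m-1} - 2x|² dx` in `[0, ∞]`, with `∇` the
weak gradient.  The weak gradient is unique up to null sets, so that the infimum runs over equal
values; it is `∞` if `v^{m-1}` has no (locally integrable) weak gradient. -/
def relFisher {d : ℕ} (m : ℝ) (v : EuclideanSpace ℝ (Fin d) → ℝ) : ℝ≥0∞ :=
  ⨅ (G : EuclideanSpace ℝ (Fin d) → EuclideanSpace ℝ (Fin d))
    (_ : HasWeakGradient (fun x => v x ^ (m - 1)) G),
    ∫⁻ x, ENNReal.ofReal (v x * ‖G x - (2 : ℝ) • x‖ ^ 2)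

/-- The entropy - entropy production quotient `𝓠[v] = 𝓘[v] / 𝓕[v]` in `[0, ∞]`; it is meant for
`v` with `0 < 𝓕[v] < ∞`. -/
def quotient {d : ℕ} (m : ℝ) (v : EuclideanSpace ℝ (Fin d) → ℝ) : ℝ≥0∞ :=
  relFisher m v / ENNReal.ofReal (relEntropy m v)

/-- The exponent `m₁ = (d - 1) / d`. -/
def mOne (d : ℕ) : ℝ := ((d : ℝ) - 1) / d

/-- The gap `η = 2 d (m - m₁)`. -/
def gapEta (d : ℕ) (m : ℝ) : ℝ := 2 * d * (m - mOne d)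

/-- The explicit constant `χ = m / (266 + 56 m)`. -/
def gapChi (m : ℝ) : ℝ := m / (266 + 56 * m)

end FastDiffusion

end

/-!
Write `a = 1 / (1 - m)` and `w_p = (1 + |x|²) ^ (-p)`, so that the Barenblatt profile is `w_a`.
For `v = w_a (1 + t)` with `|t| ≤ ε`, both functionals are controlled by quadratic ones: the
entropy is at most `(1 - m) / (2 (1 - ε)) ∫ t² w_{a-1}`, and the Fisher information is at least
`(1 - ε) ∫ |∇f|² w_a`, where `f = v ^ (m - 1) - (1 + |x|²)` is the increment of the pressure and
is `-(1 - m) (1 + |x|²) t` to first order. The inequality therefore comes from a weighted Poincaré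
inequality, in which the constant `2 a` is improved to `2 a (1 + σ)` on functions orthogonal to
affine functions. Here `f` is orthogonal to them up to terms of second order, because `v` has the
mass and the center of mass of the profile. In the Poincaré inequality it suffices to take
`σ = η / 3`, although the optimal value is `η / 2`. As `ε` tends to `0` the quotient of Fisher
information and entropy is then bounded below by `4 + 4 η / 3`, and the surplus over `4 + η`
absorbs every error of order `ε`; see `gap_constant_nonlinear` and `mul_relEntropy_le_relFisher`.

The Poincaré inequality is proved without spectral theory for the weighted operator. The weight
`w_p` is a mixture of the Gaussians `exp (-s |x|²)` with respect to a Gamma density in `s`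
(`integral_mixture`). For a single Gaussian, the Dirichlet form and the second moment of `f` are,
in Fourier variables, quadratic forms with kernels `y eʸ` and `eʸ` in `y = 2 π² ⟪ξ, ζ⟫ / s`. Every
power of `⟪ξ, ζ⟫` is a positive semidefinite kernel, and the coefficients of `(y - 1 - σ) eʸ` are
nonnegative from degree `2` on. Hence `gaussian_gap`: the terms of degree at least `4` are
dropped, and only the radial parts of those of degree `2` and `3` are kept. These two terms are,
up to constants, the squares of the derivatives in `s` of the Gaussian means of `f` and of `∇f`.
What is lost by averaging over `s` is the variance of those means in `s`, and this variance is
bounded by their derivatives through a one-dimensional Poincaré inequality for Gamma densities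
(`gamma_poincare`). This gives `weighted_gap_smooth`, and mollification and cutoff extend it to
weakly differentiable functions (`HasWeakGradient.weighted_gap`).
-/

open MeasureTheory
open scoped ENNReal ContDiff

namespace FastDiffusion
open Real Set Filter Topology

/-! ### A weighted Poincaré inequality for Gamma densities on the half-line -/

/-- Pointwise inequality behind `gamma_poincare_shifted`. With `x = s ^ (-p)`, `x₀ = s₀ ^ (-p)`,
`φ = x₀ - x` and `q = s ^ b * exp (-s)`, the left-hand side is the derivative of
`p * q * s * x * M ^ 2 / φ`; the difference of the two sides is a square plus a term whose sign is
that of `(s x - s₀ x₀) / φ`. -/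
lemma gamma_poincare_pointwise {p s s₀ x x₀ q M D φ : ℝ} (hp : 0 < p) (hs : 0 < s) (hq : 0 ≤ q)
    (hφ : φ = x₀ - x) (hφ0 : φ ≠ 0) (hsign : 0 ≤ (s * x - s₀ * x₀) / φ) :
    p * q * (s₀ * x - s * x) * M ^ 2 / φ + p * q * s * x * (2 * M * D) / φ
      - p * q * s * x * M ^ 2 * (p * x / s) / φ ^ 2 ≤ q * s ^ 2 * D ^ 2 - p * s₀ * q * M ^ 2 := by
  have h1 : q * s ^ 2 * D ^ 2 - p * s₀ * q * M ^ 2 -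
      (p * q * (s₀ * x - s * x) * M ^ 2 / φ + p * q * s * x * (2 * M * D) / φ
      - p * q * s * x * M ^ 2 * (p * x / s) / φ ^ 2)
      = q * (s * D - p * x * M / φ) ^ 2 + q * M ^ 2 * p * ((s * x - s₀ * x₀) / φ) := by
    field_simp
    subst hφ
    ring
  have h2 : 0 ≤ q * (s * D - p * x * M / φ) ^ 2 + q * M ^ 2 * p * ((s * x - s₀ * x₀) / φ) := by
    positivity
  linarith

lemma rpow_sub_sign {p s s₀ : ℝ} (hp : 0 < p) (hp1 : p ≤ 1) (hs : 0 < s) (hs₀ : 0 < s₀)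
    (hne : s ≠ s₀) : s₀ ^ (-p) - s ^ (-p) ≠ 0 ∧
      0 ≤ (s * s ^ (-p) - s₀ * s₀ ^ (-p)) / (s₀ ^ (-p) - s ^ (-p)) := by
  have e : ∀ t : ℝ, 0 < t → t * t ^ (-p) = t ^ (1 - p) := fun t ht => by
    rw [sub_eq_add_neg, rpow_add ht, rpow_one]
  rw [e s hs, e s₀ hs₀]
  rcases lt_or_gt_of_ne hne with h | h
  · have h1 : s₀ ^ (-p) < s ^ (-p) := rpow_lt_rpow_of_neg hs h (by linarith)
    have h2 : s ^ (1 - p) ≤ s₀ ^ (1 - p) := rpow_le_rpow hs.le h.le (by linarith)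
    exact ⟨by linarith, div_nonneg_of_nonpos (by linarith) (by linarith)⟩
  · have h1 : s ^ (-p) < s₀ ^ (-p) := rpow_lt_rpow_of_neg hs₀ h (by linarith)
    have h2 : s₀ ^ (1 - p) ≤ s ^ (1 - p) := rpow_le_rpow hs₀.le h.le (by linarith)
    exact ⟨by linarith, div_nonneg (by linarith) (by linarith)⟩

lemma hasDerivAt_sub_rpow_neg {p s c : ℝ} (hs : 0 < s) :
    HasDerivAt (fun t => c - t ^ (-p)) (p * s ^ (-p) / s) s := by
  refine ((hasDerivAt_rpow_const (x := s) (p := -p) (Or.inl hs.ne')).const_sub c).congr_deriv ?_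
  rw [rpow_sub hs, rpow_one]; ring

/-- The auxiliary function `p s ^ s₀ e⁻ˢ (m(s) - m(s₀))² / (s₀ ^ (-p) - s ^ (-p))`, whose value at
`s₀` is `0` by the convention on division by zero, is continuous on `(0, ∞)`. -/
lemma continuousAt_gamma_aux {p s₀ : ℝ} (hp : 0 < p) (hs₀ : 0 < s₀) {m m' : ℝ → ℝ}
    (hp1 : p ≤ 1) (hm : ∀ s, 0 < s → HasDerivAt m (m' s) s) {s : ℝ} (hs : 0 < s) :
    ContinuousAt (fun t => p * (t ^ s₀ * exp (-t)) * (m t - m s₀) ^ 2 /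
      (s₀ ^ (-p) - t ^ (-p))) s := by
  have hW : ContinuousAt (fun t => p * (t ^ s₀ * exp (-t))) s :=
    continuousAt_const.mul ((continuousAt_id.rpow_const (Or.inl hs.ne')).mul
      (continuous_exp.comp continuous_neg).continuousAt)
  by_cases h : s = s₀
  · subst h
    rw [continuousAt_iff_punctured_nhds]
    have h1 := (hm s hs).tendsto_slope
    have h2 := (hasDerivAt_sub_rpow_neg (p := p) (c := s ^ (-p)) hs).tendsto_slope
    have h3 : p * s ^ (-p) / s ≠ 0 := by positivity
    have h4 : Tendsto (fun t : ℝ => t - s) (𝓝[≠] s) (𝓝 0) := by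
      have : ContinuousAt (fun t : ℝ => t - s) s := by fun_prop
      simpa using this.tendsto.mono_left nhdsWithin_le_nhds
    have h5 := ((((hW.tendsto.mono_left nhdsWithin_le_nhds).mul (h1.pow 2)).mul h4).mul
      (h2.inv₀ h3))
    simp only [mul_zero, zero_mul, sub_self, div_zero] at h5 ⊢
    refine h5.congr' ?_
    filter_upwards [self_mem_nhdsWithin,
      mem_nhdsWithin_of_mem_nhds (lt_mem_nhds hs)] with t ht ht0
    have h6 := (rpow_sub_sign hp hp1 ht0 hs ht).1
    have h7 : t - s ≠ 0 := sub_ne_zero.2 ht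
    simp only [slope_def_field, sub_self, sub_zero]
    field_simp
  · exact (hW.mul (((hm s hs).continuousAt.sub continuousAt_const).pow 2)).div
      (hasDerivAt_sub_rpow_neg hs).continuousAt (rpow_sub_sign hp hp1 hs hs₀ h).1

lemma hasDerivAt_gamma_aux {p b s₀ : ℝ} (hp : 0 < p) (hp1 : p ≤ 1) (hs₀ : 0 < s₀)
    (hb : b = s₀ + p - 1) {m m' : ℝ → ℝ}
    (hm : ∀ s, 0 < s → HasDerivAt m (m' s) s) {s : ℝ} (hs : 0 < s) (hne : s ≠ s₀) :
    ∃ D, HasDerivAt (fun t => p * (t ^ s₀ * exp (-t)) * (m t - m s₀) ^ 2 /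
      (s₀ ^ (-p) - t ^ (-p))) D s ∧
      D ≤ s ^ (b + 2) * exp (-s) * m' s ^ 2 - p * s₀ * (s ^ b * exp (-s) * (m s - m s₀) ^ 2) := by
  obtain ⟨h0, hsg⟩ := rpow_sub_sign hp hp1 hs hs₀ hne
  have hφ := hasDerivAt_sub_rpow_neg (p := p) (c := s₀ ^ (-p)) hs
  have hW : HasDerivAt (fun t => p * (t ^ s₀ * exp (-t)))
      (p * (s₀ * s ^ (s₀ - 1) * exp (-s) + s ^ s₀ * (exp (-s) * (-1)))) s :=
    ((hasDerivAt_rpow_const (Or.inl hs.ne')).mul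
      ((hasDerivAt_id s).neg.exp)).const_mul p
  have hM : HasDerivAt (fun t => (m t - m s₀) ^ 2) (2 * (m s - m s₀) * m' s) s := by
    exact (((hm s hs).sub_const (m s₀)).fun_pow 2).congr_deriv (by norm_num)
  refine ⟨_, (hW.mul hM).div hφ h0, ?_⟩
  have key := gamma_poincare_pointwise (M := m s - m s₀) (D := m' s) (q := s ^ b * exp (-s))
    hp hs (by positivity) rfl h0 hsg
  have e1 : s ^ (b + 2) = s ^ b * s ^ 2 := by
    rw [rpow_add hs]; norm_cast
  have e2 : s ^ s₀ = s ^ b * s * s ^ (-p) := by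
    rw [← rpow_add_one hs.ne', ← rpow_add hs]; congr 1; rw [hb]; ring
  have e3 : s ^ (s₀ - 1) = s ^ b * s ^ (-p) := by
    rw [← rpow_add hs]; congr 1; rw [hb]; ring
  calc _ = _ := ?_
    _ ≤ _ := key
    _ = _ := by rw [e1]; ring
  rw [e2, e3]
  simp only [Pi.mul_apply]
  rw [e2]
  field_simp
  ring

/-- The weighted Poincaré inequality for the density `s ^ b e⁻ˢ` with the energy weight
`s ^ (b + 2) e⁻ˢ`, centred at the value of `m` at `s₀ = b + 1 - p`. It is obtained by writing
`m - m(s₀)` as a multiple of `s₀ ^ (-p) - s ^ (-p)`, which for `p = 1` is an eigenfunction of the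
associated Sturm-Liouville operator. -/
theorem gamma_poincare_shifted {p b s₀ : ℝ} (hp : 0 < p) (hp1 : p ≤ 1) (hs₀ : 0 < s₀)
    (hb : b = s₀ + p - 1) {m m' : ℝ → ℝ}
    (hm : ∀ s, 0 < s → HasDerivAt m (m' s) s)
    (hi1 : IntegrableOn (fun s => s ^ b * exp (-s) * (m s - m s₀) ^ 2) (Ioi 0))
    (hi2 : IntegrableOn (fun s => s ^ (b + 2) * exp (-s) * m' s ^ 2) (Ioi 0)) :
    p * s₀ * ∫ s in Ioi (0 : ℝ), s ^ b * exp (-s) * (m s - m s₀) ^ 2 ≤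
      ∫ s in Ioi (0 : ℝ), s ^ (b + 2) * exp (-s) * m' s ^ 2 := by
  set B : ℝ → ℝ := fun t => p * (t ^ s₀ * exp (-t)) * (m t - m s₀) ^ 2 /
      (s₀ ^ (-p) - t ^ (-p)) with hB
  set R : ℝ → ℝ := fun s => s ^ (b + 2) * exp (-s) * m' s ^ 2 -
    p * s₀ * (s ^ b * exp (-s) * (m s - m s₀) ^ 2) with hR
  have hRi : IntegrableOn R (Ioi 0) := hi2.sub (hi1.const_mul _)
  have hB0 : B s₀ = 0 := by simp [hB]
  choose! D hD using fun s (hs : 0 < s ∧ s ≠ s₀) =>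
    hasDerivAt_gamma_aux hp hp1 hs₀ hb hm hs.1 hs.2
  have step : ∀ α β, 0 < α → α ≤ β → (∀ s ∈ Ioo α β, s ≠ s₀) →
      B β - B α ≤ ∫ s in α..β, R s := by
    intro α β hα hαβ hne
    refine intervalIntegral.sub_le_integral_of_hasDeriv_right_of_le (g' := D) hαβ ?_ ?_ ?_ ?_
    · exact fun s hs => (continuousAt_gamma_aux hp hs₀ hp1 hm
        (hα.trans_le hs.1)).continuousWithinAt
    · exact fun s hs => (hD s ⟨hα.trans hs.1, hne s hs⟩).1.hasDerivWithinAt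
    · exact hRi.mono_set fun s hs => hα.trans_le hs.1
    · exact fun s hs => (hD s ⟨hα.trans hs.1, hne s hs⟩).2
  have hleft : ∀ α, 0 < α → α ≤ s₀ → 0 ≤ ∫ s in α..s₀, R s := by
    intro α hα h
    have h1 := step α s₀ hα h (fun s hs => hs.2.ne)
    have h2 : B α ≤ 0 := by
      have : s₀ ^ (-p) ≤ α ^ (-p) := rpow_le_rpow_of_nonpos hα h (by linarith)
      exact div_nonpos_of_nonneg_of_nonpos (by positivity) (by linarith)
    linarith
  have hright : ∀ β, s₀ ≤ β → 0 ≤ ∫ s in s₀..β, R s := by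
    intro β h
    have h1 := step s₀ β hs₀ h (fun s hs => hs.1.ne')
    have h2 : 0 ≤ B β := by
      have : β ^ (-p) ≤ s₀ ^ (-p) := rpow_le_rpow_of_nonpos hs₀ h (by linarith)
      have := hs₀.trans_le h
      exact div_nonneg (by positivity) (by linarith)
    linarith
  have hfull : ∀ n : ℕ, 0 ≤ ∫ s in Ioc (s₀ / (n + 1)) (s₀ + n), R s := by
    intro n
    have hn : (0 : ℝ) < n + 1 := by positivity
    have h1 : s₀ / (n + 1) ≤ s₀ := div_le_self hs₀.le (by linarith)
    have h2 : s₀ ≤ s₀ + n := by linarith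
    have h3 : 0 < s₀ / (n + 1) := by positivity
    rw [← intervalIntegral.integral_of_le (h1.trans h2),
      ← intervalIntegral.integral_add_adjacent_intervals (b := s₀)]
    · exact add_nonneg (hleft _ h3 h1) (hright _ h2)
    · exact (intervalIntegrable_iff_integrableOn_Ioc_of_le h1).2
        (hRi.mono_set fun s hs => h3.trans hs.1)
    · exact (intervalIntegrable_iff_integrableOn_Ioc_of_le h2).2
        (hRi.mono_set fun s hs => hs₀.trans hs.1)
  have hcov : AECover (volume.restrict (Ioi (0 : ℝ))) atTop
      (fun n : ℕ => Ioc (s₀ / (n + 1)) (s₀ + n)) := by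
    refine ⟨(ae_restrict_iff' measurableSet_Ioi).2 (Eventually.of_forall fun s hs => ?_),
      fun _ => measurableSet_Ioc⟩
    have h1 : Tendsto (fun n : ℕ => s₀ / ((n : ℝ) + 1)) atTop (𝓝 0) := by
      have := tendsto_one_div_add_atTop_nhds_zero_nat (𝕜 := ℝ) |>.const_mul s₀
      simpa [div_eq_mul_inv] using this
    have h2 : Tendsto (fun n : ℕ => s₀ + (n : ℝ)) atTop atTop :=
      tendsto_atTop_add_const_left _ _ tendsto_natCast_atTop_atTop
    filter_upwards [h1.eventually (gt_mem_nhds hs), h2.eventually (eventually_ge_atTop s)]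
      with n h3 h4 using ⟨h3, h4⟩
  have hlim := hcov.integral_tendsto_of_countably_generated hRi
  have hge : 0 ≤ ∫ s in Ioi (0 : ℝ), R s := by
    refine ge_of_tendsto' hlim fun n => ?_
    have h3 : 0 < s₀ / ((n : ℝ) + 1) := by positivity
    rw [Measure.restrict_restrict measurableSet_Ioc,
      inter_eq_self_of_subset_left (Ioc_subset_Ioi_self.trans (Ioi_subset_Ioi h3.le))]
    exact hfull n
  rw [integral_sub hi2 (hi1.const_mul _), integral_const_mul] at hge
  linarith

lemma integrableOn_rpow_mul_exp_neg {b : ℝ} (hb : -1 < b) :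
    IntegrableOn (fun s => s ^ b * exp (-s)) (Ioi 0) := by
  have := GammaIntegral_convergent (s := b + 1) (by linarith)
  simpa [mul_comm] using this

lemma integral_rpow_mul_exp_neg {b : ℝ} (hb : -1 < b) :
    ∫ s in Ioi (0 : ℝ), s ^ b * exp (-s) = Gamma (b + 1) := by
  rw [Gamma_eq_integral (by linarith)]
  simp [mul_comm]

/-- Poincaré inequality on the half-line for the Gamma density `s ^ b e⁻ˢ`, with the energy
`∫ s ^ (b + 2) e⁻ˢ m'²`. The free parameter `p ∈ (0, 1]` gives the constant `p (b + 1 - p)`. -/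
theorem gamma_poincare {p b : ℝ} (hp : 0 < p) (hp1 : p ≤ 1) (hb : p < b + 1) {m m' : ℝ → ℝ}
    (hm : ∀ s, 0 < s → HasDerivAt m (m' s) s)
    (hi0 : IntegrableOn (fun s => s ^ b * exp (-s) * m s) (Ioi 0))
    (hi1 : IntegrableOn (fun s => s ^ b * exp (-s) * m s ^ 2) (Ioi 0))
    (hi2 : IntegrableOn (fun s => s ^ (b + 2) * exp (-s) * m' s ^ 2) (Ioi 0)) :
    p * (b + 1 - p) * ((∫ s in Ioi (0 : ℝ), s ^ b * exp (-s) * m s ^ 2)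
      - (∫ s in Ioi (0 : ℝ), s ^ b * exp (-s) * m s) ^ 2 / Gamma (b + 1)) ≤
      ∫ s in Ioi (0 : ℝ), s ^ (b + 2) * exp (-s) * m' s ^ 2 := by
  set k := m (b + 1 - p) with hk
  have hG : 0 < Gamma (b + 1) := Gamma_pos_of_pos (by linarith)
  have hq := integrableOn_rpow_mul_exp_neg (b := b) (by linarith)
  have e : ∀ s : ℝ, s ^ b * exp (-s) * (m s - k) ^ 2 = s ^ b * exp (-s) * m s ^ 2
      - 2 * k * (s ^ b * exp (-s) * m s) + k ^ 2 * (s ^ b * exp (-s)) := fun s => by ring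
  have hA : IntegrableOn (fun s => s ^ b * exp (-s) * m s ^ 2
      - 2 * k * (s ^ b * exp (-s) * m s)) (Ioi 0) := hi1.sub (hi0.const_mul _)
  have hsh := gamma_poincare_shifted hp hp1 (s₀ := b + 1 - p) (b := b) (by linarith) (by ring) hm
    (by simp_rw [← hk, e]; exact hA.add (hq.const_mul _)) hi2
  simp_rw [← hk, e] at hsh
  rw [integral_add hA (hq.const_mul _), integral_sub hi1 (hi0.const_mul _), integral_const_mul,
    integral_const_mul, integral_rpow_mul_exp_neg (by linarith)] at hsh
  refine le_trans (mul_le_mul_of_nonneg_left ?_ (mul_nonneg hp.le (by linarith))) hsh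
  set I := ∫ s in Ioi (0 : ℝ), s ^ b * exp (-s) * m s
  have : 0 ≤ (k * Gamma (b + 1) - I) ^ 2 / Gamma (b + 1) := by positivity
  have h2 : (k * Gamma (b + 1) - I) ^ 2 / Gamma (b + 1) =
      k ^ 2 * Gamma (b + 1) - 2 * k * I + I ^ 2 / Gamma (b + 1) := by
    field_simp
    ring
  linarith

/-! ### Gaussian integrals in Fourier variables -/

section Fourier
open scoped FourierTransform ComplexConjugate SchwartzMap RealInnerProductSpace LineDeriv

/-- The normalisation `∫ exp (-s |x|²) dx = (π / s) ^ (d / 2)`. -/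
noncomputable def gaussianMass (V : Type*) [NormedAddCommGroup V] [InnerProductSpace ℝ V]
    (s : ℝ) : ℝ :=
  (π / s) ^ (Module.finrank ℝ V / 2 : ℝ)

lemma gaussianMass_pos {V : Type*} [NormedAddCommGroup V] [InnerProductSpace ℝ V]
    {s : ℝ} (hs : 0 < s) : 0 < gaussianMass V s :=
  rpow_pos_of_pos (by positivity) _

variable {V : Type*} [NormedAddCommGroup V] [InnerProductSpace ℝ V] [FiniteDimensional ℝ V]
  [MeasurableSpace V] [BorelSpace V]

lemma integrable_gaussian {s : ℝ} (hs : 0 < s) :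
    Integrable (fun x : V => exp (-s * ‖x‖ ^ 2)) := by
  have h := GaussianFourier.integrable_cexp_neg_mul_sq_norm_add (V := V) (b := (s : ℂ))
    (by simpa) 0 0
  refine h.norm.congr (Eventually.of_forall fun x => ?_)
  simp only [Complex.norm_exp]
  simp [← Complex.ofReal_pow]

lemma integral_char_mul_gaussian {s : ℝ} (hs : 0 < s) (w : V) :
    ∫ x : V, Complex.exp (↑(2 * π * ⟪w, x⟫) * Complex.I) * (exp (-s * ‖x‖ ^ 2) : ℝ) =
      (gaussianMass V s : ℂ) * (exp (-(π ^ 2 / s) * ‖w‖ ^ 2) : ℝ) := by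
  have h := GaussianFourier.integral_cexp_neg_mul_sq_norm_add (V := V) (b := (s : ℂ)) (by simpa)
    (2 * π * Complex.I) w
  rw [gaussianMass, Complex.ofReal_cpow (by positivity)]
  convert h using 2
  · ext x
    rw [Complex.ofReal_exp, ← Complex.exp_add]
    push_cast
    congr 1
    ring
  · push_cast; rfl
  · rw [Complex.ofReal_exp]
    congr 1
    have : (s : ℂ) ≠ 0 := by exact_mod_cast hs.ne'
    push_cast
    field_simp
    simp only [Complex.I_sq]
    ring

/-- A superposition of plane waves integrated against a Gaussian. -/
lemma integral_superposition_mul_gaussian {α : Type*} [MeasurableSpace α] {μ : Measure α}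
    [SFinite μ] {Φ : α → ℂ} (hΦ : Integrable Φ μ) {L : α → V} (hL : Measurable L) {s : ℝ}
    (hs : 0 < s) :
    ∫ x : V, (∫ a, Complex.exp (↑(2 * π * ⟪L a, x⟫) * Complex.I) * Φ a ∂μ) *
      (exp (-s * ‖x‖ ^ 2) : ℝ) =
      (gaussianMass V s : ℂ) * ∫ a, Φ a * (exp (-(π ^ 2 / s) * ‖L a‖ ^ 2) : ℝ) ∂μ := by
  have hint : Integrable (fun p : V × α => Complex.exp (↑(2 * π * ⟪L p.2, p.1⟫) * Complex.I) *
      (((exp (-s * ‖p.1‖ ^ 2) : ℝ) : ℂ) * Φ p.2)) (volume.prod μ) := by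
    have h1 : Integrable (fun p : V × α => ((exp (-s * ‖p.1‖ ^ 2) : ℝ) : ℂ) * Φ p.2)
      (volume.prod μ) := (integrable_gaussian hs).ofReal.mul_prod hΦ
    refine h1.bdd_mul (c := 1) ?_ (Eventually.of_forall fun p => ?_)
    · have : Measurable fun p : V × α => ⟪L p.2, p.1⟫ :=
        (hL.comp measurable_snd).inner measurable_fst
      exact (Complex.measurable_exp.comp
        ((Complex.measurable_ofReal.comp (this.const_mul _)).mul_const _)).aestronglyMeasurable
    · rw [Complex.norm_exp_ofReal_mul_I]
  simp_rw [← integral_mul_const]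
  rw [integral_integral_swap (f := fun (x : V) (a : α) =>
    Complex.exp (↑(2 * π * ⟪L a, x⟫) * Complex.I) * Φ a * (exp (-s * ‖x‖ ^ 2) : ℝ))]
  · rw [← integral_const_mul]
    congr 1 with a
    rw [mul_left_comm, ← integral_char_mul_gaussian hs, ← integral_const_mul]
    congr 1 with x
    ring
  · refine hint.congr (Eventually.of_forall fun p => ?_)
    simp only [Function.uncurry]
    ring

/-- The kernel `exp (-c |ξ - ζ|²)`, weighted by the real part of `φ(ξ) conj φ(ζ)`, represents the
Gaussian mean of the squared modulus of the inverse Fourier transform of `φ`. -/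
lemma integral_normSq_mul_gaussian {f φ : V → ℂ} (hφ : Integrable φ)
    (hf : ∀ x, f x = ∫ ξ, Complex.exp (↑(2 * π * ⟪ξ, x⟫) * Complex.I) * φ ξ) {s : ℝ} (hs : 0 < s) :
    ∫ x : V, ‖f x‖ ^ 2 * exp (-s * ‖x‖ ^ 2) =
      gaussianMass V s * ∫ p : V × V, (φ p.1 * conj (φ p.2)).re *
        exp (-(π ^ 2 / s) * ‖p.1 - p.2‖ ^ 2) := by
  have hΦ : Integrable (fun p : V × V => φ p.1 * conj (φ p.2)) :=
    hφ.mul_prod (Complex.conjLIE.integrable_comp_iff.2 hφ)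
  have h := integral_superposition_mul_gaussian hΦ (L := fun p : V × V => p.1 - p.2)
    (measurable_fst.sub measurable_snd) hs
  have e : ∀ x : V, ∫ p : V × V, Complex.exp (↑(2 * π * ⟪p.1 - p.2, x⟫) * Complex.I) *
      (φ p.1 * conj (φ p.2)) = ((‖f x‖ ^ 2 : ℝ) : ℂ) := by
    intro x
    have h1 := integral_prod_mul (μ := (volume : Measure V)) (ν := (volume : Measure V))
      (fun ξ => Complex.exp (↑(2 * π * ⟪ξ, x⟫) * Complex.I) * φ ξ)
      (fun ξ => conj (Complex.exp (↑(2 * π * ⟪ξ, x⟫) * Complex.I) * φ ξ))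
    rw [integral_conj, ← hf, Complex.mul_conj, Complex.normSq_eq_norm_sq] at h1
    rw [← h1]
    congr 1 with p
    rw [map_mul, ← Complex.exp_conj, inner_sub_left]
    rw [show (↑(2 * π * (⟪p.1, x⟫ - ⟪p.2, x⟫)) : ℂ) * Complex.I =
      ↑(2 * π * ⟪p.1, x⟫) * Complex.I + conj (↑(2 * π * ⟪p.2, x⟫) * Complex.I) by
        rw [map_mul, Complex.conj_I, Complex.conj_ofReal]; push_cast; ring, Complex.exp_add]
    ring
  simp_rw [e, ← Complex.ofReal_mul] at h
  rw [integral_complex_ofReal] at h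
  have h2 := congrArg Complex.re h
  rw [Complex.ofReal_re, Complex.re_ofReal_mul] at h2
  rw [h2]
  congr 1
  have hint : Integrable (fun p : V × V => φ p.1 * conj (φ p.2) *
      (exp (-(π ^ 2 / s) * ‖p.1 - p.2‖ ^ 2) : ℝ)) := by
    refine hΦ.mul_bdd (c := 1) ?_ (Eventually.of_forall fun p => ?_)
    · exact (by fun_prop : Continuous fun p : V × V =>
        ((exp (-(π ^ 2 / s) * ‖p.1 - p.2‖ ^ 2) : ℝ) : ℂ)).aestronglyMeasurable
    · rw [Complex.norm_real, norm_of_nonneg (exp_pos _).le, exp_le_one_iff, neg_mul]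
      have : 0 ≤ π ^ 2 / s * ‖p.1 - p.2‖ ^ 2 := by positivity
      linarith
  have h3 := integral_re hint
  simp only [RCLike.re_to_complex] at h3
  rw [← h3]
  congr 1 with p
  rw [mul_comm, Complex.re_ofReal_mul, mul_comm]

lemma integral_mul_gaussian {f φ : V → ℂ} (hφ : Integrable φ)
    (hf : ∀ x, f x = ∫ ξ, Complex.exp (↑(2 * π * ⟪ξ, x⟫) * Complex.I) * φ ξ) {s : ℝ} (hs : 0 < s) :
    ∫ x : V, f x * (exp (-s * ‖x‖ ^ 2) : ℝ) =
      (gaussianMass V s : ℂ) * ∫ ξ, φ ξ * (exp (-(π ^ 2 / s) * ‖ξ‖ ^ 2) : ℝ) := by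
  simp_rw [hf]
  exact integral_superposition_mul_gaussian hφ measurable_id hs

/-- Fourier inversion for Schwartz functions, written out. -/
lemma schwartz_eq_integral_fourier (f : 𝓢(V, ℂ)) (x : V) :
    f x = ∫ ξ, Complex.exp (↑(2 * π * ⟪ξ, x⟫) * Complex.I) * (𝓕 f) ξ := by
  conv_lhs => rw [← FourierTransform.fourierInv_fourier_eq (F := 𝓢(V, ℂ)) f]
  rw [SchwartzMap.fourierInv_coe, Real.fourierInv_eq']
  simp

lemma fourier_lineDeriv_apply (f : 𝓢(V, ℂ)) (v ξ : V) :
    (𝓕 (∂_{v} f)) ξ = 2 * π * Complex.I * (⟪ξ, v⟫ : ℝ) * (𝓕 f) ξ := by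
  have : (inner ℝ · v).HasTemperateGrowth := ((innerSL ℝ (E := V)).flip v).hasTemperateGrowth
  rw [SchwartzMap.fourier_lineDerivOp_eq]
  simp [this, mul_assoc]

end Fourier

/-! ### Positive definite kernels -/

section Kernel
open scoped FourierTransform ComplexConjugate SchwartzMap RealInnerProductSpace LineDeriv Nat

/-- The exponential series weighted by `k - 1 - σ`, without its terms of degree at most `3`.
All its coefficients are nonnegative when `σ ≤ 3`. -/
noncomputable def expTail (σ y : ℝ) : ℝ :=
  (y - 1 - σ) * exp y + (1 + σ) + σ * y - (1 - σ) / 2 * y ^ 2 - (2 - σ) / 6 * y ^ 3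

lemma hasSum_expTail (σ y : ℝ) :
    HasSum (fun n : ℕ => (((n + 4 : ℕ) : ℝ) - 1 - σ) / (n + 4)! * y ^ (n + 4)) (expTail σ y) := by
  have h1 : HasSum (fun n : ℕ => y ^ n / n !) (exp y) := by
    rw [Real.exp_eq_exp_ℝ]; exact NormedSpace.expSeries_div_hasSum_exp y
  have h2 : HasSum (fun n : ℕ => (n : ℝ) * y ^ n / n !) (y * exp y) := by
    rw [← hasSum_nat_add_iff' 1]
    simp only [Finset.sum_range_one, Nat.cast_zero, zero_mul, zero_div, sub_zero]
    refine (h1.mul_left y).congr_fun fun n => ?_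
    rw [Nat.factorial_succ]
    push_cast
    field_simp
    ring
  have h3 := h2.sub (h1.mul_left (1 + σ))
  rw [← hasSum_nat_add_iff' 4] at h3
  have e : y * exp y - (1 + σ) * exp y - ∑ i ∈ Finset.range 4,
      ((i : ℝ) * y ^ i / (i)! - (1 + σ) * (y ^ i / (i)!)) = expTail σ y := by
    simp only [Finset.sum_range_succ, Finset.sum_range_zero, expTail, Nat.factorial]
    push_cast
    ring
  rw [e] at h3
  refine h3.congr_fun fun n => ?_
  ring

lemma pow_le_factorial_mul_exp {y : ℝ} (hy : 0 ≤ y) (k : ℕ) : y ^ k ≤ k ! * exp y := by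
  have := Real.pow_div_factorial_le_exp y hy k
  rwa [div_le_iff₀' (by positivity)] at this

variable {d : ℕ}

local notation "𝔼" => EuclideanSpace ℝ (Fin d)

lemma abs_apply_le_norm (ξ : 𝔼) (i : Fin d) : |ξ i| ≤ ‖ξ‖ := PiLp.norm_apply_le ξ i

/-- A kernel of the form `∑ₐ uₐ(ξ) uₐ(ζ)` is positive semidefinite. -/
lemma integral_kernel_eq_sum {ι : Type*} [Fintype ι] {M : 𝔼 → ℂ} {u : ι → 𝔼 → ℝ}
    (hu : ∀ a, Integrable fun ξ => M ξ * (u a ξ : ℂ)) :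
    ∫ p : 𝔼 × 𝔼, (M p.1 * conj (M p.2)).re * ∑ a, u a p.1 * u a p.2 =
      ∑ a, ‖∫ ξ, M ξ * (u a ξ : ℂ)‖ ^ 2 := by
  have h : ∀ a, Integrable (fun p : 𝔼 × 𝔼 => (M p.1 * (u a p.1 : ℂ)) *
      conj (M p.2 * (u a p.2 : ℂ))) :=
    fun a => (hu a).mul_prod (Complex.conjLIE.integrable_comp_iff.2 (hu a))
  have e : ∀ p : 𝔼 × 𝔼, (M p.1 * conj (M p.2)).re * ∑ a, u a p.1 * u a p.2 =
      ∑ a, ((M p.1 * (u a p.1 : ℂ)) * conj (M p.2 * (u a p.2 : ℂ))).re := by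
    intro p
    rw [Finset.mul_sum]
    refine Finset.sum_congr rfl fun a _ => ?_
    rw [map_mul, Complex.conj_ofReal, show M p.1 * (u a p.1 : ℂ) * (conj (M p.2) * (u a p.2 : ℂ))
      = ((u a p.1 * u a p.2 : ℝ) : ℂ) * (M p.1 * conj (M p.2)) by push_cast; ring,
      Complex.re_ofReal_mul, mul_comm]
  simp_rw [e]
  have hre : ∀ a, Integrable (fun p : 𝔼 × 𝔼 =>
      ((M p.1 * (u a p.1 : ℂ)) * conj (M p.2 * (u a p.2 : ℂ))).re) := fun a => (h a).re
  rw [integral_finsetSum _ fun a _ => hre a]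
  refine Finset.sum_congr rfl fun a _ => ?_
  have h1 := integral_re (h a)
  simp only [RCLike.re_to_complex] at h1
  rw [h1]
  have h2 := integral_prod_mul (μ := (volume : Measure 𝔼)) (ν := (volume : Measure 𝔼))
    (fun ξ => M ξ * (u a ξ : ℂ)) (fun ξ => conj (M ξ * (u a ξ : ℂ)))
  rw [integral_conj, Complex.mul_conj, Complex.normSq_eq_norm_sq] at h2
  rw [← Measure.volume_eq_prod] at h2
  rw [h2, Complex.ofReal_re]

lemma inner_pow_eq_sum (k : ℕ) (ξ ζ : 𝔼) :
    ⟪ξ, ζ⟫ ^ k = ∑ α : Fin k → Fin d, (∏ j, ξ (α j)) * ∏ j, ζ (α j) := by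
  have : ⟪ξ, ζ⟫ = ∑ i, ξ i * ζ i := by simp [PiLp.inner_apply, mul_comm]
  rw [this, Fintype.sum_pow]
  simp_rw [Finset.prod_mul_distrib]

/-- An amplitude in Fourier variables that decays fast enough for all integrals against
`exp (2 c ⟪ξ, ζ⟫)` and its derivative to converge. -/
structure GaussianAmplitude (c : ℝ) (M : EuclideanSpace ℝ (Fin d) → ℂ) : Prop where
  moments : ∀ (k : ℕ) (u : EuclideanSpace ℝ (Fin d) → ℝ), Continuous u →
    (∀ ξ, |u ξ| ≤ ‖ξ‖ ^ k) → Integrable fun ξ => M ξ * (u ξ : ℂ)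
  kernel : Integrable fun p : EuclideanSpace ℝ (Fin d) × EuclideanSpace ℝ (Fin d) =>
    (M p.1 * conj (M p.2)).re * ((1 + |2 * c * ⟪p.1, p.2⟫|) * exp |2 * c * ⟪p.1, p.2⟫|)

lemma gaussianAmplitude_schwartz (F : 𝓢(𝔼, ℂ)) {c : ℝ} (hc : 0 ≤ c) :
    GaussianAmplitude c fun ξ => F ξ * (exp (-c * ‖ξ‖ ^ 2) : ℝ) := by
  have hexp1 : ∀ ξ : 𝔼, exp (-c * ‖ξ‖ ^ 2) ≤ 1 := fun ξ => by
    rw [exp_le_one_iff, neg_mul]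
    have : 0 ≤ c * ‖ξ‖ ^ 2 := by positivity
    linarith
  constructor
  · intro k u hu hb
    refine (F.integrable_pow_mul volume k).mono' ?_ (Eventually.of_forall fun ξ => ?_)
    · exact (by have := F.continuous; fun_prop : Continuous fun ξ =>
        F ξ * (exp (-c * ‖ξ‖ ^ 2) : ℝ) * (u ξ : ℂ)).aestronglyMeasurable
    · rw [norm_mul, norm_mul, Complex.norm_real, Complex.norm_real, norm_of_nonneg (exp_pos _).le,
        norm_eq_abs]
      calc ‖F ξ‖ * exp (-c * ‖ξ‖ ^ 2) * |u ξ| ≤ ‖F ξ‖ * 1 * ‖ξ‖ ^ k := by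
            gcongr
            · exact hexp1 ξ
            · exact hb ξ
        _ = _ := by ring
  · have h0 : Integrable (fun p : 𝔼 × 𝔼 => ‖F p.1‖ * ‖F p.2‖) :=
      F.integrable.norm.mul_prod F.integrable.norm
    have h1 : Integrable (fun p : 𝔼 × 𝔼 => (‖p.1‖ ^ 1 * ‖F p.1‖) * (‖p.2‖ ^ 1 * ‖F p.2‖)) :=
      (F.integrable_pow_mul volume 1).mul_prod (F.integrable_pow_mul volume 1)
    refine (h0.add (h1.const_mul (2 * c))).mono' ?_ (Eventually.of_forall fun p => ?_)
    · have := F.continuous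
      refine Continuous.aestronglyMeasurable ?_
      refine Continuous.mul (Complex.continuous_re.comp ?_) (by fun_prop)
      exact ((by fun_prop : Continuous fun p : 𝔼 × 𝔼 => F p.1 * (exp (-c * ‖p.1‖ ^ 2) : ℝ)).mul
        (Complex.continuous_conj.comp (by fun_prop : Continuous fun p : 𝔼 × 𝔼 =>
          F p.2 * (exp (-c * ‖p.2‖ ^ 2) : ℝ))))
    · set y := 2 * c * ⟪p.1, p.2⟫ with hy
      have hy1 : |y| ≤ 2 * c * (‖p.1‖ * ‖p.2‖) := by
        rw [hy, abs_mul, abs_of_nonneg (by positivity)]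
        gcongr
        exact abs_real_inner_le_norm _ _
      have hy2 : |y| ≤ c * ‖p.1‖ ^ 2 + c * ‖p.2‖ ^ 2 := by
        nlinarith [mul_nonneg hc (sq_nonneg (‖p.1‖ - ‖p.2‖))]
      have h3 : |(F p.1 * (exp (-c * ‖p.1‖ ^ 2) : ℝ) *
          conj (F p.2 * (exp (-c * ‖p.2‖ ^ 2) : ℝ))).re| ≤
          ‖F p.1‖ * ‖F p.2‖ * exp (-(c * ‖p.1‖ ^ 2 + c * ‖p.2‖ ^ 2)) := by
        refine (Complex.abs_re_le_norm _).trans (le_of_eq ?_)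
        rw [norm_mul, RCLike.norm_conj, norm_mul, norm_mul, Complex.norm_real, Complex.norm_real,
          norm_of_nonneg (exp_pos _).le, norm_of_nonneg (exp_pos _).le, neg_add, exp_add]
        simp only [neg_mul]
        ring
      rw [norm_mul, norm_eq_abs, norm_of_nonneg (by positivity)]
      calc _ ≤ ‖F p.1‖ * ‖F p.2‖ * exp (-(c * ‖p.1‖ ^ 2 + c * ‖p.2‖ ^ 2)) *
            ((1 + 2 * c * (‖p.1‖ * ‖p.2‖)) * exp (c * ‖p.1‖ ^ 2 + c * ‖p.2‖ ^ 2)) := by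
            gcongr
        _ = ‖F p.1‖ * ‖F p.2‖ * (1 + 2 * c * (‖p.1‖ * ‖p.2‖)) := by
            rw [exp_neg]; field_simp
        _ = _ := by simp only [Pi.add_apply]; ring

variable {c : ℝ} {M : EuclideanSpace ℝ (Fin d) → ℂ}

lemma GaussianAmplitude.aestronglyMeasurable (hM : GaussianAmplitude c M) :
    AEStronglyMeasurable M := by
  have := hM.moments 0 (fun _ => 1) continuous_const (by simp)
  simpa using this.aestronglyMeasurable

lemma GaussianAmplitude.integrable_kernel (hM : GaussianAmplitude c M) {h : ℝ → ℝ}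
    (hc : Continuous h) {C : ℝ} (hb : ∀ y, |h y| ≤ C * ((1 + |y|) * exp |y|)) :
    Integrable fun p : 𝔼 × 𝔼 => (M p.1 * conj (M p.2)).re * h (2 * c * ⟪p.1, p.2⟫) := by
  have hm := hM.aestronglyMeasurable
  have hMm : AEStronglyMeasurable (fun p : 𝔼 × 𝔼 => (M p.1 * conj (M p.2)).re) := by
    refine Complex.continuous_re.comp_aestronglyMeasurable ?_
    refine AEStronglyMeasurable.mul ?_ (Complex.continuous_conj.comp_aestronglyMeasurable ?_)
    · exact hm.comp_fst
    · exact hm.comp_snd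
  refine (hM.kernel.norm.const_mul C).mono' ?_ (Eventually.of_forall fun p => ?_)
  · exact hMm.mul (by fun_prop : Continuous fun p : 𝔼 × 𝔼 =>
      h (2 * c * ⟪p.1, p.2⟫)).aestronglyMeasurable
  · rw [norm_mul, norm_mul, norm_eq_abs, norm_eq_abs, mul_left_comm,
      norm_of_nonneg (r := (1 + |2 * c * ⟪p.1, p.2⟫|) * exp |2 * c * ⟪p.1, p.2⟫|) (by positivity)]
    exact mul_le_mul_of_nonneg_left (hb _) (abs_nonneg _)

lemma GaussianAmplitude.integral_pow_nonneg (hM : GaussianAmplitude c M) (hc : 0 ≤ c) (k : ℕ) :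
    0 ≤ ∫ p : 𝔼 × 𝔼, (M p.1 * conj (M p.2)).re * (2 * c * ⟪p.1, p.2⟫) ^ k := by
  have h := integral_kernel_eq_sum (M := M)
    (u := fun (α : Fin k → Fin d) (ξ : 𝔼) => ∏ j, ξ (α j)) fun α => by
      refine hM.moments k _ (by fun_prop) fun ξ => ?_
      rw [Finset.abs_prod]
      calc ∏ j, |ξ (α j)| ≤ ∏ _j : Fin k, ‖ξ‖ :=
            Finset.prod_le_prod (fun _ _ => abs_nonneg _) fun j _ => abs_apply_le_norm ξ _
        _ = ‖ξ‖ ^ k := by simp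
  simp_rw [← inner_pow_eq_sum] at h
  simp_rw [mul_pow _ ⟪_, _⟫, mul_left_comm _ ((2 * c) ^ k)]
  rw [integral_const_mul, h]
  positivity

lemma expTail_neg_one_nonneg {y : ℝ} (hy : 0 ≤ y) : 0 ≤ expTail (-1) y :=
  (hasSum_expTail (-1) y).nonneg fun n => by
    have : ((n + 4 : ℕ) : ℝ) - 1 - -1 = n + 4 := by push_cast; ring
    rw [this]; positivity

lemma abs_expTail_le (y : ℝ) : |expTail (-1) (|y|)| ≤ 1 * ((1 + |y|) * exp |y|) := by
  rw [abs_of_nonneg (expTail_neg_one_nonneg (abs_nonneg y)), expTail]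
  have := abs_nonneg y
  have := exp_pos |y|
  have : 0 ≤ |y| ^ 3 := by positivity
  nlinarith [sq_nonneg |y|]

/-- Positivity of the part of degree at least `4` of the Gaussian Dirichlet form: every power of
the inner product is a positive semidefinite kernel. -/
lemma GaussianAmplitude.integral_expTail_nonneg (hM : GaussianAmplitude c M) (hc : 0 ≤ c) {σ : ℝ}
    (hσ1 : -1 ≤ σ) (hσ : σ ≤ 3) :
    0 ≤ ∫ p : 𝔼 × 𝔼, (M p.1 * conj (M p.2)).re * expTail σ (2 * c * ⟪p.1, p.2⟫) := by
  have hcoef : ∀ n : ℕ, 0 ≤ (((n + 4 : ℕ) : ℝ) - 1 - σ) / (n + 4)! := fun n => by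
    have : (0 : ℝ) ≤ n := n.cast_nonneg
    refine div_nonneg ?_ (by positivity)
    push_cast; linarith
  have hpow : ∀ k : ℕ, Integrable fun p : 𝔼 × 𝔼 =>
      (M p.1 * conj (M p.2)).re * (2 * c * ⟪p.1, p.2⟫) ^ k := fun k =>
    hM.integrable_kernel (h := fun y => y ^ k) (by fun_prop) (C := k !) fun y => by
      rw [abs_pow]
      refine (pow_le_factorial_mul_exp (abs_nonneg y) k).trans ?_
      have := abs_nonneg y
      have := exp_pos |y|
      gcongr
      nlinarith
  have hs := hasSum_integral_of_dominated_convergence (μ := (volume : Measure (𝔼 × 𝔼)))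
    (F := fun (n : ℕ) (p : 𝔼 × 𝔼) => (M p.1 * conj (M p.2)).re *
      ((((n + 4 : ℕ) : ℝ) - 1 - σ) / (n + 4)! * (2 * c * ⟪p.1, p.2⟫) ^ (n + 4)))
    (f := fun p => (M p.1 * conj (M p.2)).re * expTail σ (2 * c * ⟪p.1, p.2⟫))
    (fun (n : ℕ) (p : 𝔼 × 𝔼) => |(M p.1 * conj (M p.2)).re| *
      ((((n + 4 : ℕ) : ℝ) - 1 - -1) / (n + 4)! * |2 * c * ⟪p.1, p.2⟫| ^ (n + 4)))
    (fun n => ?_) (fun n => Eventually.of_forall fun p => ?_)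
    (Eventually.of_forall fun p => ?_) ?_ (Eventually.of_forall fun p => ?_)
  · refine hs.nonneg fun n => ?_
    simp_rw [mul_left_comm]
    rw [integral_const_mul]
    exact mul_nonneg (hcoef n) (hM.integral_pow_nonneg hc _)
  · simp_rw [mul_left_comm]
    exact ((hpow (n + 4)).const_mul _).aestronglyMeasurable
  · rw [norm_mul, norm_mul, norm_pow, norm_eq_abs, norm_of_nonneg (hcoef n), norm_eq_abs]
    gcongr
  · exact ((hasSum_expTail (-1) _).mul_left _).summable
  · simp_rw [tsum_mul_left, (hasSum_expTail (-1) _).tsum_eq]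
    have h := (hM.integrable_kernel (h := fun y => expTail (-1) |y|)
      (by unfold expTail; fun_prop) abs_expTail_le).abs
    refine h.congr (Eventually.of_forall fun p => ?_)
    beta_reduce
    rw [abs_mul (M p.1 * conj (M p.2)).re, abs_of_nonneg (expTail_neg_one_nonneg (abs_nonneg _))]
  · exact (hasSum_expTail σ _).mul_left _

end Kernel

/-! ### The Gaussian spectral inequality -/

section GaussianGap
open scoped FourierTransform ComplexConjugate SchwartzMap RealInnerProductSpace LineDeriv Nat

variable {d : ℕ}

local notation "𝔼" => EuclideanSpace ℝ (Fin d)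

/-- The moment `∫ F(ξ) exp (-π² |ξ|² / s) u(ξ) dξ` in Fourier variables. For `F` the Fourier
transform of `f` and `u = 1` this is the mean of `f` under the Gaussian density proportional to
`exp (-s |x|²)`. -/
noncomputable def fourierMoment (F : EuclideanSpace ℝ (Fin d) → ℂ)
    (u : EuclideanSpace ℝ (Fin d) → ℝ) (s : ℝ) : ℂ :=
  ∫ ξ, F ξ * (exp (-(π ^ 2 / s) * ‖ξ‖ ^ 2) : ℝ) * (u ξ : ℂ)

lemma norm_sum_sq_le_card (z : Fin d → ℂ) : ‖∑ i, z i‖ ^ 2 ≤ d * ∑ i, ‖z i‖ ^ 2 := by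
  calc ‖∑ i, z i‖ ^ 2 ≤ (∑ i, ‖z i‖) ^ 2 := by gcongr; exact norm_sum_le _ _
    _ ≤ _ := by simpa using sq_sum_le_card_mul_sum_sq (s := Finset.univ) (f := fun i => ‖z i‖)

lemma norm_sq_eq_sum (ξ : 𝔼) : ‖ξ‖ ^ 2 = ∑ i, ξ i * ξ i := by
  rw [EuclideanSpace.real_norm_sq_eq]
  simp_rw [sq]

lemma inner_eq_sum (ξ ζ : 𝔼) : ⟪ξ, ζ⟫ = ∑ i, ξ i * ζ i := by simp [PiLp.inner_apply, mul_comm]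

lemma integral_linear_combination {α : Type*} [MeasurableSpace α] {μ : Measure α}
    {f₀ f₁ f₂ f₃ f₄ f₅ : α → ℝ} (h₀ : Integrable f₀ μ) (h₁ : Integrable f₁ μ)
    (h₂ : Integrable f₂ μ) (h₃ : Integrable f₃ μ) (h₄ : Integrable f₄ μ) (h₅ : Integrable f₅ μ)
    {a b e q r : ℝ} :
    ∫ x, (f₀ x - a * f₁ x + b * f₂ x + e * f₃ x - q * f₄ x - r * f₅ x) ∂μ =
      (∫ x, f₀ x ∂μ) - a * (∫ x, f₁ x ∂μ) + b * (∫ x, f₂ x ∂μ) + e * (∫ x, f₃ x ∂μ)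
        - q * (∫ x, f₄ x ∂μ) - r * ∫ x, f₅ x ∂μ := by
  have j1 : Integrable (fun x => f₀ x - a * f₁ x) μ := h₀.sub (h₁.const_mul a)
  have j2 : Integrable (fun x => f₀ x - a * f₁ x + b * f₂ x) μ := j1.add (h₂.const_mul b)
  have j3 : Integrable (fun x => f₀ x - a * f₁ x + b * f₂ x + e * f₃ x) μ :=
    j2.add (h₃.const_mul e)
  have j4 : Integrable (fun x => f₀ x - a * f₁ x + b * f₂ x + e * f₃ x - q * f₄ x) μ :=
    j3.sub (h₄.const_mul q)
  rw [integral_sub j4 (h₅.const_mul _), integral_sub j3 (h₄.const_mul _),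
    integral_add j2 (h₃.const_mul _), integral_add j1 (h₂.const_mul _),
    integral_sub h₀ (h₁.const_mul _)]
  simp_rw [integral_const_mul]

section moments
variable {c : ℝ} {M : EuclideanSpace ℝ (Fin d) → ℂ}

lemma GaussianAmplitude.integral_pow_zero (hM : GaussianAmplitude c M) :
    ∫ p : 𝔼 × 𝔼, (M p.1 * conj (M p.2)).re = ‖∫ ξ, M ξ * ((1 : ℝ) : ℂ)‖ ^ 2 := by
  have h := integral_kernel_eq_sum (M := M) (ι := Unit) (u := fun _ _ => 1)
    fun _ => hM.moments 0 _ continuous_const (by simp)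
  simpa using h

lemma GaussianAmplitude.integral_pow_one (hM : GaussianAmplitude c M) :
    ∫ p : 𝔼 × 𝔼, (M p.1 * conj (M p.2)).re * ⟪p.1, p.2⟫ =
      ∑ i, ‖∫ ξ, M ξ * (ξ i : ℂ)‖ ^ 2 := by
  have h := integral_kernel_eq_sum (M := M) (u := fun (i : Fin d) ξ => ξ i)
    fun i => hM.moments 1 _ (by fun_prop) fun ξ => by simpa using abs_apply_le_norm ξ i
  simpa only [← inner_eq_sum] using h

lemma GaussianAmplitude.le_integral_pow_two (hM : GaussianAmplitude c M) :
    ‖∫ ξ, M ξ * ((‖ξ‖ ^ 2 : ℝ) : ℂ)‖ ^ 2 ≤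
      d * ∫ p : 𝔼 × 𝔼, (M p.1 * conj (M p.2)).re * ⟪p.1, p.2⟫ ^ 2 := by
  have hi : ∀ i j : Fin d, Integrable fun ξ => M ξ * ((ξ i * ξ j : ℝ) : ℂ) :=
    fun i j => hM.moments 2 (fun ξ => ξ i * ξ j) (by fun_prop) fun ξ => by
      rw [abs_mul, sq]
      gcongr <;> exact abs_apply_le_norm _ _
  have h := integral_kernel_eq_sum (M := M) (u := fun (a : Fin d × Fin d) ξ => ξ a.1 * ξ a.2)
    fun a => hi a.1 a.2
  have e : ∀ p : 𝔼 × 𝔼, ∑ a : Fin d × Fin d, p.1 a.1 * p.1 a.2 * (p.2 a.1 * p.2 a.2) =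
      ⟪p.1, p.2⟫ ^ 2 := fun p => by
    rw [sq, inner_eq_sum, Finset.sum_mul_sum, Fintype.sum_prod_type]
    exact Finset.sum_congr rfl fun i _ => Finset.sum_congr rfl fun j _ => by ring
  simp_rw [e] at h
  have eL : ∫ ξ, M ξ * ((‖ξ‖ ^ 2 : ℝ) : ℂ) = ∑ i, ∫ ξ, M ξ * ((ξ i * ξ i : ℝ) : ℂ) := by
    simp_rw [norm_sq_eq_sum, Complex.ofReal_sum, Finset.mul_sum]
    exact integral_finsetSum _ fun i _ => hi i i
  rw [h, Fintype.sum_prod_type, eL]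
  refine (norm_sum_sq_le_card _).trans ?_
  refine mul_le_mul_of_nonneg_left (Finset.sum_le_sum fun i _ => ?_) (by positivity)
  exact Finset.single_le_sum (f := fun j => ‖∫ ξ, M ξ * ((ξ i * ξ j : ℝ) : ℂ)‖ ^ 2)
    (fun j _ => by positivity) (Finset.mem_univ i)

lemma GaussianAmplitude.le_integral_pow_three (hM : GaussianAmplitude c M) :
    ∑ i, ‖∫ ξ, M ξ * ((ξ i * ‖ξ‖ ^ 2 : ℝ) : ℂ)‖ ^ 2 ≤
      d * ∫ p : 𝔼 × 𝔼, (M p.1 * conj (M p.2)).re * ⟪p.1, p.2⟫ ^ 3 := by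
  have hi : ∀ i j k : Fin d, Integrable fun ξ => M ξ * ((ξ i * (ξ j * ξ k) : ℝ) : ℂ) :=
    fun i j k => hM.moments 3 (fun ξ => ξ i * (ξ j * ξ k)) (by fun_prop) fun ξ => by
      rw [abs_mul, abs_mul, pow_succ', sq]
      gcongr <;> exact abs_apply_le_norm _ _
  have h := integral_kernel_eq_sum (M := M)
    (u := fun (a : Fin d × Fin d × Fin d) ξ => ξ a.1 * (ξ a.2.1 * ξ a.2.2))
    fun a => hi a.1 a.2.1 a.2.2
  have e : ∀ p : 𝔼 × 𝔼, ∑ a : Fin d × Fin d × Fin d,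
      p.1 a.1 * (p.1 a.2.1 * p.1 a.2.2) * (p.2 a.1 * (p.2 a.2.1 * p.2 a.2.2)) =
      ⟪p.1, p.2⟫ ^ 3 := fun p => by
    rw [pow_succ', sq, inner_eq_sum, Finset.sum_mul_sum, Finset.sum_mul_sum, Fintype.sum_prod_type]
    simp_rw [Fintype.sum_prod_type, Finset.mul_sum]
    exact Finset.sum_congr rfl fun i _ => Finset.sum_congr rfl fun j _ =>
      Finset.sum_congr rfl fun k _ => by ring
  simp_rw [e] at h
  rw [h, Fintype.sum_prod_type, Finset.mul_sum]
  refine Finset.sum_le_sum fun i _ => ?_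
  have eL : ∫ ξ, M ξ * ((ξ i * ‖ξ‖ ^ 2 : ℝ) : ℂ) =
      ∑ j, ∫ ξ, M ξ * ((ξ i * (ξ j * ξ j) : ℝ) : ℂ) := by
    simp_rw [norm_sq_eq_sum, Finset.mul_sum, Complex.ofReal_sum, Finset.mul_sum]
    exact integral_finsetSum _ fun j _ => hi i j j
  rw [Fintype.sum_prod_type, eL]
  refine (norm_sum_sq_le_card _).trans ?_
  refine mul_le_mul_of_nonneg_left (Finset.sum_le_sum fun j _ => ?_) (by positivity)
  exact Finset.single_le_sum (f := fun k => ‖∫ ξ, M ξ * ((ξ i * (ξ j * ξ k) : ℝ) : ℂ)‖ ^ 2)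
    (fun k _ => by positivity) (Finset.mem_univ j)

/-- The inequality between the Gaussian Dirichlet form and the moments of degree at most `3`,
in terms of an amplitude in Fourier variables. -/
lemma GaussianAmplitude.gap (hM : GaussianAmplitude c M) (hd : 1 ≤ d) (hc : 0 ≤ c) {σ : ℝ}
    (hσ0 : 0 ≤ σ) (hσ1 : σ ≤ 1) :
    (1 + σ) * (∫ p : 𝔼 × 𝔼, (M p.1 * conj (M p.2)).re * exp (2 * c * ⟪p.1, p.2⟫)) +
      ((1 - σ) / 2 * ((2 * c) ^ 2 / d * ‖∫ ξ, M ξ * ((‖ξ‖ ^ 2 : ℝ) : ℂ)‖ ^ 2) +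
      (2 - σ) / 6 * ((2 * c) ^ 3 / d * ∑ i, ‖∫ ξ, M ξ * ((ξ i * ‖ξ‖ ^ 2 : ℝ) : ℂ)‖ ^ 2)) ≤
    (∫ p : 𝔼 × 𝔼, (M p.1 * conj (M p.2)).re * (2 * c * ⟪p.1, p.2⟫ * exp (2 * c * ⟪p.1, p.2⟫))) +
      ((1 + σ) * ‖∫ ξ, M ξ * ((1 : ℝ) : ℂ)‖ ^ 2 +
      σ * (2 * c) * ∑ i, ‖∫ ξ, M ξ * (ξ i : ℂ)‖ ^ 2) := by
  have hd' : (0 : ℝ) < d := by exact_mod_cast hd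
  have hpos := hM.integral_expTail_nonneg hc (σ := σ) (by linarith) (by linarith)
  have hb0 : ∀ (k : ℕ) (y : ℝ), |y ^ k| ≤ k ! * ((1 + |y|) * exp |y|) := fun k y => by
    rw [abs_pow]
    refine (pow_le_factorial_mul_exp (abs_nonneg y) k).trans ?_
    have := abs_nonneg y
    have := exp_pos |y|
    gcongr
    nlinarith
  have hE : ∀ y : ℝ, exp y ≤ exp |y| := fun y => exp_le_exp.2 (le_abs_self y)
  have i0 := hM.integrable_kernel (h := fun _ => 1) (C := 1) continuous_const fun y => by
    simpa using hb0 0 y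
  have i1 := hM.integrable_kernel (h := fun y => y) (C := 1) continuous_id fun y => by
    simpa using hb0 1 y
  have i2 := hM.integrable_kernel (h := fun y => y ^ 2) (continuous_pow 2) (hb0 2)
  have i3 := hM.integrable_kernel (h := fun y => y ^ 3) (continuous_pow 3) (hb0 3)
  have iE := hM.integrable_kernel (h := exp) (C := 1) continuous_exp fun y => by
    rw [abs_of_pos (exp_pos y)]
    nlinarith [hE y, abs_nonneg y, exp_pos |y|]
  have iY := hM.integrable_kernel (h := fun y => y * exp y) (C := 1) (by fun_prop) fun y => by
    rw [abs_mul, abs_of_pos (exp_pos y)]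
    nlinarith [hE y, abs_nonneg y, exp_pos |y|, mul_le_mul_of_nonneg_left (hE y) (abs_nonneg y)]
  have e : ∀ p : 𝔼 × 𝔼, (M p.1 * conj (M p.2)).re * expTail σ (2 * c * ⟪p.1, p.2⟫) =
      (M p.1 * conj (M p.2)).re * (2 * c * ⟪p.1, p.2⟫ * exp (2 * c * ⟪p.1, p.2⟫))
      - (1 + σ) * ((M p.1 * conj (M p.2)).re * exp (2 * c * ⟪p.1, p.2⟫))
      + (1 + σ) * ((M p.1 * conj (M p.2)).re * 1)
      + σ * ((M p.1 * conj (M p.2)).re * (2 * c * ⟪p.1, p.2⟫))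
      - (1 - σ) / 2 * ((M p.1 * conj (M p.2)).re * (2 * c * ⟪p.1, p.2⟫) ^ 2)
      - (2 - σ) / 6 * ((M p.1 * conj (M p.2)).re * (2 * c * ⟪p.1, p.2⟫) ^ 3) := fun p => by
    rw [expTail]; ring
  simp_rw [e] at hpos
  rw [integral_linear_combination iY iE i0 i1 i2 i3] at hpos
  have k1 : ∫ p : 𝔼 × 𝔼, (M p.1 * conj (M p.2)).re * (2 * c * ⟪p.1, p.2⟫) =
      2 * c * ∑ i, ‖∫ ξ, M ξ * (ξ i : ℂ)‖ ^ 2 := by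
    simp_rw [mul_left_comm _ (2 * c)]
    rw [integral_const_mul, hM.integral_pow_one]
  have k2 : (2 * c) ^ 2 / d * ‖∫ ξ, M ξ * ((‖ξ‖ ^ 2 : ℝ) : ℂ)‖ ^ 2 ≤
      ∫ p : 𝔼 × 𝔼, (M p.1 * conj (M p.2)).re * (2 * c * ⟪p.1, p.2⟫) ^ 2 := by
    simp_rw [mul_pow _ ⟪_, _⟫, mul_left_comm _ ((2 * c) ^ 2)]
    rw [integral_const_mul, div_mul_eq_mul_div, mul_div_assoc]
    exact mul_le_mul_of_nonneg_left ((div_le_iff₀' hd').2 hM.le_integral_pow_two) (by positivity)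
  have k3 : (2 * c) ^ 3 / d * ∑ i, ‖∫ ξ, M ξ * ((ξ i * ‖ξ‖ ^ 2 : ℝ) : ℂ)‖ ^ 2 ≤
      ∫ p : 𝔼 × 𝔼, (M p.1 * conj (M p.2)).re * (2 * c * ⟪p.1, p.2⟫) ^ 3 := by
    simp_rw [mul_pow _ ⟪_, _⟫, mul_left_comm _ ((2 * c) ^ 3)]
    rw [integral_const_mul, div_mul_eq_mul_div, mul_div_assoc]
    exact mul_le_mul_of_nonneg_left ((div_le_iff₀' hd').2 hM.le_integral_pow_three) (by positivity)
  have k0 := hM.integral_pow_zero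
  rw [k1] at hpos
  simp only [mul_one] at hpos
  rw [k0] at hpos
  have l2 := mul_le_mul_of_nonneg_left k2 (by linarith : 0 ≤ (1 - σ) / 2)
  have l3 := mul_le_mul_of_nonneg_left k3 (by linarith : 0 ≤ (2 - σ) / 6)
  linarith

end moments

/-- The Gaussian spectral inequality. If `N_k` is the squared norm of the degree-`k` part in the
Hermite expansion of `f` for the Gaussian density proportional to `exp (-s |x|²)`, the normalised
Dirichlet form is `∑ k N_k`; the inequality bounds `∑ k N_k - (1 + σ) ∑ N_k` from below by the
terms of degree `0` and `1` and by the radial components of those of degree `2` and `3`. -/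
theorem gaussian_gap (f : 𝓢(EuclideanSpace ℝ (Fin d), ℂ)) (hd : 1 ≤ d) {s σ : ℝ} (hs : 0 < s)
    (hσ0 : 0 ≤ σ) (hσ1 : σ ≤ 1) :
    (1 + σ) * (∫ x : 𝔼, ‖f x‖ ^ 2 * exp (-s * ‖x‖ ^ 2)) + gaussianMass 𝔼 s *
      ((1 - σ) / 2 * ((2 * (π ^ 2 / s)) ^ 2 / d *
        ‖fourierMoment (𝓕 f : 𝓢(𝔼, ℂ)) (fun ξ => ‖ξ‖ ^ 2) s‖ ^ 2) +
      (2 - σ) / 6 * ((2 * (π ^ 2 / s)) ^ 3 / d *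
        ∑ i, ‖fourierMoment (𝓕 f : 𝓢(𝔼, ℂ)) (fun ξ => ξ i * ‖ξ‖ ^ 2) s‖ ^ 2)) ≤
    1 / (2 * s) * (∑ i, ∫ x : 𝔼, ‖(∂_{(EuclideanSpace.single i 1 : 𝔼)} f) x‖ ^ 2 *
      exp (-s * ‖x‖ ^ 2)) + gaussianMass 𝔼 s *
      ((1 + σ) * ‖fourierMoment (𝓕 f : 𝓢(𝔼, ℂ)) (fun _ => 1) s‖ ^ 2 +
      σ * (2 * (π ^ 2 / s)) * ∑ i, ‖fourierMoment (𝓕 f : 𝓢(𝔼, ℂ)) (fun ξ => ξ i) s‖ ^ 2) := by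
  set c := π ^ 2 / s with hc
  have hc0 : 0 < c := by positivity
  set F : 𝓢(𝔼, ℂ) := 𝓕 f with hF
  set M : 𝔼 → ℂ := fun ξ => F ξ * (exp (-c * ‖ξ‖ ^ 2) : ℝ) with hMdef
  have hM : GaussianAmplitude c M := gaussianAmplitude_schwartz F hc0.le
  have hZ := gaussianMass_pos (V := 𝔼) hs
  have key := mul_le_mul_of_nonneg_left (hM.gap hd hc0.le hσ0 hσ1) hZ.le
  have hker : ∀ p : 𝔼 × 𝔼, (F p.1 * conj (F p.2)).re * exp (-c * ‖p.1 - p.2‖ ^ 2) =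
      (M p.1 * conj (M p.2)).re * exp (2 * c * ⟪p.1, p.2⟫) := fun p => by
    have : M p.1 * conj (M p.2) =
        ((exp (-c * ‖p.1‖ ^ 2) * exp (-c * ‖p.2‖ ^ 2) : ℝ) : ℂ) * (F p.1 * conj (F p.2)) := by
      simp only [hMdef, map_mul, Complex.conj_ofReal]
      push_cast; ring
    rw [this, Complex.re_ofReal_mul, mul_comm _ (F p.1 * conj (F p.2)).re, mul_assoc, ← exp_add,
      ← exp_add, norm_sub_sq_real]
    ring_nf
  have h1 : ∫ x : 𝔼, ‖f x‖ ^ 2 * exp (-s * ‖x‖ ^ 2) = gaussianMass 𝔼 s *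
      ∫ p : 𝔼 × 𝔼, (M p.1 * conj (M p.2)).re * exp (2 * c * ⟪p.1, p.2⟫) := by
    rw [integral_normSq_mul_gaussian F.integrable (schwartz_eq_integral_fourier f) hs]
    simp_rw [← hc, hker]
  have h2 : 1 / (2 * s) * (∑ i, ∫ x : 𝔼, ‖(∂_{(EuclideanSpace.single i 1 : 𝔼)} f) x‖ ^ 2 *
      exp (-s * ‖x‖ ^ 2)) =
      gaussianMass 𝔼 s * ∫ p : 𝔼 × 𝔼, (M p.1 * conj (M p.2)).re *
        (2 * c * ⟪p.1, p.2⟫ * exp (2 * c * ⟪p.1, p.2⟫)) := by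
    have h3 : ∀ i : Fin d, ∫ x : 𝔼, ‖(∂_{(EuclideanSpace.single i 1 : 𝔼)} f) x‖ ^ 2 *
        exp (-s * ‖x‖ ^ 2) =
        gaussianMass 𝔼 s * ∫ p : 𝔼 × 𝔼, 4 * π ^ 2 * ((M p.1 * conj (M p.2)).re *
          (p.1 i * p.2 i * exp (2 * c * ⟪p.1, p.2⟫))) := fun i => by
      rw [integral_normSq_mul_gaussian
        (𝓕 (∂_{(EuclideanSpace.single i 1 : 𝔼)} f) : 𝓢(𝔼, ℂ)).integrable
        (schwartz_eq_integral_fourier _) hs]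
      congr 2 with p
      have h4 : (𝓕 (∂_{(EuclideanSpace.single i 1 : 𝔼)} f) : 𝓢(𝔼, ℂ)) p.1 *
          conj ((𝓕 (∂_{EuclideanSpace.single i (1 : ℝ)} f) : 𝓢(𝔼, ℂ)) p.2) =
          ((4 * π ^ 2 * (p.1 i * p.2 i) : ℝ) : ℂ) * (F p.1 * conj (F p.2)) := by
        rw [fourier_lineDeriv_apply, fourier_lineDeriv_apply]
        simp only [map_mul, Complex.conj_ofReal, Complex.conj_I, EuclideanSpace.inner_single_right]
        simp only [Complex.ofReal_mul, Complex.ofReal_pow, Complex.ofReal_ofNat, conj_trivial,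
          one_mul, map_ofNat]
        ring_nf
        rw [Complex.I_sq]
        ring
      rw [h4, Complex.re_ofReal_mul, mul_assoc, hker]
      ring
    have h5 : ∀ i : Fin d, Integrable fun p : 𝔼 × 𝔼 => 4 * π ^ 2 * ((M p.1 * conj (M p.2)).re *
          (p.1 i * p.2 i * exp (2 * c * ⟪p.1, p.2⟫))) := fun i => by
      have h6 : Integrable fun p : 𝔼 × 𝔼 => ‖p.1‖ ^ 1 * ‖F p.1‖ * (‖p.2‖ ^ 1 * ‖F p.2‖) :=
        (F.integrable_pow_mul volume 1).mul_prod (F.integrable_pow_mul volume 1)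
      refine Integrable.const_mul (h6.mono' ?_ (Eventually.of_forall fun p => ?_)) _
      · have := F.continuous
        refine Continuous.aestronglyMeasurable ((Complex.continuous_re.comp ?_).mul (by fun_prop))
        exact (by fun_prop : Continuous fun p : 𝔼 × 𝔼 => M p.1).mul
          (Complex.continuous_conj.comp (by fun_prop : Continuous fun p : 𝔼 × 𝔼 => M p.2))
      · rw [mul_left_comm, ← hker, norm_mul, norm_mul, norm_mul,
          norm_of_nonneg (exp_pos _).le]
        have h7 : ‖(F p.1 * conj (F p.2)).re‖ ≤ ‖F p.1‖ * ‖F p.2‖ := by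
          refine (Complex.abs_re_le_norm _).trans (le_of_eq ?_)
          rw [norm_mul, RCLike.norm_conj]
        have h8 : exp (-c * ‖p.1 - p.2‖ ^ 2) ≤ 1 := by
          rw [exp_le_one_iff, neg_mul]
          have : 0 ≤ c * ‖p.1 - p.2‖ ^ 2 := by positivity
          linarith
        calc _ ≤ ‖p.1‖ * ‖p.2‖ * (‖F p.1‖ * ‖F p.2‖ * 1) := by
              gcongr
              · exact abs_apply_le_norm _ _
              · exact abs_apply_le_norm _ _
          _ = _ := by ring
    simp_rw [h3]
    rw [← Finset.mul_sum, ← integral_finsetSum _ fun i _ => h5 i, mul_left_comm,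
      ← integral_const_mul]
    congr 2 with p
    rw [← Finset.mul_sum, ← Finset.mul_sum, ← Finset.sum_mul, ← inner_eq_sum, hc]
    field_simp
    ring
  rw [h1, h2, mul_left_comm, ← mul_add, ← mul_add]
  exact key

end GaussianGap

/-! ### Gaussian mixtures -/

section Mixture

variable {V : Type*} [NormedAddCommGroup V]

/-- The weight `(1 + |x|²) ^ (-p)`. With `a = 1 / (1 - m)`, the Barenblatt profile is the weight of
exponent `a`, and its power `2 - m` is the weight of exponent `a + 1`. -/
noncomputable def cauchyWeight (p : ℝ) (x : V) : ℝ := (1 + ‖x‖ ^ 2) ^ (-p)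

lemma cauchyWeight_pos (p : ℝ) (x : V) : 0 < cauchyWeight p x :=
  rpow_pos_of_pos (by positivity) _

lemma continuous_cauchyWeight (p : ℝ) : Continuous (cauchyWeight p : V → ℝ) :=
  Continuous.rpow_const (by fun_prop) fun x => Or.inl (by positivity)

lemma cauchyWeight_add (p q : ℝ) (x : V) :
    cauchyWeight (p + q) x = cauchyWeight p x * cauchyWeight q x := by
  rw [cauchyWeight, neg_add, rpow_add (by positivity)]; rfl

lemma cauchyWeight_neg_one (x : V) : cauchyWeight (-1) x = 1 + ‖x‖ ^ 2 := by
  simp [cauchyWeight]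

lemma cauchyWeight_one_mul (x : V) : cauchyWeight 1 x * (1 + ‖x‖ ^ 2) = 1 := by
  rw [← cauchyWeight_neg_one, ← cauchyWeight_add]
  simp [cauchyWeight]

lemma cauchyWeight_succ_mul (p : ℝ) (x : V) :
    cauchyWeight (p + 1) x * (1 + ‖x‖ ^ 2) = cauchyWeight p x := by
  rw [cauchyWeight_add, mul_assoc, cauchyWeight_one_mul, mul_one]

lemma cauchyWeight_anti {p q : ℝ} (h : p ≤ q) (x : V) : cauchyWeight q x ≤ cauchyWeight p x :=
  rpow_le_rpow_of_exponent_le (by nlinarith [sq_nonneg ‖x‖]) (by linarith)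

lemma integral_rpow_mul_exp_mul_gaussian {p : ℝ} (hp : 0 < p) (x : V) :
    ∫ s in Ioi (0 : ℝ), s ^ (p - 1) * exp (-s) * exp (-s * ‖x‖ ^ 2) =
      Gamma p * cauchyWeight p x := by
  have h := integral_rpow_mul_exp_neg_mul_Ioi hp (r := 1 + ‖x‖ ^ 2) (by positivity)
  rw [cauchyWeight, rpow_neg (by positivity), ← inv_rpow (by positivity), ← one_div, mul_comm, ← h]
  refine integral_congr_ae (Eventually.of_forall fun s => ?_)
  simp only
  rw [mul_assoc, ← exp_add]
  congr 2
  ring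

lemma gaussianMass_eq [InnerProductSpace ℝ V] {s : ℝ} (hs : 0 < s) : gaussianMass V s =
    π ^ (Module.finrank ℝ V / 2 : ℝ) * s ^ (-(Module.finrank ℝ V / 2 : ℝ)) := by
  rw [gaussianMass, div_rpow pi_pos.le hs.le, rpow_neg hs.le, div_eq_mul_inv]

variable [InnerProductSpace ℝ V] [FiniteDimensional ℝ V] [MeasurableSpace V] [BorelSpace V]

lemma integrable_cauchyWeight {p : ℝ} (hp : (Module.finrank ℝ V : ℝ) / 2 < p) :
    Integrable (cauchyWeight p : V → ℝ) := by
  have h := integrable_rpow_neg_one_add_norm_sq (E := V) (μ := volume) (r := 2 * p) (by linarith)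
  refine h.congr (Eventually.of_forall fun x => ?_)
  simp only [cauchyWeight]
  congr 1; ring

lemma integrable_mixture {p : ℝ} (hp : 0 < p) {g : V → ℝ} (hg : Integrable g) :
    Integrable (fun z : ℝ × V => z.1 ^ (p - 1) * exp (-z.1) * (g z.2 * exp (-z.1 * ‖z.2‖ ^ 2)))
      ((volume.restrict (Ioi 0)).prod volume) := by
  have h1 := (integrableOn_rpow_mul_exp_neg (b := p - 1) (by linarith)).mul_prod hg
  have h2 : AEStronglyMeasurable (fun z : ℝ × V => exp (-z.1 * ‖z.2‖ ^ 2))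
      ((volume.restrict (Ioi 0)).prod volume) :=
    (by fun_prop : Continuous fun z : ℝ × V => exp (-z.1 * ‖z.2‖ ^ 2)).aestronglyMeasurable
  have h3 : ∀ᵐ z : ℝ × V ∂((volume.restrict (Ioi 0)).prod volume),
      ‖exp (-z.1 * ‖z.2‖ ^ 2)‖ ≤ 1 := by
    have : ∀ᵐ s ∂(volume.restrict (Ioi (0 : ℝ))), 0 < s :=
      (ae_restrict_iff' measurableSet_Ioi).2 (Eventually.of_forall fun s hs => hs)
    filter_upwards [Measure.quasiMeasurePreserving_fst.ae this] with z hz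
    rw [norm_of_nonneg (exp_pos _).le, exp_le_one_iff, neg_mul]
    have : 0 ≤ z.1 * ‖z.2‖ ^ 2 := by positivity
    linarith
  refine (h1.mul_bdd (c := 1) h2 h3).congr (Eventually.of_forall fun z => ?_)
  simp only
  ring

/-- Averaging the Gaussians `exp (-s |x|²)` against `s ^ (p - 1) e⁻ˢ ds` gives the weight of
exponent `p`, up to the factor `Γ(p)`. -/
lemma integral_mixture {p : ℝ} (hp : 0 < p) {g : V → ℝ} (hg : Integrable g) :
    ∫ s in Ioi (0 : ℝ), s ^ (p - 1) * exp (-s) * (∫ x, g x * exp (-s * ‖x‖ ^ 2)) =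
      Gamma p * ∫ x, g x * cauchyWeight p x := by
  simp_rw [← integral_const_mul]
  rw [integral_integral_swap (integrable_mixture hp hg)]
  congr 1 with x
  rw [mul_left_comm, ← integral_rpow_mul_exp_mul_gaussian hp, ← integral_const_mul]
  congr 1 with s
  ring

lemma integrableOn_mixture {p : ℝ} (hp : 0 < p) {g : V → ℝ} (hg : Integrable g) :
    IntegrableOn (fun s => s ^ (p - 1) * exp (-s) * (∫ x, g x * exp (-s * ‖x‖ ^ 2))) (Ioi 0) := by
  refine (integrable_mixture hp hg).integral_prod_left.congr (Eventually.of_forall fun s => ?_)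
  simp only [integral_const_mul]

lemma integral_cauchyWeight {p : ℝ} (hp : (Module.finrank ℝ V : ℝ) / 2 < p) :
    Gamma p * ∫ x : V, cauchyWeight p x =
      π ^ (Module.finrank ℝ V / 2 : ℝ) * Gamma (p - Module.finrank ℝ V / 2) := by
  set δ : ℝ := Module.finrank ℝ V / 2 with hδ
  have hδ0 : 0 ≤ δ := by positivity
  have hp0 : 0 < p := by linarith
  have hin : ∀ s : ℝ, 0 < s → ∫ x : V, s ^ (p - 1) * exp (-s) * exp (-s * ‖x‖ ^ 2) =
      π ^ δ * (s ^ (p - δ - 1) * exp (-s)) := fun s hs => by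
    rw [integral_const_mul, GaussianFourier.integral_rexp_neg_mul_sq_norm hs, ← hδ,
      div_rpow pi_pos.le hs.le, show p - δ - 1 = p - 1 - δ by ring, rpow_sub hs (p - 1)]
    ring
  have hint : Integrable (fun z : ℝ × V => z.1 ^ (p - 1) * exp (-z.1) * exp (-z.1 * ‖z.2‖ ^ 2))
      ((volume.restrict (Ioi 0)).prod volume) := by
    have hm : AEStronglyMeasurable
        (fun z : ℝ × V => z.1 ^ (p - 1) * exp (-z.1) * exp (-z.1 * ‖z.2‖ ^ 2))
        ((volume.restrict (Ioi 0)).prod volume) := by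
      refine Measurable.aestronglyMeasurable ?_
      exact ((measurable_fst.pow_const _).mul (measurable_fst.neg.exp)).mul
        (by fun_prop : Continuous fun z : ℝ × V => exp (-z.1 * ‖z.2‖ ^ 2)).measurable
    rw [integrable_prod_iff hm]
    constructor
    · refine (ae_restrict_iff' measurableSet_Ioi).2 (Eventually.of_forall fun s hs => ?_)
      exact (integrable_gaussian (V := V) hs).const_mul (s ^ (p - 1) * exp (-s))
    · have h := (integrableOn_rpow_mul_exp_neg (b := p - δ - 1) (by linarith)).const_mul (π ^ δ)
      refine IntegrableOn.congr_fun h (fun s hs => ?_) measurableSet_Ioi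
      have hs' : (0 : ℝ) < s := hs
      simp only
      rw [← hin s hs]
      congr 1 with x
      exact (norm_of_nonneg (by positivity)).symm
  have hswap := integral_integral_swap (f := fun (s : ℝ) (x : V) =>
    s ^ (p - 1) * exp (-s) * exp (-s * ‖x‖ ^ 2)) hint
  have h1 : ∫ s in Ioi (0 : ℝ), ∫ x : V, s ^ (p - 1) * exp (-s) * exp (-s * ‖x‖ ^ 2) =
      π ^ δ * Gamma (p - δ) := by
    rw [setIntegral_congr_fun measurableSet_Ioi fun s hs => hin s hs, integral_const_mul,
      integral_rpow_mul_exp_neg (by linarith)]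
    congr 2; ring
  rw [← h1]
  refine Eq.trans ?_ hswap.symm
  rw [← integral_const_mul]
  congr 1 with x
  exact (integral_rpow_mul_exp_mul_gaussian hp0 x).symm

end Mixture

/-! ### Dependence of Gaussian moments on the scale -/

section Scale
open scoped FourierTransform ComplexConjugate SchwartzMap RealInnerProductSpace LineDeriv

variable {d : ℕ}

local notation "𝔼" => EuclideanSpace ℝ (Fin d)

lemma integrable_fourierMoment (F : 𝓢(𝔼, ℂ)) {u : 𝔼 → ℝ} (hu : Continuous u) {k : ℕ}
    (hb : ∀ ξ, |u ξ| ≤ ‖ξ‖ ^ k) {s : ℝ} (hs : 0 < s) :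
    Integrable fun ξ => F ξ * (exp (-(π ^ 2 / s) * ‖ξ‖ ^ 2) : ℝ) * (u ξ : ℂ) :=
  (gaussianAmplitude_schwartz F (c := π ^ 2 / s) (by positivity)).moments k u hu hb

lemma norm_fourierMoment_le (F : 𝓢(𝔼, ℂ)) {u : 𝔼 → ℝ} {k : ℕ}
    (hb : ∀ ξ, |u ξ| ≤ ‖ξ‖ ^ k) {s : ℝ} (hs : 0 < s) :
    ‖fourierMoment F u s‖ ≤ ∫ ξ, ‖ξ‖ ^ k * ‖F ξ‖ := by
  refine norm_integral_le_of_norm_le (F.integrable_pow_mul volume k)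
    (Eventually.of_forall fun ξ => ?_)
  have h1 : exp (-(π ^ 2 / s) * ‖ξ‖ ^ 2) ≤ 1 := by
    rw [exp_le_one_iff, neg_mul]
    have : 0 ≤ π ^ 2 / s * ‖ξ‖ ^ 2 := by positivity
    linarith
  rw [norm_mul, norm_mul, Complex.norm_real, Complex.norm_real, norm_of_nonneg (exp_pos _).le,
    norm_eq_abs]
  calc _ ≤ ‖F ξ‖ * 1 * ‖ξ‖ ^ k := by gcongr; exact hb ξ
    _ = _ := by ring

/-- The derivative of a Gaussian moment in the scale is of order `1 / s`. -/
lemma norm_mul_fourierMoment_le (F : 𝓢(𝔼, ℂ)) {u : 𝔼 → ℝ} {k : ℕ}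
    (hb : ∀ ξ, |u ξ| ≤ ‖ξ‖ ^ k) {s : ℝ} (hs : 0 < s) :
    ‖(π ^ 2 / s : ℝ) * fourierMoment F (fun ξ => u ξ * ‖ξ‖ ^ 2) s‖ ≤ ∫ ξ, ‖ξ‖ ^ k * ‖F ξ‖ := by
  rw [fourierMoment, ← integral_const_mul]
  refine norm_integral_le_of_norm_le (F.integrable_pow_mul volume k)
    (Eventually.of_forall fun ξ => ?_)
  have h1 : (π ^ 2 / s * ‖ξ‖ ^ 2) * exp (-(π ^ 2 / s) * ‖ξ‖ ^ 2) ≤ 1 := by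
    have h := mul_le_mul_of_nonneg_right (add_one_le_exp (π ^ 2 / s * ‖ξ‖ ^ 2))
      (exp_pos (-(π ^ 2 / s * ‖ξ‖ ^ 2))).le
    rw [← exp_add, add_neg_cancel, exp_zero] at h
    rw [neg_mul]
    nlinarith [exp_pos (-(π ^ 2 / s * ‖ξ‖ ^ 2))]
  have h0 : 0 ≤ π ^ 2 / s := by positivity
  rw [norm_mul, norm_mul, norm_mul, Complex.norm_real, Complex.norm_real, Complex.norm_real,
    norm_of_nonneg (exp_pos _).le, norm_of_nonneg h0, norm_mul, norm_pow, norm_norm, norm_eq_abs]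
  calc _ = ‖F ξ‖ * ((π ^ 2 / s * ‖ξ‖ ^ 2) * exp (-(π ^ 2 / s) * ‖ξ‖ ^ 2)) * |u ξ| := by ring
    _ ≤ ‖F ξ‖ * 1 * ‖ξ‖ ^ k := by gcongr; exact hb ξ
    _ = _ := by ring

lemma hasDerivAt_fourierMoment (F : 𝓢(𝔼, ℂ)) {u : 𝔼 → ℝ} (hu : Continuous u) {k : ℕ}
    (hb : ∀ ξ, |u ξ| ≤ ‖ξ‖ ^ k) {s : ℝ} (hs : 0 < s) :
    HasDerivAt (fourierMoment F u)
      ((π ^ 2 / s ^ 2 : ℝ) * fourierMoment F (fun ξ => u ξ * ‖ξ‖ ^ 2) s) s := by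
  have hF := F.continuous
  have hmeas : ∀ t : ℝ, AEStronglyMeasurable
      (fun ξ => F ξ * (exp (-(π ^ 2 / t) * ‖ξ‖ ^ 2) : ℝ) * (u ξ : ℂ)) volume := fun t =>
    (by fun_prop : Continuous fun ξ =>
      F ξ * (exp (-(π ^ 2 / t) * ‖ξ‖ ^ 2) : ℝ) * (u ξ : ℂ)).aestronglyMeasurable
  have h := hasDerivAt_integral_of_dominated_loc_of_deriv_le (μ := (volume : Measure 𝔼))
    (F := fun (t : ℝ) ξ => F ξ * (exp (-(π ^ 2 / t) * ‖ξ‖ ^ 2) : ℝ) * (u ξ : ℂ))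
    (F' := fun (t : ℝ) ξ => (π ^ 2 / t ^ 2 : ℝ) *
      (F ξ * (exp (-(π ^ 2 / t) * ‖ξ‖ ^ 2) : ℝ) * ((u ξ * ‖ξ‖ ^ 2 : ℝ) : ℂ)))
    (x₀ := s) (s := Ioi (s / 2)) (bound := fun ξ => π ^ 2 / (s / 2) ^ 2 * (‖ξ‖ ^ (k + 2) * ‖F ξ‖))
    (Ioi_mem_nhds (by linarith)) (Eventually.of_forall hmeas)
    (integrable_fourierMoment F hu hb hs) ?_ ?_
    ((F.integrable_pow_mul volume (k + 2)).const_mul _) ?_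
  · rw [fourierMoment, ← integral_const_mul]
    exact h.2
  · exact (by fun_prop : Continuous fun ξ => ((π ^ 2 / s ^ 2 : ℝ) : ℂ) *
      (F ξ * (exp (-(π ^ 2 / s) * ‖ξ‖ ^ 2) : ℝ) *
        ((u ξ * ‖ξ‖ ^ 2 : ℝ) : ℂ))).aestronglyMeasurable
  · refine Eventually.of_forall fun ξ t ht => ?_
    have ht' : s / 2 < t := ht
    have ht0 : 0 < t := by linarith
    have h1 : exp (-(π ^ 2 / t) * ‖ξ‖ ^ 2) ≤ 1 := by
      rw [exp_le_one_iff, neg_mul]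
      have : 0 ≤ π ^ 2 / t * ‖ξ‖ ^ 2 := by positivity
      linarith
    rw [norm_mul, norm_mul, norm_mul, Complex.norm_real, Complex.norm_real, Complex.norm_real,
      norm_of_nonneg (exp_pos _).le, norm_of_nonneg (by positivity : 0 ≤ π ^ 2 / t ^ 2),
      norm_mul, norm_pow, norm_norm, norm_eq_abs]
    calc _ ≤ π ^ 2 / (s / 2) ^ 2 * (‖F ξ‖ * 1 * (‖ξ‖ ^ k * ‖ξ‖ ^ 2)) := by
          gcongr
          exact hb ξ
      _ = _ := by ring
  · refine Eventually.of_forall fun ξ t ht => ?_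
    have ht' : s / 2 < t := ht
    have ht0 : t ≠ 0 := by linarith
    have h1 : HasDerivAt (fun t : ℝ => exp (-(π ^ 2 / t) * ‖ξ‖ ^ 2))
        (exp (-(π ^ 2 / t) * ‖ξ‖ ^ 2) * (π ^ 2 / t ^ 2 * ‖ξ‖ ^ 2)) t := by
      have h2 : HasDerivAt (fun t : ℝ => -(π ^ 2 / t) * ‖ξ‖ ^ 2) (π ^ 2 / t ^ 2 * ‖ξ‖ ^ 2) t := by
        have := (((hasDerivAt_inv ht0).const_mul (π ^ 2)).neg).mul_const (‖ξ‖ ^ 2)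
        refine this.congr_deriv ?_
        field_simp
      exact h2.exp
    refine ((h1.ofReal_comp.const_mul (F ξ)).mul_const (u ξ : ℂ)).congr_deriv ?_
    push_cast
    ring

/-- The weighted Poincaré inequality for real parts of multiples of Gaussian moments; `b` and `p`
are as in `gamma_poincare`. -/
lemma gamma_poincare_moment (F : 𝓢(𝔼, ℂ)) {u : 𝔼 → ℝ} (hu : Continuous u) {k : ℕ}
    (hb : ∀ ξ, |u ξ| ≤ ‖ξ‖ ^ k) (z : ℂ) {p b : ℝ} (hp : 0 < p) (hp1 : p ≤ 1) (hpb : p < b + 1)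
    {m m' : ℝ → ℝ} (hm : ∀ s, m s = (z * fourierMoment F u s).re)
    (hm' : ∀ s, m' s =
      (z * ((π ^ 2 / s ^ 2 : ℝ) * fourierMoment F (fun ξ => u ξ * ‖ξ‖ ^ 2) s)).re) :
    IntegrableOn (fun s => s ^ b * exp (-s) * m s ^ 2) (Ioi 0) ∧
    IntegrableOn (fun s => s ^ (b + 2) * exp (-s) * m' s ^ 2) (Ioi 0) ∧
    p * (b + 1 - p) * ((∫ s in Ioi (0 : ℝ), s ^ b * exp (-s) * m s ^ 2)
      - (∫ s in Ioi (0 : ℝ), s ^ b * exp (-s) * m s) ^ 2 / Gamma (b + 1)) ≤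
      ∫ s in Ioi (0 : ℝ), s ^ (b + 2) * exp (-s) * m' s ^ 2 := by
  set C : ℝ := ‖z‖ * ∫ ξ, ‖ξ‖ ^ k * ‖F ξ‖ with hC
  have hC0 : 0 ≤ C := by positivity
  have hu2 : Continuous fun ξ : 𝔼 => u ξ * ‖ξ‖ ^ 2 := by fun_prop
  have hb2 : ∀ ξ : 𝔼, |u ξ * ‖ξ‖ ^ 2| ≤ ‖ξ‖ ^ (k + 2) := fun ξ => by
    rw [abs_mul, abs_of_nonneg (sq_nonneg ‖ξ‖), pow_add]
    gcongr
    exact hb ξ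
  have hmC : ∀ s, 0 < s → |m s| ≤ C := fun s hs => by
    rw [hm]
    refine (Complex.abs_re_le_norm _).trans ?_
    rw [norm_mul]
    exact mul_le_mul_of_nonneg_left (norm_fourierMoment_le F hb hs) (norm_nonneg _)
  have hm'C : ∀ s, 0 < s → |s * m' s| ≤ C := fun s hs => by
    have e : s * m' s =
        (z * ((π ^ 2 / s : ℝ) * fourierMoment F (fun ξ => u ξ * ‖ξ‖ ^ 2) s)).re := by
      rw [hm', ← Complex.re_ofReal_mul]
      congr 1
      have : (s : ℂ) ≠ 0 := by exact_mod_cast hs.ne'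
      push_cast
      field_simp
    rw [e]
    refine (Complex.abs_re_le_norm _).trans ?_
    rw [norm_mul]
    exact mul_le_mul_of_nonneg_left (norm_mul_fourierMoment_le F hb hs) (norm_nonneg _)
  have hderiv : ∀ s, 0 < s → HasDerivAt m (m' s) s := fun s hs => by
    have h1 := (hasDerivAt_fourierMoment F hu hb hs).const_mul z
    have h2 := Complex.reCLM.hasFDerivAt.comp_hasDerivAt s h1
    rw [hm', show m = fun s => (z * fourierMoment F u s).re from funext hm]
    exact h2
  have hcont : ContinuousOn m (Ioi 0) := fun s hs => (hderiv s hs).continuousAt.continuousWithinAt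
  have hcont' : ContinuousOn m' (Ioi 0) := by
    rw [show m' = _ from funext hm']
    intro s hs
    have hs' : s ≠ 0 := ne_of_gt hs
    have h1 := (hasDerivAt_fourierMoment F hu2 hb2 hs).continuousAt
    have h2 : ContinuousAt (fun s : ℝ => ((π ^ 2 / s ^ 2 : ℝ) : ℂ)) s :=
      Complex.continuous_ofReal.continuousAt.comp
        (continuousAt_const.div (by fun_prop) (by positivity))
    exact (Complex.continuous_re.continuousAt.comp
      (continuousAt_const.mul (h2.mul h1))).continuousWithinAt
  have hq := integrableOn_rpow_mul_exp_neg (b := b) (by linarith)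
  have hqc : ∀ r : ℝ, ContinuousOn (fun s : ℝ => s ^ r * exp (-s)) (Ioi 0) := fun r =>
    (continuousOn_id.rpow_const fun s hs => Or.inl (ne_of_gt hs)).mul (by fun_prop)
  have i0 : IntegrableOn (fun s => s ^ b * exp (-s) * m s) (Ioi 0) := by
    refine Integrable.mono' (hq.const_mul C)
      (((hqc b).mul hcont).aestronglyMeasurable measurableSet_Ioi)
      ((ae_restrict_iff' measurableSet_Ioi).2 (Eventually.of_forall fun s hs => ?_))
    have hs' : (0 : ℝ) < s := hs
    rw [norm_mul, norm_of_nonneg (by positivity), mul_comm]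
    exact mul_le_mul_of_nonneg_right (hmC s hs) (by positivity)
  have i1 : IntegrableOn (fun s => s ^ b * exp (-s) * m s ^ 2) (Ioi 0) := by
    refine Integrable.mono' (hq.const_mul (C ^ 2))
      (((hqc b).mul (hcont.pow 2)).aestronglyMeasurable measurableSet_Ioi)
      ((ae_restrict_iff' measurableSet_Ioi).2 (Eventually.of_forall fun s hs => ?_))
    have hs' : (0 : ℝ) < s := hs
    rw [norm_of_nonneg (by positivity), mul_comm, ← sq_abs]
    exact mul_le_mul_of_nonneg_right (pow_le_pow_left₀ (abs_nonneg _) (hmC s hs) 2) (by positivity)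
  have i2 : IntegrableOn (fun s => s ^ (b + 2) * exp (-s) * m' s ^ 2) (Ioi 0) := by
    refine Integrable.mono' (hq.const_mul (C ^ 2))
      (((hqc (b + 2)).mul (hcont'.pow 2)).aestronglyMeasurable measurableSet_Ioi)
      ((ae_restrict_iff' measurableSet_Ioi).2 (Eventually.of_forall fun s hs => ?_))
    have hs' : (0 : ℝ) < s := hs
    have e1 : s ^ (b + 2) = s ^ b * s ^ 2 := by
      rw [rpow_add hs']; norm_cast
    rw [norm_of_nonneg (by positivity), e1,
      show s ^ b * s ^ 2 * exp (-s) * m' s ^ 2 = |s * m' s| ^ 2 * (s ^ b * exp (-s)) by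
        rw [sq_abs]; ring]
    exact mul_le_mul_of_nonneg_right (pow_le_pow_left₀ (abs_nonneg _) (hm'C s hs) 2)
      (by positivity)
  exact ⟨i1, i2, gamma_poincare hp hp1 hpb hderiv i0 i1 i2⟩

end Scale

/-! ### The spectral gap for smooth compactly supported functions -/

section SmoothGap
open scoped FourierTransform ComplexConjugate SchwartzMap RealInnerProductSpace LineDeriv

variable {d : ℕ}

local notation "𝔼" => EuclideanSpace ℝ (Fin d)

lemma gradient_apply_eq_fderiv {f : 𝔼 → ℝ} (x : 𝔼) (i : Fin d) :
    gradient f x i = fderiv ℝ f x (EuclideanSpace.single i 1) := by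
  rw [← inner_gradient_left, EuclideanSpace.inner_single_right]
  simp

lemma continuous_gradient {f : 𝔼 → ℝ} (hf : ContDiff ℝ ∞ f) : Continuous (gradient f) :=
  (InnerProductSpace.toDual ℝ 𝔼).symm.continuous.comp (hf.continuous_fderiv (by simp))

lemma hasCompactSupport_gradient {f : 𝔼 → ℝ} (hc : HasCompactSupport f) :
    HasCompactSupport (gradient f) :=
  (hc.fderiv (𝕜 := ℝ)).comp_left (g := (InnerProductSpace.toDual ℝ 𝔼).symm) (map_zero _)

/-- The means `m`, `c i` of `f` and of its partial derivatives under the Gaussian density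
proportional to `exp (-s |x|²)`, together with their derivatives `m'`, `c' i` in `s`: the Gaussian
spectral inequality, and the one-dimensional Poincaré inequalities they satisfy. -/
lemma exists_gaussian_means {f : 𝔼 → ℝ} (hf : ContDiff ℝ ∞ f) (hc : HasCompactSupport f)
    (hd : 1 ≤ d) : ∃ (m m' : ℝ → ℝ) (c c' : Fin d → ℝ → ℝ),
    (∀ s, 0 < s → gaussianMass 𝔼 s * m s = ∫ x : 𝔼, f x * exp (-s * ‖x‖ ^ 2)) ∧
    (∀ i s, 0 < s → gaussianMass 𝔼 s * c i s =
      ∫ x : 𝔼, gradient f x i * exp (-s * ‖x‖ ^ 2)) ∧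
    (∀ s σ, 0 < s → 0 ≤ σ → σ ≤ 1 →
      (1 + σ) * (∫ x : 𝔼, f x ^ 2 * exp (-s * ‖x‖ ^ 2)) + gaussianMass 𝔼 s *
        ((1 - σ) * (2 / d) * (s ^ 2 * m' s ^ 2) + (2 - σ) / (3 * d) * (s * ∑ i, c' i s ^ 2)) ≤
      1 / (2 * s) * (∑ i, ∫ x : 𝔼, gradient f x i ^ 2 * exp (-s * ‖x‖ ^ 2)) + gaussianMass 𝔼 s *
        ((1 + σ) * m s ^ 2 + σ / (2 * s) * ∑ i, c i s ^ 2)) ∧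
    (∀ p b : ℝ, 0 < p → p ≤ 1 → p < b + 1 →
      IntegrableOn (fun s => s ^ b * exp (-s) * m s ^ 2) (Ioi 0) ∧
      IntegrableOn (fun s => s ^ (b + 2) * exp (-s) * m' s ^ 2) (Ioi 0) ∧
      p * (b + 1 - p) * ((∫ s in Ioi (0 : ℝ), s ^ b * exp (-s) * m s ^ 2)
        - (∫ s in Ioi (0 : ℝ), s ^ b * exp (-s) * m s) ^ 2 / Gamma (b + 1)) ≤
        ∫ s in Ioi (0 : ℝ), s ^ (b + 2) * exp (-s) * m' s ^ 2) ∧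
    (∀ i, ∀ p b : ℝ, 0 < p → p ≤ 1 → p < b + 1 →
      IntegrableOn (fun s => s ^ b * exp (-s) * c i s ^ 2) (Ioi 0) ∧
      IntegrableOn (fun s => s ^ (b + 2) * exp (-s) * c' i s ^ 2) (Ioi 0) ∧
      p * (b + 1 - p) * ((∫ s in Ioi (0 : ℝ), s ^ b * exp (-s) * c i s ^ 2)
        - (∫ s in Ioi (0 : ℝ), s ^ b * exp (-s) * c i s) ^ 2 / Gamma (b + 1)) ≤
        ∫ s in Ioi (0 : ℝ), s ^ (b + 2) * exp (-s) * c' i s ^ 2) := by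
  have hgc : HasCompactSupport (fun x => (f x : ℂ)) := hc.comp_left Complex.ofReal_zero
  have hgs : ContDiff ℝ ∞ (fun x => (f x : ℂ)) := Complex.ofRealCLM.contDiff.comp hf
  set g : 𝓢(𝔼, ℂ) := hgc.toSchwartzMap hgs with hg
  have hgx : ∀ x, g x = (f x : ℂ) := fun x => rfl
  have hgd : ∀ (i : Fin d) (x : 𝔼), (∂_{(EuclideanSpace.single i 1 : 𝔼)} g) x =
      ((gradient f x i : ℝ) : ℂ) := fun i x => by
    rw [SchwartzMap.lineDerivOp_apply_eq_fderiv, gradient_apply_eq_fderiv]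
    have h1 : HasFDerivAt (fun x => (f x : ℂ)) (Complex.ofRealCLM.comp (fderiv ℝ f x)) x :=
      Complex.ofRealCLM.hasFDerivAt.comp x (hf.differentiable (by simp) x).hasFDerivAt
    rw [show (⇑g) = fun x => (f x : ℂ) from rfl, h1.fderiv]
    rfl
  set F : 𝓢(𝔼, ℂ) := 𝓕 g with hF
  have hb0 : ∀ ξ : 𝔼, |(1 : ℝ)| ≤ ‖ξ‖ ^ 0 := by simp
  have hb1 : ∀ (i : Fin d) (ξ : 𝔼), |ξ i| ≤ ‖ξ‖ ^ 1 := fun i ξ => by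
    simpa using abs_apply_le_norm ξ i
  have hM0 : ∀ s, 0 < s → (gaussianMass 𝔼 s : ℂ) * (1 * fourierMoment F (fun _ => 1) s) =
      ((∫ x : 𝔼, f x * exp (-s * ‖x‖ ^ 2) : ℝ) : ℂ) := fun s hs => by
    have h := integral_mul_gaussian F.integrable (schwartz_eq_integral_fourier g) hs
    rw [← integral_complex_ofReal]
    simp_rw [hgx, ← Complex.ofReal_mul] at h
    rw [h, fourierMoment, one_mul]
    simp
  have hM1 : ∀ (i : Fin d) (s : ℝ), 0 < s → (gaussianMass 𝔼 s : ℂ) *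
      (2 * π * Complex.I * fourierMoment F (fun ξ => ξ i) s) =
      ((∫ x : 𝔼, gradient f x i * exp (-s * ‖x‖ ^ 2) : ℝ) : ℂ) := fun i s hs => by
    have h := integral_mul_gaussian
      (𝓕 (∂_{(EuclideanSpace.single i 1 : 𝔼)} g) : 𝓢(𝔼, ℂ)).integrable
      (schwartz_eq_integral_fourier _) hs
    rw [← integral_complex_ofReal]
    simp_rw [hgd, ← Complex.ofReal_mul] at h
    rw [h, fourierMoment, ← integral_const_mul]
    congr 2 with ξ
    rw [fourier_lineDeriv_apply, EuclideanSpace.inner_single_right]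
    simp only [conj_trivial, one_mul]
    ring
  have hreal : ∀ (Z R : ℝ) (z : ℂ), 0 < Z → (Z : ℂ) * z = (R : ℂ) → Z * z.re = R ∧
      ‖z‖ ^ 2 = z.re ^ 2 := fun Z R z hZ h => by
    have h1 := congrArg Complex.re h
    have h2 := congrArg Complex.im h
    rw [Complex.re_ofReal_mul, Complex.ofReal_re] at h1
    rw [Complex.im_ofReal_mul, Complex.ofReal_im] at h2
    have h3 : z.im = 0 := by simpa [hZ.ne'] using h2
    refine ⟨h1, ?_⟩
    rw [← Complex.normSq_eq_norm_sq, Complex.normSq_apply, h3]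
    ring
  refine ⟨fun s => (1 * fourierMoment F (fun _ => 1) s).re,
    fun s => (1 * ((π ^ 2 / s ^ 2 : ℝ) * fourierMoment F (fun ξ => 1 * ‖ξ‖ ^ 2) s)).re,
    fun i s => (2 * π * Complex.I * fourierMoment F (fun ξ => ξ i) s).re,
    fun i s => (2 * π * Complex.I *
      ((π ^ 2 / s ^ 2 : ℝ) * fourierMoment F (fun ξ => ξ i * ‖ξ‖ ^ 2) s)).re,
    fun s hs => (hreal _ _ _ (gaussianMass_pos hs) (hM0 s hs)).1,
    fun i s hs => (hreal _ _ _ (gaussianMass_pos hs) (hM1 i s hs)).1, ?_,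
    fun p b hp hp1 hpb => gamma_poincare_moment F continuous_const hb0 1 hp hp1 hpb
      (fun _ => rfl) (fun _ => rfl),
    fun i p b hp hp1 hpb => gamma_poincare_moment F (by fun_prop) (hb1 i) (2 * π * Complex.I)
      hp hp1 hpb (fun _ => rfl) (fun _ => rfl)⟩
  intro s σ hs hσ0 hσ1
  have hd' : (0 : ℝ) < d := by exact_mod_cast hd
  have hZ := gaussianMass_pos (V := 𝔼) hs
  have key := gaussian_gap g hd hs hσ0 hσ1
  simp_rw [hgd, hgx, Complex.norm_real, norm_eq_abs, sq_abs, ← hF] at key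
  have e0 := (hreal _ _ _ hZ (hM0 s hs)).2
  have e1 := fun i => (hreal _ _ _ hZ (hM1 i s hs)).2
  have n0 : ∀ z : ℂ, ‖2 * π * Complex.I * z‖ ^ 2 = 4 * π ^ 2 * ‖z‖ ^ 2 := fun z => by
    simp only [norm_mul, Complex.norm_I, Complex.norm_real, norm_of_nonneg pi_pos.le,
      Complex.norm_ofNat]
    ring
  have sqre : ∀ z : ℂ, z.re ^ 2 ≤ ‖z‖ ^ 2 := fun z => by
    rw [← sq_abs]
    exact pow_le_pow_left₀ (abs_nonneg _) (Complex.abs_re_le_norm z) 2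
  have l0 : (1 - σ) * (2 / d) * (s ^ 2 *
      (1 * ((π ^ 2 / s ^ 2 : ℝ) * fourierMoment F (fun ξ => 1 * ‖ξ‖ ^ 2) s)).re ^ 2) ≤
      (1 - σ) / 2 * ((2 * (π ^ 2 / s)) ^ 2 / d *
        ‖fourierMoment F (fun ξ => ‖ξ‖ ^ 2) s‖ ^ 2) := by
    have h1 := sqre (1 * ((π ^ 2 / s ^ 2 : ℝ) * fourierMoment F (fun ξ => 1 * ‖ξ‖ ^ 2) s))
    rw [one_mul, norm_mul, Complex.norm_real, norm_of_nonneg (by positivity), mul_pow] at h1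
    simp_rw [one_mul] at h1 ⊢
    calc _ ≤ (1 - σ) * (2 / d) * (s ^ 2 * ((π ^ 2 / s ^ 2) ^ 2 *
          ‖fourierMoment F (fun ξ => ‖ξ‖ ^ 2) s‖ ^ 2)) := by
          have : 0 ≤ 1 - σ := by linarith
          gcongr
      _ = _ := by field_simp
  have l1 : (2 - σ) / (3 * d) * (s * ∑ i, (2 * π * Complex.I *
      ((π ^ 2 / s ^ 2 : ℝ) * fourierMoment F (fun ξ => ξ i * ‖ξ‖ ^ 2) s)).re ^ 2) ≤
      (2 - σ) / 6 * ((2 * (π ^ 2 / s)) ^ 3 / d *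
        ∑ i, ‖fourierMoment F (fun ξ => ξ i * ‖ξ‖ ^ 2) s‖ ^ 2) := by
    have h1 : ∀ i : Fin d, (2 * π * Complex.I *
      ((π ^ 2 / s ^ 2 : ℝ) * fourierMoment F (fun ξ => ξ i * ‖ξ‖ ^ 2) s)).re ^ 2 ≤
      4 * π ^ 2 * (π ^ 2 / s ^ 2) ^ 2 * ‖fourierMoment F (fun ξ => ξ i * ‖ξ‖ ^ 2) s‖ ^ 2 :=
      fun i => by
        refine (sqre _).trans (le_of_eq ?_)
        rw [n0, norm_mul, Complex.norm_real, norm_of_nonneg (by positivity), mul_pow]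
        ring
    calc _ ≤ (2 - σ) / (3 * d) * (s * ∑ i : Fin d, 4 * π ^ 2 * (π ^ 2 / s ^ 2) ^ 2 *
          ‖fourierMoment F (fun ξ => ξ i * ‖ξ‖ ^ 2) s‖ ^ 2) := by
          have : 0 ≤ 2 - σ := by linarith
          gcongr with i
          exact h1 i
      _ = _ := by rw [← Finset.mul_sum]; field_simp; ring
  have r0 : σ * (2 * (π ^ 2 / s)) * ∑ i, ‖fourierMoment F (fun ξ => ξ i) s‖ ^ 2 =
      σ / (2 * s) * ∑ i, (2 * π * Complex.I * fourierMoment F (fun ξ => ξ i) s).re ^ 2 := by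
    simp_rw [← e1, n0]
    rw [← Finset.mul_sum]
    field_simp
    ring
  rw [r0] at key
  simp only [one_mul] at e0 l0 ⊢
  rw [← e0]
  refine le_trans ?_ key
  gcongr

lemma integrable_compact {g : 𝔼 → ℝ} (hg : Continuous g) (hc : HasCompactSupport g) :
    Integrable g := hg.integrable_of_hasCompactSupport hc

lemma hasFDerivAt_cauchyWeight (p : ℝ) (x : 𝔼) : HasFDerivAt (cauchyWeight p : 𝔼 → ℝ)
    ((-(2 * p) * cauchyWeight (p + 1) x) • innerSL ℝ x) x := by
  have h1 : HasFDerivAt (fun x : 𝔼 => 1 + ‖x‖ ^ 2) ((2 : ℝ) • innerSL ℝ x) x := by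
    have := (hasStrictFDerivAt_norm_sq x).hasFDerivAt.const_add 1
    refine this.congr_fderiv ?_
    ext y; simp
  refine (h1.rpow_const (p := -p) (Or.inl (by positivity))).congr_fderiv ?_
  ext y
  simp only [smul_apply, smul_eq_mul, cauchyWeight]
  rw [show -(p + 1) = -p - 1 by ring]
  ring

/-- Integration by parts against the weight: the coordinates are eigenfunctions of the weighted
Laplacian. -/
lemma integral_gradient_mul_cauchyWeight {f : 𝔼 → ℝ} (hf : ContDiff ℝ ∞ f)
    (hc : HasCompactSupport f) (p : ℝ) (i : Fin d) :
    ∫ x, gradient f x i * cauchyWeight p x = 2 * p * ∫ x, f x * x i * cauchyWeight (p + 1) x := by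
  have hw := hasFDerivAt_cauchyWeight (d := d) p
  have hder : ∀ x : 𝔼, fderiv ℝ (cauchyWeight p : 𝔼 → ℝ) x (EuclideanSpace.single i 1) =
      -(2 * p) * cauchyWeight (p + 1) x * x i := fun x => by
    rw [(hw x).fderiv]
    simp [EuclideanSpace.inner_single_right]
  have hfc := hf.continuous
  have hcw := fun q => continuous_cauchyWeight (V := 𝔼) q
  have hdf : Continuous fun x => gradient f x i :=
    (by fun_prop : Continuous fun y : 𝔼 => y i).comp (continuous_gradient hf)
  have hgi : HasCompactSupport fun x => gradient f x i :=
    (hasCompactSupport_gradient hc).comp_left (g := fun y : 𝔼 => y i) rfl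
  have h := integral_mul_fderiv_eq_neg_fderiv_mul_of_integrable (μ := (volume : Measure 𝔼))
    (f := f) (g := cauchyWeight p) (v := EuclideanSpace.single i 1) ?_ ?_ ?_ ?_ ?_
  · simp_rw [hder, ← gradient_apply_eq_fderiv] at h
    rw [← neg_eq_iff_eq_neg.2 h, ← integral_neg, ← integral_const_mul]
    congr 1 with x
    ring
  · simp_rw [← gradient_apply_eq_fderiv]
    exact integrable_compact (hdf.mul (hcw _)) hgi.mul_right
  · simp_rw [hder]
    have := hcw (p + 1)
    exact integrable_compact (by fun_prop) hc.mul_right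
  · exact integrable_compact (hfc.mul (hcw _)) hc.mul_right
  · exact fun x _ => hf.differentiable (by simp) x
  · exact fun x _ => (hw x).differentiableAt

end SmoothGap

section SmoothGap
open scoped RealInnerProductSpace

variable {d : ℕ}

local notation "𝔼" => EuclideanSpace ℝ (Fin d)

/-- The exponents `a = 1 / (1 - m)` for which the spectral gap is proved: `d < a` means `m₁ < m`,
and the bound in dimension one means `1 / 3 < m`. In all dimensions the weight of exponent `a`
then has finite second moments. -/
structure AdmissibleExponent (d : ℕ) (a : ℝ) : Prop where
  one_le : 1 ≤ d
  lt : (d : ℝ) < a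
  lt_of_one : d = 1 → 3 / 2 < a

lemma AdmissibleExponent.half_lt {a : ℝ} (h : AdmissibleExponent d a) : (d : ℝ) / 2 + 1 < a := by
  rcases Nat.lt_or_ge 1 d with h2 | h2
  · have h3 : (2 : ℝ) ≤ d := by exact_mod_cast h2
    linarith [h.lt]
  · have h3 : d = 1 := le_antisymm h2 h.one_le
    have := h.lt_of_one h3
    subst h3
    push_cast; linarith

/-- The comparison of constants for the modes of degree `0` and `2`. -/
lemma gap_constant_radial {a : ℝ} (h : AdmissibleExponent d a) {σ : ℝ}
    (hσ : σ = 2 / 3 * (1 - d / a)) :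
    1 + σ ≤ (1 - σ) * (2 / d) * (a - d / 2) := by
  have hd : (0 : ℝ) < d := by exact_mod_cast h.one_le
  have ha := h.lt
  have ha0 : 0 < a := by linarith
  have e : (1 - σ) * (2 / d) * (a - d / 2) - (1 + σ) = 2 * (a - d) / (3 * d) := by
    rw [hσ]; field_simp; ring
  have : 0 ≤ 2 * (a - d) / (3 * d) := div_nonneg (by linarith) (by positivity)
  linarith

/-- The comparison of constants for the modes of degree `1` and `3`. The last factor is the constant
of `gamma_poincare` for `p = 1 / 2` and `b = a - d / 2 - 1`. -/
lemma gap_constant_linear {a : ℝ} (h : AdmissibleExponent d a) {σ : ℝ}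
    (hσ : σ = 2 / 3 * (1 - d / a)) :
    σ / 2 ≤ (2 - σ) / (3 * d) * (1 / 2 * (a - d / 2 - 1 + 1 - 1 / 2)) := by
  have hd1 : (1 : ℝ) ≤ d := by exact_mod_cast h.one_le
  have hd : (0 : ℝ) < d := by linarith
  have ha := h.lt
  have ha0 : 0 < a := by linarith
  have e : (2 - σ) / (3 * d) * (1 / 2 * (a - d / 2 - 1 + 1 - 1 / 2)) - σ / 2 =
      ((4 * a + 2 * d) * (2 * a - d - 1) - 12 * d * (a - d)) / (36 * a * d) := by
    rw [hσ]; field_simp; ring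
  have : 0 ≤ ((4 * a + 2 * d) * (2 * a - d - 1) - 12 * d * (a - d)) / (36 * a * d) := by
    refine div_nonneg ?_ (by positivity)
    nlinarith [mul_nonneg (sub_nonneg.2 ha.le) (sub_nonneg.2 hd1), sq_nonneg (a - d),
      mul_nonneg hd.le (sub_nonneg.2 hd1)]
  linarith

lemma sub_le_of_poincare {α β l X Y N : ℝ} (hα : 0 ≤ α) (hβ : 0 ≤ β) (hαβ : α ≤ β * l)
    (h : l * (X - N) ≤ Y) (hY : 0 ≤ Y) : α * X - β * Y ≤ α * N := by
  have h4 := mul_le_mul_of_nonneg_left h hβ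
  rcases le_total 0 (X - N) with h6 | h6
  · have := mul_le_mul_of_nonneg_right hαβ h6
    linarith
  · have := mul_nonneg hβ hY
    have := mul_nonneg hα (neg_nonneg.2 h6)
    linarith

set_option maxHeartbeats 800000 in
/-- The weighted Poincaré inequality with improved constant `2 a (1 + σ)`, `σ = 2 (1 - d / a) / 3`,
for smooth compactly supported functions. The constant lies between the first eigenvalue `2 a`,
whose eigenfunctions are the coordinates, and the second one `4 a - 2 d`. -/
theorem weighted_gap_smooth {a : ℝ} (h : AdmissibleExponent d a) {σ : ℝ}
    (hσ : σ = 2 / 3 * (1 - d / a)) {f : 𝔼 → ℝ} (hf : ContDiff ℝ ∞ f) (hc : HasCompactSupport f) :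
    (1 + σ) * ((∫ x, f x ^ 2 * cauchyWeight (a + 1) x) -
        (∫ x, f x * cauchyWeight (a + 1) x) ^ 2 / (∫ x : 𝔼, cauchyWeight (a + 1) x)) -
      σ * ((∑ i, (∫ x, f x * x i * cauchyWeight (a + 1) x) ^ 2) /
        ((∫ x : 𝔼, cauchyWeight a x) / (2 * a))) ≤
    1 / (2 * a) * ∫ x, ‖gradient f x‖ ^ 2 * cauchyWeight a x := by
  have hd1 : (1 : ℝ) ≤ d := by exact_mod_cast h.one_le
  have hd0 : (0 : ℝ) < d := by linarith
  have hda := h.lt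
  have hhalf := h.half_lt
  have ha0 : 0 < a := by linarith
  have hσ0 : 0 ≤ σ := by
    rw [hσ]
    have : (d : ℝ) / a ≤ 1 := (div_le_one ha0).2 hda.le
    linarith
  have hσ1 : σ ≤ 1 := by
    rw [hσ]
    have : 0 ≤ (d : ℝ) / a := by positivity
    linarith
  obtain ⟨m, m', c, c', hm, hcm, hgap, hpm, hpc⟩ := exists_gaussian_means hf hc h.one_le
  set δ : ℝ := (d : ℝ) / 2 with hδ
  set P : ℝ := π ^ δ with hP
  have hP0 : 0 < P := rpow_pos_of_pos pi_pos _
  have hZ : ∀ s : ℝ, 0 < s → gaussianMass 𝔼 s = P * s ^ (-δ) := fun s hs => by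
    rw [gaussianMass_eq hs]; simp [hP, hδ]
  have hfcont := hf.continuous
  have hgcont := continuous_gradient hf
  have hgcpt := hasCompactSupport_gradient hc
  have hf2 : Integrable fun x => f x ^ 2 :=
    integrable_compact (by fun_prop) (hc.comp_left (g := fun y => y ^ 2) (by simp))
  have hf1 : Integrable f := integrable_compact hfcont hc
  have hgi : ∀ i : Fin d, Integrable fun x => gradient f x i := fun i =>
    integrable_compact ((by fun_prop : Continuous fun y : 𝔼 => y i).comp hgcont)
      (hgcpt.comp_left (g := fun y : 𝔼 => y i) rfl)
  have hg2 : ∀ i : Fin d, Integrable fun x => gradient f x i ^ 2 := fun i =>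
    integrable_compact ((by fun_prop : Continuous fun y : 𝔼 => y i ^ 2).comp hgcont)
      (hgcpt.comp_left (g := fun y : 𝔼 => y i ^ 2) (by simp))
  obtain ⟨im, im', pm⟩ := hpm 1 (a - δ) one_pos le_rfl (by linarith)
  have hpc' := fun i => hpc i (1 / 2) (a - δ - 1) (by norm_num) (by norm_num) (by linarith)
  -- the spectral inequality on each Gaussian, multiplied by `s ^ a * exp (-s)`
  have hpt : ∀ s : ℝ, 0 < s →
      (1 + σ) * (s ^ (a + 1 - 1) * exp (-s) * ∫ x : 𝔼, f x ^ 2 * exp (-s * ‖x‖ ^ 2)) +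
        (P * ((1 - σ) * (2 / d)) * (s ^ (a - δ + 2) * exp (-s) * m' s ^ 2) +
        P * ((2 - σ) / (3 * d)) * ∑ i, s ^ (a - δ - 1 + 2) * exp (-s) * c' i s ^ 2) ≤
      1 / 2 * (∑ i, s ^ (a - 1) * exp (-s) * ∫ x : 𝔼, gradient f x i ^ 2 * exp (-s * ‖x‖ ^ 2)) +
        (P * (1 + σ) * (s ^ (a - δ) * exp (-s) * m s ^ 2) +
        P * (σ / 2) * ∑ i, s ^ (a - δ - 1) * exp (-s) * c i s ^ 2) := fun s hs => by
    have key := mul_le_mul_of_nonneg_left (hgap s σ hs hσ0 hσ1)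
      (by positivity : 0 ≤ s ^ a * exp (-s))
    rw [hZ s hs] at key
    have e0 : s ^ (a + 1 - 1) = s ^ a := by ring_nf
    have e1 : s ^ (a - 1) = s ^ a / s := by rw [rpow_sub hs, rpow_one]
    have e2 : s ^ (a - δ) = s ^ a * s ^ (-δ) := by rw [← rpow_add hs]; rfl
    have e3 : s ^ (a - δ - 1) = s ^ a * s ^ (-δ) / s := by rw [rpow_sub hs, rpow_one, e2]
    have e4 : s ^ (a - δ + 2) = s ^ a * s ^ (-δ) * s ^ 2 := by
      rw [rpow_add hs, e2]; norm_cast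
    have e5 : s ^ (a - δ - 1 + 2) = s ^ a * s ^ (-δ) * s := by
      rw [rpow_add hs, e3, show s ^ (2 : ℝ) = s ^ 2 by norm_cast]; field_simp
    simp_rw [← Finset.mul_sum]
    rw [e0, e1, e2, e3, e4, e5]
    calc _ = _ := ?_
      _ ≤ _ := key
      _ = _ := ?_
    · ring
    · field_simp
  have iA := integrableOn_mixture (p := a + 1) (by linarith) hf2
  have iD := fun i => integrableOn_mixture ha0 (hg2 i)
  have iL2 : IntegrableOn (fun s => ∑ i, s ^ (a - δ - 1 + 2) * exp (-s) * c' i s ^ 2) (Ioi 0) :=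
    integrable_finsetSum _ fun i _ => (hpc' i).2.1
  have iR1 : IntegrableOn (fun s => ∑ i, s ^ (a - 1) * exp (-s) *
      ∫ x : 𝔼, gradient f x i ^ 2 * exp (-s * ‖x‖ ^ 2)) (Ioi 0) :=
    integrable_finsetSum _ fun i _ => iD i
  have iR2 : IntegrableOn (fun s => ∑ i, s ^ (a - δ - 1) * exp (-s) * c i s ^ 2) (Ioi 0) :=
    integrable_finsetSum _ fun i _ => (hpc' i).1
  have iL' := (im'.const_mul (P * ((1 - σ) * (2 / d)))).add
    (iL2.const_mul (P * ((2 - σ) / (3 * d))))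
  have iR' := (im.const_mul (P * (1 + σ))).add (iR2.const_mul (P * (σ / 2)))
  have hmain := setIntegral_mono_on ((iA.const_mul (1 + σ)).add iL')
    ((iR1.const_mul (1 / 2)).add iR') measurableSet_Ioi hpt
  rw [integral_add' (iA.const_mul (1 + σ)) iL', integral_add' (iR1.const_mul (1 / 2)) iR',
    integral_add' (im'.const_mul _) (iL2.const_mul _),
    integral_add' (im.const_mul _) (iR2.const_mul _)] at hmain
  simp_rw [integral_const_mul] at hmain
  rw [integral_finsetSum _ fun i _ => (hpc' i).2.1, integral_finsetSum _ fun i _ => iD i,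
    integral_finsetSum _ fun i _ => (hpc' i).1, integral_mixture (by linarith) hf2] at hmain
  simp_rw [integral_mixture ha0 (hg2 _)] at hmain
  -- the means of `m` and `c i` are weighted integrals of `f`
  have mean0 : P * ∫ s in Ioi (0 : ℝ), s ^ (a - δ) * exp (-s) * m s =
      Gamma (a + 1) * ∫ x, f x * cauchyWeight (a + 1) x := by
    rw [← integral_mixture (by linarith) hf1, ← integral_const_mul]
    refine setIntegral_congr_fun measurableSet_Ioi fun s hs => ?_
    have hs' : (0 : ℝ) < s := hs
    beta_reduce
    rw [← hm s hs, hZ s hs, show a + 1 - 1 = a by ring, sub_eq_add_neg, rpow_add hs']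
    ring
  have mean1 : ∀ i, P * ∫ s in Ioi (0 : ℝ), s ^ (a - δ - 1) * exp (-s) * c i s =
      2 * Gamma (a + 1) * ∫ x, f x * x i * cauchyWeight (a + 1) x := fun i => by
    have e : 2 * Gamma (a + 1) * ∫ x, f x * x i * cauchyWeight (a + 1) x =
        Gamma a * ∫ x, gradient f x i * cauchyWeight a x := by
      rw [integral_gradient_mul_cauchyWeight hf hc, Gamma_add_one ha0.ne']
      ring
    rw [e, ← integral_mixture ha0 (hgi i), ← integral_const_mul]
    refine setIntegral_congr_fun measurableSet_Ioi fun s hs => ?_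
    have hs' : (0 : ℝ) < s := hs
    beta_reduce
    rw [← hcm i s hs, hZ s hs, show a - δ - 1 = a - 1 + -δ by ring, rpow_add hs']
    ring
  have hmass0 : Gamma (a + 1) * ∫ x : 𝔼, cauchyWeight (a + 1) x = P * Gamma (a - δ + 1) := by
    rw [integral_cauchyWeight (by simp; linarith)]
    simp [hP, hδ]; left; ring_nf
  have hmass1 : Gamma a * ∫ x : 𝔼, cauchyWeight a x = P * Gamma (a - δ - 1 + 1) := by
    rw [integral_cauchyWeight (by simp; linarith)]
    simp [hP, hδ]
  have hG1 : Gamma (a + 1) = a * Gamma a := Gamma_add_one ha0.ne'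
  have hGa : 0 < Gamma a := Gamma_pos_of_pos ha0
  have hGb : 0 < Gamma (a - δ + 1) := Gamma_pos_of_pos (by linarith)
  have hGb1 : 0 < Gamma (a - δ - 1 + 1) := Gamma_pos_of_pos (by linarith)
  set W0 := ∫ x : 𝔼, cauchyWeight (a + 1) x
  set W1 := ∫ x : 𝔼, cauchyWeight a x
  set A := ∫ x, f x ^ 2 * cauchyWeight (a + 1) x
  set A0 := ∫ x, f x * cauchyWeight (a + 1) x
  set X0 := ∫ s in Ioi (0 : ℝ), s ^ (a - δ) * exp (-s) * m s ^ 2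
  set Y0 := ∫ s in Ioi (0 : ℝ), s ^ (a - δ + 2) * exp (-s) * m' s ^ 2
  set M0 := ∫ s in Ioi (0 : ℝ), s ^ (a - δ) * exp (-s) * m s
  have hX0 : (1 + σ) * X0 - (1 - σ) * (2 / d) * Y0 ≤ (1 + σ) * (M0 ^ 2 / Gamma (a - δ + 1)) := by
    have h1 := gap_constant_radial h hσ
    rw [← hδ] at h1
    have h2 : 0 ≤ (1 - σ) * (2 / d) := mul_nonneg (by linarith) (by positivity)
    have hb : 0 < a - δ := by linarith
    have h3 : (a - δ) * (X0 - M0 ^ 2 / Gamma (a - δ + 1)) ≤ Y0 := by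
      have := pm; rw [one_mul, add_sub_cancel_right] at this; exact this
    have h5 : 0 ≤ Y0 := setIntegral_nonneg measurableSet_Ioi fun s hs => by
      have : (0 : ℝ) < s := hs
      positivity
    exact sub_le_of_poincare (by linarith) h2 h1 h3 h5
  have hX1 : ∀ i, σ / 2 * (∫ s in Ioi (0 : ℝ), s ^ (a - δ - 1) * exp (-s) * c i s ^ 2) -
      (2 - σ) / (3 * d) * (∫ s in Ioi (0 : ℝ), s ^ (a - δ - 1 + 2) * exp (-s) * c' i s ^ 2) ≤
      σ / 2 * ((∫ s in Ioi (0 : ℝ), s ^ (a - δ - 1) * exp (-s) * c i s) ^ 2 /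
        Gamma (a - δ - 1 + 1)) := fun i => by
    have h1 := gap_constant_linear h hσ
    rw [← hδ] at h1
    have h2 : 0 ≤ (2 - σ) / (3 * d) := div_nonneg (by linarith) (by positivity)
    have h3 := (hpc' i).2.2
    have h5 : 0 ≤ ∫ s in Ioi (0 : ℝ), s ^ (a - δ - 1 + 2) * exp (-s) * c' i s ^ 2 :=
      setIntegral_nonneg measurableSet_Ioi fun s hs => by
        have : (0 : ℝ) < s := hs
        positivity
    exact sub_le_of_poincare (by linarith) h2 h1 h3 h5
  have hX1s := Finset.sum_le_sum fun i (_ : i ∈ Finset.univ) => hX1 i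
  rw [Finset.sum_sub_distrib, ← Finset.mul_sum, ← Finset.mul_sum, ← Finset.mul_sum] at hX1s
  -- rewrite the squared means through the total masses
  have q0 : P * (M0 ^ 2 / Gamma (a - δ + 1)) = Gamma (a + 1) * (A0 ^ 2 / W0) := by
    have hM0 : M0 = Gamma (a + 1) * A0 / P := by rw [← mean0]; field_simp
    have hW0 : W0 = P * Gamma (a - δ + 1) / Gamma (a + 1) := by
      rw [← hmass0, hG1]; field_simp
    rw [hM0, hW0, hG1]
    field_simp
  have q1 : ∀ i, P * ((∫ s in Ioi (0 : ℝ), s ^ (a - δ - 1) * exp (-s) * c i s) ^ 2 /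
      Gamma (a - δ - 1 + 1)) = 2 * Gamma (a + 1) *
        ((∫ x, f x * x i * cauchyWeight (a + 1) x) ^ 2 / (W1 / (2 * a))) := fun i => by
    have hM1 : ∫ s in Ioi (0 : ℝ), s ^ (a - δ - 1) * exp (-s) * c i s =
        2 * Gamma (a + 1) * (∫ x, f x * x i * cauchyWeight (a + 1) x) / P := by
      rw [← mean1]; field_simp
    have hW1 : W1 = P * Gamma (a - δ - 1 + 1) / Gamma a := by
      rw [← hmass1]; field_simp
    rw [hM1, hW1, hG1]
    field_simp
  have q1s : P * ∑ i, ((∫ s in Ioi (0 : ℝ), s ^ (a - δ - 1) * exp (-s) * c i s) ^ 2 /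
      Gamma (a - δ - 1 + 1)) = 2 * Gamma (a + 1) *
        ((∑ i, (∫ x, f x * x i * cauchyWeight (a + 1) x) ^ 2) / (W1 / (2 * a))) := by
    rw [Finset.mul_sum, Finset.sum_congr rfl fun i _ => q1 i, ← Finset.mul_sum, Finset.sum_div]
  have hgr : ∑ i, ∫ x, gradient f x i ^ 2 * cauchyWeight a x =
      ∫ x, ‖gradient f x‖ ^ 2 * cauchyWeight a x := by
    rw [← integral_finsetSum]
    · congr 1 with x
      rw [EuclideanSpace.real_norm_sq_eq, Finset.sum_mul]
    · intro i _
      exact integrable_compact (((by fun_prop : Continuous fun y : 𝔼 => y i ^ 2).comp hgcont).mul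
        (continuous_cauchyWeight a)) (hgcpt.comp_left (g := fun y : 𝔼 => y i ^ 2)
          (by simp)).mul_right
  rw [← Finset.mul_sum, hgr] at hmain
  set D := ∫ x, ‖gradient f x‖ ^ 2 * cauchyWeight a x
  have t0 := mul_le_mul_of_nonneg_left hX0 hP0.le
  have t1 := mul_le_mul_of_nonneg_left hX1s hP0.le
  have fin : Gamma (a + 1) * ((1 + σ) * (A - A0 ^ 2 / W0) -
      σ * ((∑ i, (∫ x, f x * x i * cauchyWeight (a + 1) x) ^ 2) / (W1 / (2 * a)))) ≤
      Gamma (a + 1) * (1 / (2 * a) * D) := by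
    have e1 : Gamma (a + 1) * (1 / (2 * a) * D) = 1 / 2 * (Gamma a * D) := by
      rw [hG1]; field_simp
    rw [e1]
    have t0' : P * ((1 + σ) * (M0 ^ 2 / Gamma (a - δ + 1))) =
      (1 + σ) * (Gamma (a + 1) * (A0 ^ 2 / W0)) := by rw [← q0]; ring
    rw [t0'] at t0
    rw [mul_left_comm P, q1s] at t1
    linarith
  exact le_of_mul_le_mul_left fin (by rw [hG1]; positivity)

end SmoothGap

/-! ### Mollification and weak gradients -/

section Mollify
open scoped RealInnerProductSpace Convolution
open ContinuousLinearMap (lsmul)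

variable {d : ℕ}

local notation "𝔼" => EuclideanSpace ℝ (Fin d)

lemma hasCompactSupport_translate {ρ : 𝔼 → ℝ} (hρc : HasCompactSupport ρ) (x : 𝔼) :
    HasCompactSupport fun y => ρ (x - y) :=
  hρc.comp_homeomorph (Homeomorph.subLeft x)

/-- The convolution with a smooth kernel of a function with a weak gradient has as its gradient
the convolution of the weak gradient. -/
lemma HasWeakGradient.gradient_convolution {f : 𝔼 → ℝ} {G : 𝔼 → 𝔼} (h : HasWeakGradient f G)
    {ρ : 𝔼 → ℝ} (hρ : ContDiff ℝ ∞ ρ) (hρc : HasCompactSupport ρ) (x : 𝔼) :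
    HasGradientAt (ρ ⋆[lsmul ℝ ℝ, volume] f) ((ρ ⋆[lsmul ℝ ℝ, volume] G) x) x := by
  have h1 := hρc.hasFDerivAt_convolution_left (L := lsmul ℝ ℝ) (hρ.of_le (by simp))
    h.locallyIntegrable x
  have hρd : Differentiable ℝ ρ := hρ.differentiable (by simp)
  have hgrad : ∀ y, gradient (fun y => ρ (x - y)) y = -gradient ρ (x - y) := fun y => by
    have h2 : HasFDerivAt (fun y => ρ (x - y)) (-fderiv ℝ ρ (x - y)) y := by
      have := (hρd (x - y)).hasFDerivAt.comp y ((hasFDerivAt_id y).const_sub x)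
      refine this.congr_fderiv ?_
      ext v; simp
    rw [gradient, h2.fderiv, map_neg]; rfl
  have h3 := h.integral_eq (fun y => ρ (x - y)) (hρ.comp (contDiff_const.sub contDiff_id))
    (hasCompactSupport_translate hρc x)
  simp_rw [hgrad, smul_neg, integral_neg, neg_inj] at h3
  rw [hasGradientAt_iff_hasFDerivAt]
  refine h1.congr_fderiv ?_
  ext v
  rw [InnerProductSpace.toDual_apply_apply, convolution_lsmul_swap, ← h3, convolution_eq_swap,
    ContinuousLinearMap.integral_apply, real_inner_comm, ← integral_inner]
  · congr 1 with y
    rw [inner_smul_right, real_inner_comm, inner_gradient_left]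
    simp [mul_comm]
  · have hcg : Continuous fun y => gradient ρ (x - y) :=
      (continuous_gradient hρ).comp (by fun_prop)
    exact h.locallyIntegrable.integrable_smul_right_of_hasCompactSupport hcg
      ((hasCompactSupport_gradient hρc).comp_homeomorph (Homeomorph.subLeft x))
  · have := (hρc.fderiv (𝕜 := ℝ)).convolutionExists_left ((lsmul ℝ ℝ).precompL 𝔼)
      (hρ.continuous_fderiv (by simp)) h.locallyIntegrable x
    exact (convolutionExistsAt_iff_integrable_swap).1 this

/-- The weight varies slowly: its values at distance at most `δ ≤ 1` are comparable with a
constant close to `1`. -/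
lemma cauchyWeight_le_mul {p δ : ℝ} (hp : 0 ≤ p) (hδ1 : δ ≤ 1) {x y : 𝔼}
    (hxy : ‖x - y‖ ≤ δ) : cauchyWeight p x ≤ (1 + 2 * δ) ^ p * cauchyWeight p y := by
  have hδ0 : 0 ≤ δ := (norm_nonneg _).trans hxy
  have h1 : ‖y‖ ≤ ‖x‖ + δ := by
    have := norm_sub_norm_le y x
    rw [norm_sub_rev] at this
    linarith
  have h2 : 1 + ‖y‖ ^ 2 ≤ (1 + 2 * δ) * (1 + ‖x‖ ^ 2) := by
    have : ‖y‖ ^ 2 ≤ (‖x‖ + δ) ^ 2 := pow_le_pow_left₀ (norm_nonneg _) h1 2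
    nlinarith [mul_nonneg hδ0 (sq_nonneg (‖x‖ - 1)), mul_nonneg hδ0 (sub_nonneg.2 hδ1)]
  rw [cauchyWeight, cauchyWeight, rpow_neg (by positivity), rpow_neg (by positivity),
    ← div_eq_mul_inv, inv_eq_one_div, div_le_div_iff₀ (by positivity) (by positivity), one_mul,
    ← mul_rpow (by positivity) (by positivity)]
  exact rpow_le_rpow (by positivity) h2 hp

/-- Mollification does not increase the weighted energy by more than a factor close to `1`:
Jensen's inequality, and the slow variation of the weight. -/
lemma integral_norm_convolution_sq_le {G : 𝔼 → 𝔼} (hG : LocallyIntegrable G) {a δ : ℝ}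
    (ha : 0 ≤ a) (hδ1 : δ ≤ 1)
    (hE : Integrable fun x => ‖G x‖ ^ 2 * cauchyWeight a x) {ρ : 𝔼 → ℝ}
    (hρ : Continuous ρ) (hρc : HasCompactSupport ρ) (hρ0 : ∀ x, 0 ≤ ρ x) (hρ1 : ∫ x, ρ x = 1)
    (hsupp : ∀ x, δ < ‖x‖ → ρ x = 0) :
    Integrable (fun x => ‖(ρ ⋆[lsmul ℝ ℝ, volume] G) x‖ ^ 2 * cauchyWeight a x) ∧
    ∫ x, ‖(ρ ⋆[lsmul ℝ ℝ, volume] G) x‖ ^ 2 * cauchyWeight a x ≤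
      (1 + 2 * δ) ^ a * ∫ x, ‖G x‖ ^ 2 * cauchyWeight a x := by
  set H : 𝔼 → ℝ := fun x => ‖G x‖ ^ 2 * cauchyWeight a x with hH
  have hconv : Integrable (ρ ⋆[lsmul ℝ ℝ, volume] H) :=
    (hρ.integrable_of_hasCompactSupport hρc).integrable_convolution (lsmul ℝ ℝ) hE
  have hwc : ∀ p, Continuous (cauchyWeight p : 𝔼 → ℝ) := continuous_cauchyWeight
  have hρx : ∀ x : 𝔼, Continuous fun y => ρ (x - y) := fun x => by fun_prop
  have jensen : ∀ x, ‖(ρ ⋆[lsmul ℝ ℝ, volume] G) x‖ ^ 2 ≤ ∫ y, ρ (x - y) * ‖G y‖ ^ 2 := by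
    intro x
    set A := (ρ ⋆[lsmul ℝ ℝ, volume] G) x with hA
    have hAe : A = ∫ y, ρ (x - y) • G y := by rw [hA, convolution_lsmul_swap]
    have i1 : Integrable fun y => ρ (x - y) • G y :=
      hG.integrable_smul_left_of_hasCompactSupport (hρx x) (hasCompactSupport_translate hρc x)
    have i2 : Integrable fun y => ρ (x - y) * ‖G y‖ ^ 2 := by
      have h1 := hE.locallyIntegrable.integrable_smul_left_of_hasCompactSupport
        ((hρx x).mul (hwc (-a))) (hasCompactSupport_translate hρc x).mul_right
      refine h1.congr (Eventually.of_forall fun y => ?_)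
      have h2 : cauchyWeight (-a) y * cauchyWeight a y = 1 := by
        rw [← cauchyWeight_add]; simp [cauchyWeight]
      simp only [hH, smul_eq_mul, Pi.mul_apply]
      linear_combination (ρ (x - y) * ‖G y‖ ^ 2) * h2
    have i3 : Integrable fun y => ρ (x - y) :=
      (hρx x).integrable_of_hasCompactSupport (hasCompactSupport_translate hρc x)
    have e1 : ∫ y, ρ (x - y) = 1 := by rw [integral_sub_left_eq_self]; exact hρ1
    have i4 : Integrable fun y => ⟪A, ρ (x - y) • G y⟫ := i1.const_inner A
    have h0 : 0 ≤ ∫ y, ρ (x - y) * ‖G y - A‖ ^ 2 :=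
      integral_nonneg fun y => mul_nonneg (hρ0 _) (by positivity)
    have e2 : ∀ y, ρ (x - y) * ‖G y - A‖ ^ 2 = ρ (x - y) * ‖G y‖ ^ 2
        - 2 * ⟪A, ρ (x - y) • G y⟫ + ρ (x - y) * ‖A‖ ^ 2 := fun y => by
      rw [norm_sub_sq_real, inner_smul_right, real_inner_comm]; ring
    simp_rw [e2] at h0
    have i5 : Integrable fun y => ρ (x - y) * ‖G y‖ ^ 2 - 2 * ⟪A, ρ (x - y) • G y⟫ :=
      i2.sub (i4.const_mul 2)
    rw [integral_add i5 (i3.mul_const _), integral_sub i2 (i4.const_mul 2), integral_const_mul,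
      integral_mul_const, e1, integral_inner i1, ← hAe, real_inner_self_eq_norm_sq] at h0
    linarith
  have hpt : ∀ x, ‖(ρ ⋆[lsmul ℝ ℝ, volume] G) x‖ ^ 2 * cauchyWeight a x ≤
      (1 + 2 * δ) ^ a * (ρ ⋆[lsmul ℝ ℝ, volume] H) x := by
    intro x
    refine (mul_le_mul_of_nonneg_right (jensen x) (cauchyWeight_pos _ _).le).trans ?_
    rw [convolution_lsmul_swap, ← integral_mul_const, ← integral_const_mul]
    refine integral_mono_of_nonneg (Eventually.of_forall fun y => ?_) ?_
      (Eventually.of_forall fun y => ?_)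
    · exact mul_nonneg (mul_nonneg (hρ0 _) (by positivity)) (cauchyWeight_pos _ _).le
    · exact (hE.locallyIntegrable.integrable_smul_left_of_hasCompactSupport (hρx x)
        (hasCompactSupport_translate hρc x)).const_mul _
    · simp only [hH, smul_eq_mul]
      by_cases hxy : δ < ‖x - y‖
      · simp [hsupp _ hxy]
      · have := cauchyWeight_le_mul ha hδ1 (not_lt.1 hxy)
        have h1 : 0 ≤ ρ (x - y) * ‖G y‖ ^ 2 := mul_nonneg (hρ0 _) (by positivity)
        nlinarith [mul_le_mul_of_nonneg_left this h1]
  have hint : Integrable (fun x => ‖(ρ ⋆[lsmul ℝ ℝ, volume] G) x‖ ^ 2 * cauchyWeight a x) := by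
    refine (hconv.const_mul ((1 + 2 * δ) ^ a)).mono' ?_ (Eventually.of_forall fun x => ?_)
    · exact (((hρc.continuous_convolution_left (lsmul ℝ ℝ) hρ hG).norm.pow 2).mul
        (hwc a)).aestronglyMeasurable
    · rw [norm_of_nonneg (mul_nonneg (by positivity) (cauchyWeight_pos _ _).le)]
      exact hpt x
  refine ⟨hint, (integral_mono hint (hconv.const_mul _) hpt).trans (le_of_eq ?_)⟩
  rw [integral_const_mul, integral_convolution _ (hρ.integrable_of_hasCompactSupport hρc) hE]
  simp [hρ1]

/-- Mollification preserves a bound by a multiple of `1 + |x|²`, up to a factor. -/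
lemma abs_convolution_le {f : 𝔼 → ℝ} {C : ℝ} (hC : 0 ≤ C)
    (hb : ∀ᵐ x, |f x| ≤ C * (1 + ‖x‖ ^ 2)) {ρ : 𝔼 → ℝ}
    (hρ : Continuous ρ) (hρc : HasCompactSupport ρ) (hρ0 : ∀ x, 0 ≤ ρ x) (hρ1 : ∫ x, ρ x = 1)
    (hsupp : ∀ x, 1 < ‖x‖ → ρ x = 0) (x : 𝔼) :
    |(ρ ⋆[lsmul ℝ ℝ, volume] f) x| ≤ 3 * C * (1 + ‖x‖ ^ 2) := by
  have hρx : Continuous fun y => ρ (x - y) := by fun_prop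
  have i3 : Integrable fun y => ρ (x - y) :=
    hρx.integrable_of_hasCompactSupport (hasCompactSupport_translate hρc x)
  rw [convolution_lsmul_swap, ← norm_eq_abs]
  calc ‖∫ y, ρ (x - y) • f y‖ ≤ ∫ y, ρ (x - y) * (3 * C * (1 + ‖x‖ ^ 2)) := by
        refine norm_integral_le_of_norm_le (i3.mul_const _) ?_
        filter_upwards [hb] with y hy
        rw [norm_smul, norm_of_nonneg (hρ0 _), norm_eq_abs]
        by_cases hxy : 1 < ‖x - y‖
        · simp [hsupp _ hxy]
        · refine mul_le_mul_of_nonneg_left (hy.trans ?_) (hρ0 _)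
          have h1 : ‖y‖ ≤ ‖x‖ + 1 := by
            have := norm_sub_norm_le y x
            rw [norm_sub_rev] at this
            linarith [not_lt.1 hxy]
          have h2 : ‖y‖ ^ 2 ≤ (‖x‖ + 1) ^ 2 := pow_le_pow_left₀ (norm_nonneg _) h1 2
          have h3 : 1 + ‖y‖ ^ 2 ≤ 3 * (1 + ‖x‖ ^ 2) := by nlinarith [sq_nonneg (‖x‖ - 1)]
          nlinarith
    _ = _ := by
        rw [integral_mul_const, integral_sub_left_eq_self (fun y => ρ y), hρ1, one_mul]

end Mollify

/-! ### The weighted spectral gap for weakly differentiable functions -/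

section WeakGap
open scoped RealInnerProductSpace Convolution
open ContinuousLinearMap (lsmul)

variable {d : ℕ}

local notation "𝔼" => EuclideanSpace ℝ (Fin d)

lemma cauchyWeight_sub_one {V : Type*} [NormedAddCommGroup V] (p : ℝ) (x : V) :
    cauchyWeight (p - 1) x = (1 + ‖x‖ ^ 2) ^ 2 * cauchyWeight (p + 1) x := by
  have h1 := cauchyWeight_succ_mul (p - 1) x
  have h2 := cauchyWeight_succ_mul p x
  rw [sub_add_cancel] at h1
  rw [← h1, ← h2]; ring

/-- Smooth cutoffs at scale `n + 1`. -/
lemma exists_cutoff (d : ℕ) : ∃ (χ : ℕ → EuclideanSpace ℝ (Fin d) → ℝ) (K : ℝ), 0 ≤ K ∧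
    (∀ n, ContDiff ℝ ∞ (χ n)) ∧ (∀ n, HasCompactSupport (χ n)) ∧ (∀ n x, 0 ≤ χ n x) ∧
    (∀ n x, χ n x ≤ 1) ∧ (∀ x, Tendsto (fun n => χ n x) atTop (𝓝 1)) ∧
    (∀ n x, ‖gradient (χ n) x‖ ≤ K * (1 / ((n : ℝ) + 1))) ∧
    ∀ n x, ‖gradient (χ n) x‖ ^ 2 * (1 + ‖x‖ ^ 2) ≤ 5 * K ^ 2 := by
  let χ : ContDiffBump (0 : EuclideanSpace ℝ (Fin d)) := ⟨1, 2, by norm_num, by norm_num⟩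
  have hχ : ContDiff ℝ ∞ χ := χ.contDiff
  have hχc : HasCompactSupport χ := χ.hasCompactSupport
  obtain ⟨K, hK⟩ := (hχc.fderiv (𝕜 := ℝ)).exists_bound_of_continuous
    (hχ.continuous_fderiv (by simp))
  have hK0 : 0 ≤ K := (norm_nonneg _).trans (hK 0)
  have hr : ∀ n : ℕ, (0 : ℝ) < 1 / ((n : ℝ) + 1) := fun n => by positivity
  have hgrad : ∀ (n : ℕ) x, ‖gradient (fun x => χ ((1 / ((n : ℝ) + 1)) • x)) x‖ =
      1 / ((n : ℝ) + 1) * ‖fderiv ℝ χ ((1 / ((n : ℝ) + 1)) • x)‖ := fun n x => by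
    have h1 : HasFDerivAt (fun x => χ ((1 / ((n : ℝ) + 1)) • x))
        ((1 / ((n : ℝ) + 1)) • fderiv ℝ χ ((1 / ((n : ℝ) + 1)) • x)) x := by
      have := (hχ.differentiable (by simp) ((1 / ((n : ℝ) + 1)) • x)).hasFDerivAt.comp x
        ((hasFDerivAt_id x).const_smul (1 / ((n : ℝ) + 1)))
      refine this.congr_fderiv ?_
      ext v; simp
    rw [gradient, LinearIsometryEquiv.norm_map, h1.fderiv, norm_smul, norm_of_nonneg (hr n).le]
  have hle : ∀ (n : ℕ) x, ‖gradient (fun x => χ ((1 / ((n : ℝ) + 1)) • x)) x‖ ≤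
      K * (1 / ((n : ℝ) + 1)) := fun n x => by
    rw [hgrad, mul_comm]
    exact mul_le_mul_of_nonneg_right (hK _) (hr n).le
  refine ⟨fun n x => χ ((1 / ((n : ℝ) + 1)) • x), K, hK0,
    fun n => hχ.comp (contDiff_const_smul _), fun n => ?_, fun n x => χ.nonneg,
    fun n x => χ.le_one, fun x => ?_, hle, fun n x => ?_⟩
  · exact hχc.comp_smul (hr n).ne'
  · have h1 : Tendsto (fun n : ℕ => (1 / ((n : ℝ) + 1)) • x) atTop (𝓝 0) := by
      simpa using (tendsto_one_div_add_atTop_nhds_zero_nat (𝕜 := ℝ)).smul_const x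
    have h2 := (χ.continuous.tendsto 0).comp h1
    rwa [χ.one_of_mem_closedBall (by simp [χ])] at h2
  · by_cases hx : ‖x‖ ≤ 2 * ((n : ℝ) + 1)
    · have h1 := pow_le_pow_left₀ (norm_nonneg _) (hle n x) 2
      have h2 : 1 + ‖x‖ ^ 2 ≤ 5 * ((n : ℝ) + 1) ^ 2 := by
        have := pow_le_pow_left₀ (norm_nonneg _) hx 2
        have h3 : (0 : ℝ) ≤ n := n.cast_nonneg
        nlinarith
      calc _ ≤ (K * (1 / ((n : ℝ) + 1))) ^ 2 * (5 * ((n : ℝ) + 1) ^ 2) := by gcongr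
        _ = _ := by field_simp
    · have h0 : fderiv ℝ χ ((1 / ((n : ℝ) + 1)) • x) = 0 := by
        refine image_eq_zero_of_notMem_tsupport fun h => hx ?_
        have h1 := tsupport_fderiv_subset ℝ h
        rw [χ.tsupport_eq, mem_closedBall_zero_iff, norm_smul, norm_of_nonneg (hr n).le,
          one_div, inv_mul_le_iff₀ (by positivity)] at h1
        rw [mul_comm]; exact h1
      rw [hgrad, h0]
      simp only [norm_zero, mul_zero, ne_eq, OfNat.ofNat_ne_zero, not_false_eq_true, zero_pow,
        zero_mul]
      positivity

/-- A function of at most quadratic growth with a weak gradient of finite weighted energy is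
approximated by test functions, the energy of which is asymptotically not larger. -/
lemma HasWeakGradient.exists_approx {f : 𝔼 → ℝ} {G : 𝔼 → 𝔼} (h : HasWeakGradient f G) {a C : ℝ}
    (ha : (d : ℝ) / 2 + 1 < a) (hC : 0 ≤ C) (hb : ∀ᵐ x, |f x| ≤ C * (1 + ‖x‖ ^ 2))
    (hE : Integrable fun x => ‖G x‖ ^ 2 * cauchyWeight a x) :
    ∃ F : ℕ → 𝔼 → ℝ, (∀ n, ContDiff ℝ ∞ (F n)) ∧ (∀ n, HasCompactSupport (F n)) ∧
      (∀ n x, |F n x| ≤ 3 * C * (1 + ‖x‖ ^ 2)) ∧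
      (∀ᵐ x, Tendsto (fun n => F n x) atTop (𝓝 (f x))) ∧
      ∀ θ : ℝ, 0 < θ → ∃ e : ℕ → ℝ,
        Tendsto e atTop (𝓝 ((1 + θ) * ∫ x, ‖G x‖ ^ 2 * cauchyWeight a x)) ∧
        ∀ n, ∫ x, ‖gradient (F n) x‖ ^ 2 * cauchyWeight a x ≤ e n := by
  have hd0 : (0 : ℝ) ≤ d := d.cast_nonneg
  have ha0 : 0 ≤ a := by linarith
  obtain ⟨χ, K, hK, hχ, hχc, hχ0, hχ1, hχt, hχg, hχg2⟩ := exists_cutoff d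
  have hr : ∀ n : ℕ, (0 : ℝ) < 1 / ((n : ℝ) + 1) := fun n => by positivity
  have hr1 : ∀ n : ℕ, 1 / ((n : ℝ) + 1) ≤ 1 := fun n => by
    rw [div_le_one (by positivity)]; linarith [n.cast_nonneg (α := ℝ)]
  let B : ℕ → ContDiffBump (0 : 𝔼) := fun n =>
    ⟨1 / ((n : ℝ) + 1) / 2, 1 / ((n : ℝ) + 1), half_pos (hr n), half_lt_self (hr n)⟩
  let ρ : ℕ → 𝔼 → ℝ := fun n => (B n).normed volume
  have hρ : ∀ n, ContDiff ℝ ∞ (ρ n) := fun n => (B n).contDiff_normed (n := ⊤)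
  have hρc : ∀ n, HasCompactSupport (ρ n) := fun n => (B n).hasCompactSupport_normed
  have hρ0 : ∀ n x, 0 ≤ ρ n x := fun n x => (B n).nonneg_normed x
  have hρ1 : ∀ n, ∫ x, ρ n x = 1 := fun n => (B n).integral_normed
  have hρs : ∀ (n : ℕ) x, 1 / ((n : ℝ) + 1) < ‖x‖ → ρ n x = 0 := fun n x hx => by
    refine Function.notMem_support.1 fun h => ?_
    rw [(B n).support_normed_eq, mem_ball_zero_iff] at h
    exact lt_asymm h hx
  have hρs1 : ∀ n x, 1 < ‖x‖ → ρ n x = 0 := fun n x hx => hρs n x ((hr1 n).trans_lt hx)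
  let u : ℕ → 𝔼 → ℝ := fun n => ρ n ⋆[lsmul ℝ ℝ, volume] f
  let U : ℕ → 𝔼 → 𝔼 := fun n => ρ n ⋆[lsmul ℝ ℝ, volume] G
  have hu : ∀ n, ContDiff ℝ ∞ (u n) := fun n =>
    (hρc n).contDiff_convolution_left (n := ⊤) (lsmul ℝ ℝ) (hρ n) h.locallyIntegrable
  have hub : ∀ n x, |u n x| ≤ 3 * C * (1 + ‖x‖ ^ 2) := fun n x =>
    abs_convolution_le hC hb (hρ n).continuous (hρc n) (hρ0 n) (hρ1 n) (hρs1 n) x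
  have hgrad : ∀ n x, gradient (fun x => χ n x * u n x) x =
      χ n x • U n x + u n x • gradient (χ n) x := fun n x => by
    have h1 := (h.gradient_convolution (hρ n) (hρc n) x).hasFDerivAt
    have h2 := ((hχ n).differentiable (by simp) x).hasGradientAt.hasFDerivAt
    have h3 := (h2.mul h1).hasGradientAt
    refine HasGradientAt.gradient ?_
    rw [map_add, map_smulₛₗ, map_smulₛₗ, LinearIsometryEquiv.symm_apply_apply,
      LinearIsometryEquiv.symm_apply_apply] at h3
    exact h3
  have hnorm : ∀ θ : ℝ, 0 < θ → ∀ n x, ‖gradient (fun x => χ n x * u n x) x‖ ^ 2 ≤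
      (1 + θ) * ‖U n x‖ ^ 2 + (1 + 1 / θ) * ((3 * C * (1 + ‖x‖ ^ 2)) ^ 2 *
        ‖gradient (χ n) x‖ ^ 2) := by
    intro θ hθ n x
    rw [hgrad]
    have h1 : ‖χ n x • U n x‖ ≤ ‖U n x‖ := by
      rw [norm_smul, norm_of_nonneg (hχ0 n x)]
      exact mul_le_of_le_one_left (norm_nonneg _) (hχ1 n x)
    have h2 : ‖u n x • gradient (χ n) x‖ ≤ 3 * C * (1 + ‖x‖ ^ 2) * ‖gradient (χ n) x‖ := by
      rw [norm_smul]
      exact mul_le_mul_of_nonneg_right (hub n x) (norm_nonneg _)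
    set A := ‖U n x‖
    set D := 3 * C * (1 + ‖x‖ ^ 2) * ‖gradient (χ n) x‖ with hD
    have h3 : ‖χ n x • U n x + u n x • gradient (χ n) x‖ ≤ A + D :=
      (norm_add_le _ _).trans (add_le_add h1 h2)
    have h4 := pow_le_pow_left₀ (norm_nonneg _) h3 2
    have h5 : (1 + θ) * A ^ 2 + (1 + 1 / θ) * D ^ 2 - (A + D) ^ 2 = (θ * A - D) ^ 2 / θ := by
      field_simp; ring
    have h6 : 0 ≤ (θ * A - D) ^ 2 / θ := by positivity
    rw [← mul_pow, ← hD]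
    linarith
  have hen : ∀ n, Integrable (fun x => ‖U n x‖ ^ 2 * cauchyWeight a x) ∧
      ∫ x, ‖U n x‖ ^ 2 * cauchyWeight a x ≤
        (1 + 2 * (1 / ((n : ℝ) + 1))) ^ a * ∫ x, ‖G x‖ ^ 2 * cauchyWeight a x := fun n =>
    integral_norm_convolution_sq_le h.locallyIntegrable_grad ha0 (hr1 n) hE (hρ n).continuous
      (hρc n) (hρ0 n) (hρ1 n) (hρs n)
  have hFs : ∀ n, ContDiff ℝ ∞ (fun x => χ n x * u n x) := fun n => (hχ n).mul (hu n)
  have hFc : ∀ n, HasCompactSupport (fun x => χ n x * u n x) := fun n => (hχc n).mul_right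
  -- the error made by the cutoff
  let Z : ℕ → 𝔼 → ℝ := fun n x =>
    (3 * C * (1 + ‖x‖ ^ 2)) ^ 2 * ‖gradient (χ n) x‖ ^ 2 * cauchyWeight a x
  have hZc : ∀ n, Continuous (Z n) := fun n =>
    (((continuous_const.mul (by fun_prop)).pow 2).mul
      ((continuous_gradient (hχ n)).norm.pow 2)).mul (continuous_cauchyWeight a)
  have hZ0 : ∀ n x, 0 ≤ Z n x := fun n x => mul_nonneg (by positivity) (cauchyWeight_pos _ _).le
  have hZb : ∀ n x, Z n x ≤ 45 * C ^ 2 * K ^ 2 * cauchyWeight (a - 1) x := fun n x => by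
    have h1 : cauchyWeight a x * (1 + ‖x‖ ^ 2) = cauchyWeight (a - 1) x := by
      simpa using cauchyWeight_succ_mul (a - 1) x
    have h2 := mul_le_mul_of_nonneg_right (hχg2 n x)
      (mul_nonneg (by positivity : 0 ≤ 9 * C ^ 2) (cauchyWeight_pos (a - 1) x).le)
    rw [← h1] at h2 ⊢
    simp only [Z]
    linarith
  have hwi : Integrable fun x : 𝔼 => 45 * C ^ 2 * K ^ 2 * cauchyWeight (a - 1) x :=
    (integrable_cauchyWeight (by simp; linarith)).const_mul _
  have hZi : ∀ n, Integrable (Z n) := fun n =>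
    hwi.mono' (hZc n).aestronglyMeasurable (Eventually.of_forall fun x => by
      rw [norm_of_nonneg (hZ0 n x)]; exact hZb n x)
  have hZt : Tendsto (fun n => ∫ x, Z n x) atTop (𝓝 0) := by
    have := tendsto_integral_of_dominated_convergence (f := fun _ : 𝔼 => (0 : ℝ)) _
      (fun n => (hZc n).aestronglyMeasurable) hwi
      (fun n => Eventually.of_forall fun x => by
        rw [norm_of_nonneg (hZ0 n x)]; exact hZb n x)
      (Eventually.of_forall fun x => by
        have h1 : Tendsto (fun n => ‖gradient (χ n) x‖) atTop (𝓝 0) :=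
          squeeze_zero (fun _ => norm_nonneg _) (fun n => hχg n x) (by
            simpa using (tendsto_one_div_add_atTop_nhds_zero_nat (𝕜 := ℝ)).const_mul K)
        simpa [Z] using ((h1.pow 2).const_mul ((3 * C * (1 + ‖x‖ ^ 2)) ^ 2)).mul_const
          (cauchyWeight a x))
    simpa using this
  refine ⟨fun n x => χ n x * u n x, hFs, hFc, fun n x => ?_, ?_, fun θ hθ =>
    ⟨fun n => (1 + θ) * ((1 + 2 * (1 / ((n : ℝ) + 1))) ^ a *
      ∫ x, ‖G x‖ ^ 2 * cauchyWeight a x) + (1 + 1 / θ) * ∫ x, Z n x, ?_, fun n => ?_⟩⟩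
  · rw [abs_mul, abs_of_nonneg (hχ0 n x)]
    exact (mul_le_of_le_one_left (abs_nonneg _) (hχ1 n x)).trans (hub n x)
  · have h1 := ContDiffBump.ae_convolution_tendsto_right_of_locallyIntegrable (μ := volume)
      (φ := B) (l := atTop) (K := 2) (tendsto_one_div_add_atTop_nhds_zero_nat (𝕜 := ℝ))
      (Eventually.of_forall fun n => by simp only [B]; linarith) h.locallyIntegrable
    filter_upwards [h1] with x hx
    simpa using (hχt x).mul hx
  · have h1 : Tendsto (fun n : ℕ => (1 + 2 * (1 / ((n : ℝ) + 1))) ^ a) atTop (𝓝 1) := by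
      have h2 : Tendsto (fun n : ℕ => 1 + 2 * (1 / ((n : ℝ) + 1))) atTop (𝓝 1) := by
        simpa using ((tendsto_one_div_add_atTop_nhds_zero_nat (𝕜 := ℝ)).const_mul 2).const_add 1
      simpa using h2.rpow_const (p := a) (Or.inl one_ne_zero)
    simpa using ((h1.mul_const (∫ x, ‖G x‖ ^ 2 * cauchyWeight a x)).const_mul (1 + θ)).add
      (hZt.const_mul (1 + 1 / θ))
  · have i1 : Integrable fun x => ‖gradient (fun x => χ n x * u n x) x‖ ^ 2 * cauchyWeight a x :=
      integrable_compact
        (((continuous_gradient (hFs n)).norm.pow 2).mul (continuous_cauchyWeight a))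
        ((hasCompactSupport_gradient (hFc n)).comp_left (g := fun v => ‖v‖ ^ 2)
          (by simp)).mul_right
    refine (integral_mono i1 (((hen n).1.const_mul (1 + θ)).add
      ((hZi n).const_mul (1 + 1 / θ))) fun x => ?_).trans ?_
    · have := mul_le_mul_of_nonneg_right (hnorm θ hθ n x) (cauchyWeight_pos a x).le
      simp only [Z, Pi.add_apply]
      linarith
    · rw [integral_add' ((hen n).1.const_mul (1 + θ)) ((hZi n).const_mul (1 + 1 / θ)),
        integral_const_mul, integral_const_mul]
      exact add_le_add_left (mul_le_mul_of_nonneg_left (hen n).2 (by positivity)) _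

/-- The weighted spectral gap for a weakly differentiable function of at most quadratic growth:
the smooth case, and approximation. -/
theorem HasWeakGradient.weighted_gap {f : 𝔼 → ℝ} {G : 𝔼 → 𝔼} (h : HasWeakGradient f G) {a C : ℝ}
    (had : AdmissibleExponent d a) {σ : ℝ} (hσ : σ = 2 / 3 * (1 - d / a)) (hC : 0 ≤ C)
    (hb : ∀ᵐ x, |f x| ≤ C * (1 + ‖x‖ ^ 2))
    (hE : Integrable fun x => ‖G x‖ ^ 2 * cauchyWeight a x) :
    (1 + σ) * ((∫ x, f x ^ 2 * cauchyWeight (a + 1) x) -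
        (∫ x, f x * cauchyWeight (a + 1) x) ^ 2 / (∫ x : 𝔼, cauchyWeight (a + 1) x)) -
      σ * ((∑ i, (∫ x, f x * x i * cauchyWeight (a + 1) x) ^ 2) /
        ((∫ x : 𝔼, cauchyWeight a x) / (2 * a))) ≤
    1 / (2 * a) * ∫ x, ‖G x‖ ^ 2 * cauchyWeight a x := by
  have ha := had.half_lt
  have hd0 : (0 : ℝ) ≤ d := d.cast_nonneg
  have ha0 : 0 < a := by linarith
  obtain ⟨F, hF, hFc, hFb, hFt, hFe⟩ := h.exists_approx ha hC hb hE
  have hwi : ∀ c : ℝ, Integrable fun x : 𝔼 => c * cauchyWeight (a - 1) x := fun c =>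
    (integrable_cauchyWeight (by simp; linarith)).const_mul _
  have hw := cauchyWeight_sub_one (V := 𝔼) a
  have hwp := fun x : 𝔼 => cauchyWeight_pos (a + 1) x
  have hwc : Continuous fun x : 𝔼 => cauchyWeight (a + 1) x := continuous_cauchyWeight _
  have t1 : Tendsto (fun n => ∫ x, F n x ^ 2 * cauchyWeight (a + 1) x) atTop
      (𝓝 (∫ x, f x ^ 2 * cauchyWeight (a + 1) x)) := by
    refine tendsto_integral_of_dominated_convergence _
      (fun n => (((hF n).continuous.pow 2).mul hwc).aestronglyMeasurable)
      (hwi ((3 * C) ^ 2)) (fun n => Eventually.of_forall fun x => ?_) ?_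
    · rw [norm_of_nonneg (mul_nonneg (sq_nonneg _) (hwp x).le), hw, ← mul_assoc, ← mul_pow]
      refine mul_le_mul_of_nonneg_right ?_ (hwp x).le
      rw [← sq_abs]
      exact pow_le_pow_left₀ (abs_nonneg _) (hFb n x) 2
    · filter_upwards [hFt] with x hx using (hx.pow 2).mul_const _
  have t2 : Tendsto (fun n => ∫ x, F n x * cauchyWeight (a + 1) x) atTop
      (𝓝 (∫ x, f x * cauchyWeight (a + 1) x)) := by
    refine tendsto_integral_of_dominated_convergence _
      (fun n => ((hF n).continuous.mul hwc).aestronglyMeasurable)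
      (hwi (3 * C)) (fun n => Eventually.of_forall fun x => ?_) ?_
    · rw [norm_mul, norm_of_nonneg (hwp x).le, hw, ← mul_assoc]
      refine mul_le_mul_of_nonneg_right ((hFb n x).trans ?_) (hwp x).le
      refine mul_le_mul_of_nonneg_left ?_ (by positivity)
      nlinarith [sq_nonneg ‖x‖]
    · filter_upwards [hFt] with x hx using hx.mul_const _
  have t3 : ∀ i, Tendsto (fun n => ∫ x, F n x * x i * cauchyWeight (a + 1) x) atTop
      (𝓝 (∫ x, f x * x i * cauchyWeight (a + 1) x)) := fun i => by
    refine tendsto_integral_of_dominated_convergence _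
      (fun n => (((hF n).continuous.mul (by fun_prop)).mul hwc).aestronglyMeasurable)
      (hwi (3 * C)) (fun n => Eventually.of_forall fun x => ?_) ?_
    · rw [norm_mul, norm_of_nonneg (hwp x).le, hw, ← mul_assoc]
      refine mul_le_mul_of_nonneg_right ?_ (hwp x).le
      rw [norm_mul]
      have h1 : ‖x i‖ ≤ 1 + ‖x‖ ^ 2 := by
        nlinarith [PiLp.norm_apply_le x i, sq_nonneg (‖x‖ - 1), norm_nonneg x]
      calc ‖F n x‖ * ‖x i‖ ≤ (3 * C * (1 + ‖x‖ ^ 2)) * (1 + ‖x‖ ^ 2) :=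
            mul_le_mul (hFb n x) h1 (norm_nonneg _) (by positivity)
        _ = _ := by ring
    · filter_upwards [hFt] with x hx using (hx.mul_const _).mul_const _
  have tL := ((t1.sub ((t2.pow 2).div_const (∫ x : 𝔼, cauchyWeight (a + 1) x))).const_mul
    (1 + σ)).sub (((tendsto_finsetSum Finset.univ fun i _ => (t3 i).pow 2).div_const
      ((∫ x : 𝔼, cauchyWeight a x) / (2 * a))).const_mul σ)
  set I := ∫ x, ‖G x‖ ^ 2 * cauchyWeight a x with hI
  have key : ∀ θ : ℝ, 0 < θ → _ ≤ 1 / (2 * a) * ((1 + θ) * I) := fun θ hθ => by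
    obtain ⟨e, he, hle⟩ := hFe θ hθ
    exact le_of_tendsto_of_tendsto' tL (he.const_mul (1 / (2 * a))) fun n =>
      (weighted_gap_smooth had hσ (hF n) (hFc n)).trans
        (mul_le_mul_of_nonneg_left (hle n) (by positivity))
  have t4 : Tendsto (fun θ : ℝ => 1 / (2 * a) * ((1 + θ) * I)) (𝓝[>] 0)
      (𝓝 (1 / (2 * a) * I)) := by
    have : Continuous fun θ : ℝ => 1 / (2 * a) * ((1 + θ) * I) := by fun_prop
    simpa using (this.tendsto 0).mono_left nhdsWithin_le_nhds
  exact ge_of_tendsto t4 (eventually_nhdsWithin_of_forall fun θ hθ => key θ hθ)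

end WeakGap

/-! ### Pointwise comparison of powers -/

section Powers

/-- Bernoulli's inequality, applied to `1 + t` and to its inverse, controls the first-order Taylor
expansion of a power with exponent in `(-1, 0)`. -/
lemma rpow_neg_taylor {κ t : ℝ} (hκ : 0 ≤ κ) (hκ1 : κ ≤ 1) (ht : -1 < t) :
    0 ≤ (1 + t) ^ (-κ) - 1 + κ * t ∧ (1 + t) ^ (-κ) - 1 + κ * t ≤ κ * t ^ 2 / (1 + t) := by
  have h0 : 0 < 1 + t := by linarith
  rw [rpow_neg h0.le]
  constructor
  · have h1 := rpow_one_add_le_one_add_mul_self ht.le hκ hκ1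
    have h2 : 0 < (1 + t) ^ κ := rpow_pos_of_pos h0 _
    have h3 : 1 - κ * t ≤ ((1 + t) ^ κ)⁻¹ := by
      rw [← one_div, le_div_iff₀ h2]
      rcases le_or_gt (1 - κ * t) 0 with h4 | h4
      · nlinarith
      · nlinarith [sq_nonneg (κ * t)]
    linarith
  · have h1 : ((1 + t) ^ κ)⁻¹ = (1 + -t / (1 + t)) ^ κ := by
      rw [← inv_rpow h0.le]
      congr 1; field_simp; ring
    have h2 : -1 ≤ -t / (1 + t) := by rw [le_div_iff₀ h0]; linarith
    have h3 := rpow_one_add_le_one_add_mul_self h2 hκ hκ1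
    rw [h1]
    have h4 : κ * (-t / (1 + t)) + κ * t = κ * t ^ 2 / (1 + t) := by field_simp; ring
    linarith

/-- The relative density of the entropy is comparable with the square of the relative error. -/
lemma entropy_le_sq {m ε t : ℝ} (hm : 0 < m) (hm1 : m < 1) (hε : ε < 1) (ht : |t| ≤ ε) :
    t - ((1 + t) ^ m - 1) / m ≤ (1 - m) / 2 * (1 / (1 - ε)) * t ^ 2 := by
  have hε0 : 0 ≤ ε := (abs_nonneg t).trans ht
  have hε1 : 0 < 1 - ε := by linarith
  set k : ℝ → ℝ := fun t => (1 - m) / 2 * (1 / (1 - ε)) * t ^ 2 - t + ((1 + t) ^ m - 1) / m with hk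
  set k' : ℝ → ℝ := fun t => (1 - m) * (1 / (1 - ε)) * t - 1 + (1 + t) ^ (m - 1) with hk'
  have hd : ∀ s, -1 < s → HasDerivAt k (k' s) s := fun s hs => by
    have h1 := (((hasDerivAt_id s).const_add 1).rpow_const (p := m)
      (Or.inl (by simp only [id]; linarith))).sub_const 1 |>.div_const m
    have h2 := ((((hasDerivAt_id s).pow 2).const_mul ((1 - m) / 2 * (1 / (1 - ε)))).sub
      (hasDerivAt_id s)).add h1
    refine h2.congr_deriv ?_
    simp only [hk', id]
    field_simp
    ring
  have hmem : ∀ s ∈ Icc (-ε) ε, -1 < s := fun s hs => by linarith [hs.1]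
  have hcont : ContinuousOn k (Icc (-ε) ε) := fun s hs =>
    (hd s (hmem s hs)).continuousAt.continuousWithinAt
  have h0 : k 0 = 0 := by simp [hk]
  -- the derivative has the sign of its argument, so that `k` is minimal at `0`
  have hsign : ∀ s ∈ Icc (-ε) ε, (0 ≤ s → 0 ≤ k' s) ∧ (s ≤ 0 → k' s ≤ 0) := fun s hs => by
    have h1 := hmem s hs
    obtain ⟨h2, h3⟩ := rpow_neg_taylor (κ := 1 - m) (by linarith) (by linarith) h1
    rw [neg_sub] at h2 h3
    have h4 : (1 : ℝ) ≤ 1 / (1 - ε) := by rw [le_div_iff₀ hε1]; linarith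
    constructor
    · intro hs0
      have := mul_nonneg (mul_nonneg (by linarith : 0 ≤ 1 - m) hs0) (sub_nonneg.2 h4)
      simp only [hk']; linarith
    · intro hs0
      have h5 : 1 / (1 + s) ≤ 1 / (1 - ε) := one_div_le_one_div_of_le hε1 (by linarith [hs.1])
      have h6 : (1 - m) * s ^ 2 / (1 + s) = (1 - m) * s - (1 - m) * s * (1 / (1 + s)) := by
        have : 1 + s ≠ 0 := by linarith
        field_simp; ring
      have h7 := mul_nonneg (mul_nonneg (by linarith : 0 ≤ 1 - m) (neg_nonneg.2 hs0))
        (sub_nonneg.2 h5)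
      simp only [hk']; linarith
  have key : 0 ≤ k t := by
    have hmt := abs_le.1 ht
    rw [← h0]
    rcases le_total 0 t with h | h
    · have hmono : MonotoneOn k (Icc 0 ε) := by
        refine monotoneOn_of_deriv_nonneg (convex_Icc _ _)
          (hcont.mono (Icc_subset_Icc (by linarith) le_rfl)) (fun s hs => ?_) fun s hs => ?_
        · rw [interior_Icc] at hs
          exact (hd s (by linarith [hs.1])).differentiableAt.differentiableWithinAt
        · rw [interior_Icc] at hs
          rw [(hd s (by linarith [hs.1])).deriv]
          exact (hsign s ⟨by linarith [hs.1], hs.2.le⟩).1 hs.1.le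
      exact hmono ⟨le_rfl, hε0⟩ ⟨h, hmt.2⟩ h
    · have hanti : AntitoneOn k (Icc (-ε) 0) := by
        refine antitoneOn_of_deriv_nonpos (convex_Icc _ _)
          (hcont.mono (Icc_subset_Icc le_rfl hε0)) (fun s hs => ?_) fun s hs => ?_
        · rw [interior_Icc] at hs
          exact (hd s (by linarith [hs.1])).differentiableAt.differentiableWithinAt
        · rw [interior_Icc] at hs
          rw [(hd s (by linarith [hs.1])).deriv]
          exact (hsign s ⟨hs.1.le, by linarith [hs.2]⟩).2 hs.2.le
      exact hanti ⟨hmt.1, h⟩ ⟨by linarith, le_rfl⟩ h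
  simp only [hk] at key
  linarith

lemma entropy_pos {m t : ℝ} (hm : 0 < m) (hm1 : m < 1) (ht : -1 ≤ t) (ht0 : t ≠ 0) :
    0 < t - ((1 + t) ^ m - 1) / m := by
  have h := rpow_one_add_lt_one_add_mul_self ht ht0 hm hm1
  rw [sub_pos, div_lt_iff₀ hm]
  linarith

/-- The increment of the pressure is comparable with the relative error. -/
lemma sq_le_sq_pressure {κ ε t : ℝ} (hκ : 0 ≤ κ) (hκ1 : κ ≤ 1) (hε : ε ≤ 1 / 2) (ht : |t| ≤ ε) :
    κ ^ 2 * (1 - ε / (1 - ε)) ^ 2 * t ^ 2 ≤ ((1 + t) ^ (-κ) - 1) ^ 2 ∧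
    ((1 + t) ^ (-κ) - 1 + κ * t) ^ 2 ≤ κ ^ 2 * (ε / (1 - ε)) ^ 2 * t ^ 2 := by
  have hε0 : 0 ≤ ε := (abs_nonneg t).trans ht
  have hε1 : 0 < 1 - ε := by linarith
  have hmt := abs_le.1 ht
  obtain ⟨h1, h2⟩ := rpow_neg_taylor hκ hκ1 (by linarith : -1 < t)
  set δ := ε / (1 - ε) with hδ
  have hδ0 : 0 ≤ δ := by positivity
  have hδ1 : δ ≤ 1 := by rw [hδ, div_le_one hε1]; linarith
  have h3 : κ * t ^ 2 / (1 + t) ≤ κ * δ * |t| := by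
    have h4 : κ * δ * |t| = κ * ε * |t| / (1 - ε) := by rw [hδ]; ring
    rw [h4]
    have h5 : κ * t ^ 2 ≤ κ * ε * |t| := by
      rw [← sq_abs]
      nlinarith [mul_nonneg hκ (abs_nonneg t)]
    exact div_le_div₀ (by positivity) h5 hε1 (by linarith)
  have h6 : |(1 + t) ^ (-κ) - 1 + κ * t| ≤ κ * δ * |t| := by
    rw [abs_of_nonneg h1]; linarith
  constructor
  · have h7 : κ * (1 - δ) * |t| ≤ |(1 + t) ^ (-κ) - 1| := by
      have h8 := abs_sub_abs_le_abs_sub (κ * t) (-((1 + t) ^ (-κ) - 1))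
      rw [abs_neg, sub_neg_eq_add, abs_mul, abs_of_nonneg hκ, add_comm (κ * t)] at h8
      linarith
    have h9 := pow_le_pow_left₀ (mul_nonneg (mul_nonneg hκ (by linarith)) (abs_nonneg t)) h7 2
    rwa [sq_abs, mul_pow, mul_pow, sq_abs] at h9
  · have h9 := pow_le_pow_left₀ (abs_nonneg _) h6 2
    rwa [sq_abs, mul_pow, mul_pow, sq_abs] at h9

/-- The loss due to the nonlinearity is absorbed by the surplus `σ` in the spectral gap. The
bound on `ε` follows from `ε < χ η`, since `χ < 1 / 266` and `η = 3 σ`. -/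
lemma gap_constant_nonlinear {σ ε : ℝ} (hσ : 0 < σ) (hσ1 : σ < 2 / 3) (hε0 : 0 < ε)
    (hε : ε < 3 * σ / 266) :
    (4 + 3 * σ) * (1 / (1 - ε)) ≤ 4 * (1 - ε) *
      ((1 + σ) * (1 - ε / (1 - ε)) ^ 2 - (1 + 2 * σ) * (ε / (1 - ε)) ^ 2) := by
  have h1 : 0 < 1 - ε := by linarith
  have e1 : 1 - ε / (1 - ε) = (1 - 2 * ε) / (1 - ε) := by field_simp; ring
  rw [e1, div_pow, div_pow]
  have e2 : 4 * (1 - ε) * ((1 + σ) * ((1 - 2 * ε) ^ 2 / (1 - ε) ^ 2) -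
      (1 + 2 * σ) * (ε ^ 2 / (1 - ε) ^ 2)) =
      4 * ((1 + σ) * (1 - 2 * ε) ^ 2 - (1 + 2 * σ) * ε ^ 2) * (1 / (1 - ε)) := by
    field_simp
  rw [e2]
  refine mul_le_mul_of_nonneg_right ?_ (by positivity)
  have h2 : ε * σ ≤ ε * (2 / 3) := by nlinarith
  nlinarith [mul_pos hε0 hσ, sq_nonneg ε, mul_pos (mul_pos hε0 hε0) hσ]

end Powers

/-! ### Projections onto affine functions -/

section Projections
open scoped RealInnerProductSpace

variable {d : ℕ}

local notation "𝔼" => EuclideanSpace ℝ (Fin d)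

lemma integrable_mul_mul_weight {α : Type*} [MeasurableSpace α] {μ : Measure α} {w h k : α → ℝ}
    (hw : ∀ x, 0 ≤ w x) (hm : AEStronglyMeasurable (fun x => h x * k x * w x) μ)
    (hh : Integrable (fun x => h x ^ 2 * w x) μ) (hk : Integrable (fun x => k x ^ 2 * w x) μ) :
    Integrable (fun x => h x * k x * w x) μ := by
  refine (hh.add hk).mono' hm (Eventually.of_forall fun x => ?_)
  rw [norm_mul, norm_of_nonneg (hw x), norm_eq_abs, Pi.add_apply, ← add_mul]
  refine mul_le_mul_of_nonneg_right (abs_le.2 ⟨?_, ?_⟩) (hw x)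
  · nlinarith [sq_nonneg (h x + k x), sq_nonneg (h x), sq_nonneg (k x)]
  · nlinarith [sq_nonneg (h x - k x), sq_nonneg (h x), sq_nonneg (k x)]

lemma sq_integral_mul_mul_weight_le {α : Type*} [MeasurableSpace α] {μ : Measure α}
    {w h k : α → ℝ} (hw : ∀ x, 0 ≤ w x)
    (hm : AEStronglyMeasurable (fun x => h x * k x * w x) μ)
    (hh : Integrable (fun x => h x ^ 2 * w x) μ) (hk : Integrable (fun x => k x ^ 2 * w x) μ) :
    (∫ x, h x * k x * w x ∂μ) ^ 2 ≤ (∫ x, h x ^ 2 * w x ∂μ) * ∫ x, k x ^ 2 * w x ∂μ := by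
  have hhk := integrable_mul_mul_weight hw hm hh hk
  have key := discrim_le_zero (a := ∫ x, k x ^ 2 * w x ∂μ) (b := 2 * ∫ x, h x * k x * w x ∂μ)
    (c := ∫ x, h x ^ 2 * w x ∂μ) fun s => by
      have h0 : 0 ≤ ∫ x, (s * k x + h x) ^ 2 * w x ∂μ :=
        integral_nonneg fun x => mul_nonneg (sq_nonneg _) (hw x)
      have e : ∀ x, (s * k x + h x) ^ 2 * w x = s * s * (k x ^ 2 * w x) +
          2 * s * (h x * k x * w x) + h x ^ 2 * w x := fun x => by ring
      simp_rw [e] at h0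
      have i1 : Integrable (fun x => s * s * (k x ^ 2 * w x) + 2 * s * (h x * k x * w x)) μ :=
        (hk.const_mul _).add (hhk.const_mul _)
      rw [integral_add i1 hh, integral_add (hk.const_mul _) (hhk.const_mul _),
        integral_const_mul, integral_const_mul] at h0
      linarith
  rw [discrim] at key
  nlinarith

lemma norm_sq_mul_cauchyWeight_succ_le (a : ℝ) (x : 𝔼) :
    ‖x‖ ^ 2 * cauchyWeight (a + 1) x ≤ cauchyWeight a x := by
  rw [← cauchyWeight_succ_mul a]
  nlinarith [cauchyWeight_pos (a + 1) x]

lemma integrable_coord_mul_cauchyWeight {a : ℝ} (ha : (d : ℝ) / 2 + 1 < a) (v : 𝔼) :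
    Integrable fun x : 𝔼 => ⟪v, x⟫ * cauchyWeight a x := by
  have hi : Integrable fun x : 𝔼 => ‖v‖ * cauchyWeight (a - 1) x :=
    (integrable_cauchyWeight (by simp; linarith)).const_mul _
  refine hi.mono' (((by fun_prop : Continuous fun x : 𝔼 => ⟪v, x⟫).mul
    (continuous_cauchyWeight a)).aestronglyMeasurable) (Eventually.of_forall fun x => ?_)
  have h1 : cauchyWeight a x * (1 + ‖x‖ ^ 2) = cauchyWeight (a - 1) x := by
    simpa using cauchyWeight_succ_mul (a - 1) x
  have hp := cauchyWeight_pos a x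
  rw [norm_mul, norm_of_nonneg hp.le, ← h1]
  have h2 : ‖(⟪v, x⟫ : ℝ)‖ ≤ ‖v‖ * (1 + ‖x‖ ^ 2) := by
    refine (norm_inner_le_norm v x).trans (mul_le_mul_of_nonneg_left ?_ (norm_nonneg _))
    nlinarith [sq_nonneg (‖x‖ - 1), norm_nonneg x]
  nlinarith

lemma integrable_sq_coord_mul_cauchyWeight {a : ℝ} (ha : (d : ℝ) / 2 < a) (v : 𝔼) :
    Integrable fun x : 𝔼 => ⟪v, x⟫ ^ 2 * cauchyWeight (a + 1) x := by
  have hi : Integrable fun x : 𝔼 => ‖v‖ ^ 2 * cauchyWeight a x :=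
    (integrable_cauchyWeight (by simpa)).const_mul _
  refine hi.mono' ((((by fun_prop : Continuous fun x : 𝔼 => ⟪v, x⟫).pow 2).mul
    (continuous_cauchyWeight (a + 1))).aestronglyMeasurable) (Eventually.of_forall fun x => ?_)
  have hp := cauchyWeight_pos (a + 1) x
  rw [norm_of_nonneg (mul_nonneg (sq_nonneg _) hp.le)]
  have h2 : (⟪v, x⟫ : ℝ) ^ 2 ≤ ‖v‖ ^ 2 * ‖x‖ ^ 2 := by
    rw [← mul_pow, ← sq_abs]
    exact pow_le_pow_left₀ (abs_nonneg _) (abs_real_inner_le_norm v x) 2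
  calc _ ≤ ‖v‖ ^ 2 * ‖x‖ ^ 2 * cauchyWeight (a + 1) x := mul_le_mul_of_nonneg_right h2 hp.le
    _ = ‖v‖ ^ 2 * (‖x‖ ^ 2 * cauchyWeight (a + 1) x) := mul_assoc _ _ _
    _ ≤ _ := mul_le_mul_of_nonneg_left (norm_sq_mul_cauchyWeight_succ_le a x) (sq_nonneg _)

/-- The second moments of the weight, by an integration by parts. -/
lemma integral_sq_coord_mul_cauchyWeight {a : ℝ} (ha : (d : ℝ) / 2 + 1 < a) (v : 𝔼) :
    ∫ x : 𝔼, ⟪v, x⟫ ^ 2 * cauchyWeight (a + 1) x =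
      ‖v‖ ^ 2 * ((∫ x : 𝔼, cauchyWeight a x) / (2 * a)) := by
  have hd0 : (0 : ℝ) ≤ d := d.cast_nonneg
  have ha0 : 0 < a := by linarith
  have hdw : ∀ x : 𝔼, fderiv ℝ (cauchyWeight a : 𝔼 → ℝ) x v =
      -(2 * a) * cauchyWeight (a + 1) x * ⟪v, x⟫ := fun x => by
    rw [(hasFDerivAt_cauchyWeight a x).fderiv]
    simp [real_inner_comm]
  have hdl : ∀ x : 𝔼, HasFDerivAt (fun x : 𝔼 => (⟪v, x⟫ : ℝ)) (innerSL ℝ v) x := fun x =>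
    (innerSL ℝ v).hasFDerivAt
  have e1 : ∀ x : 𝔼, (⟪v, x⟫ : ℝ) * (-(2 * a) * cauchyWeight (a + 1) x * ⟪v, x⟫) =
      -(2 * a) * (⟪v, x⟫ ^ 2 * cauchyWeight (a + 1) x) := fun x => by ring
  have h := integral_mul_fderiv_eq_neg_fderiv_mul_of_integrable (μ := (volume : Measure 𝔼))
    (f := fun x : 𝔼 => (⟪v, x⟫ : ℝ)) (g := cauchyWeight a) (v := v) ?_ ?_ ?_ ?_ ?_
  · simp_rw [hdw, e1, (hdl _).fderiv, innerSL_apply_apply, real_inner_self_eq_norm_sq,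
      integral_const_mul] at h
    field_simp
    linarith
  · simp_rw [(hdl _).fderiv, innerSL_apply_apply]
    exact (integrable_cauchyWeight (by simp; linarith)).const_mul _
  · simp_rw [hdw, e1]
    exact (integrable_sq_coord_mul_cauchyWeight (by linarith) v).const_mul _
  · exact integrable_coord_mul_cauchyWeight ha v
  · exact fun x _ => (hdl x).differentiableAt
  · exact fun x _ => (hasFDerivAt_cauchyWeight a x).differentiableAt

lemma integral_cauchyWeight_pos {p : ℝ} (hp : (d : ℝ) / 2 < p) :
    0 < ∫ x : 𝔼, cauchyWeight p x :=
  integral_pos_of_integrable_nonneg_nonzero (x := 0) (continuous_cauchyWeight p)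
    (integrable_cauchyWeight (by simpa)) (fun x => (cauchyWeight_pos p x).le)
    (cauchyWeight_pos p 0).ne'

lemma sq_integral_mul_cauchyWeight_div_le {a : ℝ} (ha : (d : ℝ) / 2 < a) {h : 𝔼 → ℝ}
    (hm : AEStronglyMeasurable h volume)
    (hi : Integrable fun x => h x ^ 2 * cauchyWeight (a + 1) x) :
    (∫ x, h x * cauchyWeight (a + 1) x) ^ 2 / (∫ x : 𝔼, cauchyWeight (a + 1) x) ≤
      ∫ x, h x ^ 2 * cauchyWeight (a + 1) x := by
  have h1 := sq_integral_mul_mul_weight_le (k := fun _ => 1)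
    (fun x => (cauchyWeight_pos (a + 1) x).le)
    ((hm.mul aestronglyMeasurable_const).mul
      (continuous_cauchyWeight (a + 1)).aestronglyMeasurable) hi
    (by simpa using integrable_cauchyWeight (V := 𝔼) (p := a + 1) (by simp; linarith))
  rw [div_le_iff₀ (integral_cauchyWeight_pos (by linarith))]
  simpa using h1

/-- Bessel's inequality for the coordinate functions. -/
lemma sum_sq_integral_coord_div_le {a : ℝ} (ha : (d : ℝ) / 2 + 1 < a) {h : 𝔼 → ℝ}
    (hm : AEStronglyMeasurable h volume)
    (hi : Integrable fun x => h x ^ 2 * cauchyWeight (a + 1) x) :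
    (∑ i, (∫ x, h x * x i * cauchyWeight (a + 1) x) ^ 2) /
      ((∫ x : 𝔼, cauchyWeight a x) / (2 * a)) ≤ ∫ x, h x ^ 2 * cauchyWeight (a + 1) x := by
  have hd0 : (0 : ℝ) ≤ d := d.cast_nonneg
  have ha0 : 0 < a := by linarith
  have hM := integral_cauchyWeight_pos (d := d) (p := a) (by linarith)
  set M := (∫ x : 𝔼, cauchyWeight a x) / (2 * a) with hMd
  have hM0 : 0 < M := by positivity
  set c : 𝔼 := WithLp.toLp 2 fun i => ∫ x, h x * x i * cauchyWeight (a + 1) x with hc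
  have hcn : ‖c‖ ^ 2 = ∑ i, (∫ x, h x * x i * cauchyWeight (a + 1) x) ^ 2 := by
    rw [EuclideanSpace.norm_sq_eq]; simp [hc]
  have hwm := (continuous_cauchyWeight (V := 𝔼) (a + 1)).aestronglyMeasurable (μ := volume)
  have hint : ∀ i, Integrable fun x => h x * x i * cauchyWeight (a + 1) x := fun i =>
    integrable_mul_mul_weight (fun x => (cauchyWeight_pos (a + 1) x).le)
      ((hm.mul (by fun_prop : Continuous fun x : 𝔼 => x i).aestronglyMeasurable).mul hwm) hi
      (by
        have := integrable_sq_coord_mul_cauchyWeight (d := d) (a := a) (by linarith)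
          (EuclideanSpace.single i 1)
        simpa [EuclideanSpace.inner_single_left] using this)
  have h1 := sq_integral_mul_mul_weight_le (k := fun x : 𝔼 => (⟪c, x⟫ : ℝ))
    (fun x => (cauchyWeight_pos (a + 1) x).le)
    ((hm.mul (by fun_prop : Continuous fun x : 𝔼 => (⟪c, x⟫ : ℝ)).aestronglyMeasurable).mul hwm)
    hi (integrable_sq_coord_mul_cauchyWeight (by linarith) c)
  have e1 : ∫ x, h x * ⟪c, x⟫ * cauchyWeight (a + 1) x = ‖c‖ ^ 2 := by
    have e2 : ∀ x : 𝔼, h x * ⟪c, x⟫ * cauchyWeight (a + 1) x =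
        ∑ i, c i * (h x * x i * cauchyWeight (a + 1) x) := fun x => by
      rw [inner_eq_sum, Finset.mul_sum, Finset.sum_mul]
      exact Finset.sum_congr rfl fun i _ => by ring
    simp_rw [e2]
    rw [integral_finsetSum _ fun i _ => (hint i).const_mul _, hcn]
    refine Finset.sum_congr rfl fun i _ => ?_
    rw [integral_const_mul, sq]
  rw [e1, integral_sq_coord_mul_cauchyWeight ha, ← hMd] at h1
  rw [← hcn, div_le_iff₀ hM0]
  have hY : 0 ≤ ∫ x, h x ^ 2 * cauchyWeight (a + 1) x :=
    integral_nonneg fun x => mul_nonneg (sq_nonneg _) (cauchyWeight_pos _ _).le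
  rcases (sq_nonneg ‖c‖).eq_or_lt with h0 | h0
  · rw [← h0]; positivity
  · nlinarith

lemma hasWeakGradient_of_contDiff {q : 𝔼 → ℝ} (hq : ContDiff ℝ ∞ q) :
    HasWeakGradient q (gradient q) := by
  have hcq := continuous_gradient hq
  refine ⟨hq.continuous.locallyIntegrable, hcq.locallyIntegrable, fun φ hφ hφc => ?_⟩
  have hcφ := continuous_gradient hφ
  have hcc : ∀ i : Fin d, Continuous fun y : 𝔼 => y i := fun i => by fun_prop
  have i1 : Integrable fun x => q x • gradient φ x :=
    (hq.continuous.smul hcφ).integrable_of_hasCompactSupport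
      (hasCompactSupport_gradient hφc).smul_left
  have i2 : Integrable fun x => φ x • gradient q x :=
    (hφ.continuous.smul hcq).integrable_of_hasCompactSupport hφc.smul_right
  have e : ∀ {u : 𝔼 → 𝔼}, Integrable u → ∀ i, (∫ x, u x) i = ∫ x, u x i := fun hu i =>
    ((EuclideanSpace.proj i : 𝔼 →L[ℝ] ℝ).integral_comp_comm hu).symm
  ext i
  rw [PiLp.neg_apply, e i1, e i2]
  simp only [PiLp.smul_apply, smul_eq_mul, gradient_apply_eq_fderiv]
  rw [integral_mul_fderiv_eq_neg_fderiv_mul_of_integrable]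
  · simp only [mul_comm]
  · simp_rw [← gradient_apply_eq_fderiv]
    exact integrable_compact (((hcc i).comp hcq).mul hφ.continuous) hφc.mul_left
  · simp_rw [← gradient_apply_eq_fderiv]
    exact integrable_compact (hq.continuous.mul ((hcc i).comp hcφ))
      ((hasCompactSupport_gradient hφc).comp_left (g := fun y : 𝔼 => y i) rfl).mul_left
  · exact integrable_compact (hq.continuous.mul hφ.continuous) hφc.mul_left
  · exact fun x _ => hq.differentiable (by simp) x
  · exact fun x _ => hφ.differentiable (by simp) x

lemma HasWeakGradient.sub {f g : 𝔼 → ℝ} {F G : 𝔼 → 𝔼} (hf : HasWeakGradient f F)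
    (hg : HasWeakGradient g G) : HasWeakGradient (fun x => f x - g x) fun x => F x - G x := by
  refine ⟨hf.locallyIntegrable.sub hg.locallyIntegrable,
    hf.locallyIntegrable_grad.sub hg.locallyIntegrable_grad, fun φ hφ hφc => ?_⟩
  simp_rw [sub_smul, smul_sub]
  have hgc := hasCompactSupport_gradient hφc
  have hgd := continuous_gradient hφ
  rw [integral_sub (hf.locallyIntegrable.integrable_smul_right_of_hasCompactSupport hgd hgc)
      (hg.locallyIntegrable.integrable_smul_right_of_hasCompactSupport hgd hgc),
    integral_sub
      (hf.locallyIntegrable_grad.integrable_smul_left_of_hasCompactSupport hφ.continuous hφc)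
      (hg.locallyIntegrable_grad.integrable_smul_left_of_hasCompactSupport hφ.continuous hφc),
    hf.integral_eq φ hφ hφc, hg.integral_eq φ hφ hφc]
  abel

lemma hasWeakGradient_one_add_norm_sq :
    HasWeakGradient (fun x : 𝔼 => 1 + ‖x‖ ^ 2) fun x => (2 : ℝ) • x := by
  have hq : ContDiff ℝ ∞ fun x : 𝔼 => 1 + ‖x‖ ^ 2 := contDiff_const.add (contDiff_norm_sq ℝ)
  have e : gradient (fun x : 𝔼 => 1 + ‖x‖ ^ 2) = fun x => (2 : ℝ) • x := by
    funext x
    refine HasGradientAt.gradient ?_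
    rw [hasGradientAt_iff_hasFDerivAt]
    refine ((hasStrictFDerivAt_norm_sq x).hasFDerivAt.const_add 1).congr_fderiv ?_
    ext y; simp
  rw [← e]
  exact hasWeakGradient_of_contDiff hq

end Projections

/-! ### Entropy and Fisher information near the Barenblatt profile -/

section Nonlinear
open scoped RealInnerProductSpace

variable {d : ℕ}

local notation "𝔼" => EuclideanSpace ℝ (Fin d)

lemma cauchyWeight_rpow {V : Type*} [NormedAddCommGroup V] (p q : ℝ) (x : V) :
    cauchyWeight p x ^ q = cauchyWeight (p * q) x := by
  rw [cauchyWeight, cauchyWeight, ← rpow_mul (by positivity), neg_mul]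

lemma barenblatt_eq_cauchyWeight (d : ℕ) (m : ℝ) :
    barenblatt d m = cauchyWeight (1 / (1 - m)) := by
  funext x
  rw [barenblatt, cauchyWeight, ← neg_sub 1 m, one_div_neg_eq_neg_one_div]

/-- The weighted spectral gap, applied to the pressure increment `f` of the density
`(1 + t) cauchyWeight a`. Its projections onto affine functions are of second order, since those
of `t` vanish. -/
theorem HasWeakGradient.pressure_gap {f : 𝔼 → ℝ} {G : 𝔼 → 𝔼} (h : HasWeakGradient f G) {a κ : ℝ}
    (had : AdmissibleExponent d a) (hκ : κ = 1 / a) {σ : ℝ} (hσ : σ = 2 / 3 * (1 - d / a))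
    (hσ0 : 0 ≤ σ) {ε : ℝ} (hε : ε ≤ 1 / 2) {t : 𝔼 → ℝ} (htm : AEStronglyMeasurable t volume)
    (ht : ∀ᵐ x, |t x| ≤ ε) (hf : ∀ᵐ x, f x = (1 + ‖x‖ ^ 2) * ((1 + t x) ^ (-κ) - 1))
    (ht0 : ∫ x, t x * cauchyWeight a x = 0) (ht1 : ∀ i, ∫ x, t x * x i * cauchyWeight a x = 0)
    (hE : Integrable fun x => ‖G x‖ ^ 2 * cauchyWeight a x) :
    2 * κ * ((1 + σ) * (1 - ε / (1 - ε)) ^ 2 - (1 + 2 * σ) * (ε / (1 - ε)) ^ 2) *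
      (∫ x, t x ^ 2 * cauchyWeight (a - 1) x) ≤ ∫ x, ‖G x‖ ^ 2 * cauchyWeight a x := by
  have ha := had.half_lt
  have hd0 : (0 : ℝ) ≤ d := d.cast_nonneg
  have ha1 : 1 < a := by linarith
  have ha0 : 0 < a := by linarith
  have hκ0 : 0 < κ := by rw [hκ]; positivity
  have hκ1 : κ ≤ 1 := by rw [hκ, div_le_one ha0]; exact ha1.le
  have hw1 := fun x : 𝔼 => cauchyWeight_sub_one a x
  have hw2 := fun x : 𝔼 => cauchyWeight_succ_mul a x
  have hwp := fun (p : ℝ) (x : 𝔼) => cauchyWeight_pos p x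
  have hwm := fun p : ℝ =>
    (continuous_cauchyWeight (V := 𝔼) p).aestronglyMeasurable (μ := volume)
  have hwi : Integrable fun x : 𝔼 => cauchyWeight (a - 1) x :=
    integrable_cauchyWeight (by simp; linarith)
  have hwi0 : Integrable fun x : 𝔼 => cauchyWeight a x :=
    integrable_cauchyWeight (by simp; linarith)
  have hfm := h.locallyIntegrable.aestronglyMeasurable
  have hqm : AEStronglyMeasurable (fun x : 𝔼 => 1 + ‖x‖ ^ 2) volume :=
    (by fun_prop : Continuous fun x : 𝔼 => 1 + ‖x‖ ^ 2).aestronglyMeasurable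
  have hcm : ∀ i : Fin d, AEStronglyMeasurable (fun x : 𝔼 => x i) volume := fun i =>
    (by fun_prop : Continuous fun x : 𝔼 => x i).aestronglyMeasurable
  have hbd : ∀ᵐ x, |f x| ≤ 2 * (1 + ‖x‖ ^ 2) := by
    filter_upwards [ht, hf] with x hx hfx
    have h0 := (abs_nonneg _).trans hx
    obtain ⟨h1, h2⟩ := rpow_neg_taylor hκ0.le hκ1 (by linarith [abs_le.1 hx] : -1 < t x)
    have hx2 := abs_le.1 hx
    have h3 : κ * t x ^ 2 / (1 + t x) ≤ 1 := by
      rw [div_le_one (by linarith)]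
      nlinarith [sq_nonneg (t x)]
    have h4 : |(1 + t x) ^ (-κ) - 1| ≤ 2 := abs_le.2 ⟨by nlinarith, by nlinarith⟩
    rw [hfx, abs_mul, abs_of_pos (by positivity), mul_comm]
    exact mul_le_mul_of_nonneg_right h4 (by positivity)
  have hS : Integrable fun x => t x ^ 2 * cauchyWeight (a - 1) x := by
    refine hwi.mono' ((htm.pow 2).mul (hwm _)) ?_
    filter_upwards [ht] with x hx
    rw [norm_of_nonneg (mul_nonneg (sq_nonneg _) (hwp _ x).le)]
    refine mul_le_of_le_one_left (hwp _ x).le ?_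
    rw [← sq_abs]
    exact pow_le_one₀ (abs_nonneg _) (by linarith)
  set S := ∫ x, t x ^ 2 * cauchyWeight (a - 1) x with hSd
  set δ := ε / (1 - ε) with hδ
  -- the second-order part of the pressure increment
  set g : 𝔼 → ℝ := fun x => f x + κ * ((1 + ‖x‖ ^ 2) * t x) with hg
  have hgm : AEStronglyMeasurable g volume := hfm.add ((hqm.mul htm).const_mul κ)
  have hgle : ∀ᵐ x, g x ^ 2 * cauchyWeight (a + 1) x ≤
      κ ^ 2 * δ ^ 2 * (t x ^ 2 * cauchyWeight (a - 1) x) := by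
    filter_upwards [ht, hf] with x hx hfx
    have h1 := mul_le_mul_of_nonneg_right (sq_le_sq_pressure hκ0.le hκ1 hε hx).2
      (hwp (a - 1) x).le
    refine le_of_eq_of_le ?_ (h1.trans (le_of_eq (by ring)))
    simp only [hg]
    rw [hfx, hw1]; ring
  have hgi : Integrable fun x => g x ^ 2 * cauchyWeight (a + 1) x := by
    refine (hS.const_mul (κ ^ 2 * δ ^ 2)).mono' ((hgm.pow 2).mul (hwm _)) ?_
    filter_upwards [hgle] with x hx
    rwa [norm_of_nonneg (mul_nonneg (sq_nonneg _) (hwp _ x).le)]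
  have hY : ∫ x, g x ^ 2 * cauchyWeight (a + 1) x ≤ κ ^ 2 * δ ^ 2 * S := by
    rw [hSd, ← integral_const_mul]
    exact integral_mono_ae hgi (hS.const_mul _) hgle
  have hX : κ ^ 2 * (1 - δ) ^ 2 * S ≤ ∫ x, f x ^ 2 * cauchyWeight (a + 1) x := by
    rw [hSd, ← integral_const_mul]
    refine integral_mono_ae (hS.const_mul _) ?_ ?_
    · refine (hwi.const_mul 4).mono' ((hfm.pow 2).mul (hwm _)) ?_
      filter_upwards [hbd] with x hx
      rw [norm_of_nonneg (mul_nonneg (sq_nonneg _) (hwp _ x).le), hw1, ← mul_assoc]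
      refine mul_le_mul_of_nonneg_right ?_ (hwp _ x).le
      rw [← sq_abs]
      exact (pow_le_pow_left₀ (abs_nonneg _) hx 2).trans (le_of_eq (by ring))
    · filter_upwards [ht, hf] with x hx hfx
      have h1 := mul_le_mul_of_nonneg_right (sq_le_sq_pressure hκ0.le hκ1 hε hx).1
        (hwp (a - 1) x).le
      refine (le_of_eq (by ring)).trans (h1.trans (le_of_eq ?_))
      rw [hfx, hw1]; ring
  have hm0 : ∫ x, g x * cauchyWeight (a + 1) x = ∫ x, f x * cauchyWeight (a + 1) x := by
    have e : ∀ x, g x * cauchyWeight (a + 1) x =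
        f x * cauchyWeight (a + 1) x + κ * (t x * cauchyWeight a x) := fun x => by
      simp only [hg]; rw [← hw2]; ring
    simp_rw [e]
    rw [integral_add, integral_const_mul, ht0, mul_zero, add_zero]
    · refine (hwi0.const_mul 2).mono' (hfm.mul (hwm _)) ?_
      filter_upwards [hbd] with x hx
      rw [norm_mul, norm_of_nonneg (hwp _ x).le, ← hw2, norm_eq_abs]
      nlinarith [mul_le_mul_of_nonneg_right hx (hwp (a + 1) x).le]
    · refine (hwi0.mono' (htm.mul (hwm _)) ?_).const_mul κ
      filter_upwards [ht] with x hx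
      rw [Pi.mul_apply, norm_mul, norm_of_nonneg (hwp _ x).le, norm_eq_abs]
      exact mul_le_of_le_one_left (hwp _ x).le (by linarith)
  have hm1 : ∀ i, ∫ x, g x * x i * cauchyWeight (a + 1) x =
      ∫ x, f x * x i * cauchyWeight (a + 1) x := fun i => by
    have e : ∀ x, g x * x i * cauchyWeight (a + 1) x =
        f x * x i * cauchyWeight (a + 1) x + κ * (t x * x i * cauchyWeight a x) := fun x => by
      simp only [hg]; rw [← hw2]; ring
    have hc : Integrable fun x : 𝔼 => x i * cauchyWeight a x := by
      simpa [EuclideanSpace.inner_single_left] using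
        integrable_coord_mul_cauchyWeight ha (EuclideanSpace.single i (1 : ℝ))
    simp_rw [e]
    rw [integral_add, integral_const_mul, ht1, mul_zero, add_zero]
    · refine (hc.norm.const_mul 2).mono' ((hfm.mul (hcm i)).mul (hwm _)) ?_
      filter_upwards [hbd] with x hx
      have h1 := mul_le_mul_of_nonneg_right hx
        (mul_nonneg (abs_nonneg (x i)) (hwp (a + 1) x).le)
      rw [norm_mul, norm_mul, norm_mul, norm_of_nonneg (hwp _ x).le, norm_of_nonneg (hwp _ x).le,
        ← hw2, norm_eq_abs, norm_eq_abs]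
      linarith
    · refine (hc.norm.mono' ((htm.mul (hcm i)).mul (hwm _)) ?_).const_mul κ
      filter_upwards [ht] with x hx
      simp only [Pi.mul_apply]
      rw [mul_assoc, norm_mul, norm_eq_abs (t x)]
      exact mul_le_of_le_one_left (norm_nonneg _) (by linarith)
  have hP0 := (sq_integral_mul_cauchyWeight_div_le (by linarith) hgm hgi).trans hY
  have hP1 := (sum_sq_integral_coord_div_le ha hgm hgi).trans hY
  rw [hm0] at hP0
  simp_rw [hm1] at hP1
  have hgap := h.weighted_gap had hσ (by norm_num) hbd hE
  have e1 : 1 / (2 * a) = κ / 2 := by rw [hκ]; field_simp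
  rw [e1] at hgap
  have h1 := mul_le_mul_of_nonneg_left hX (by linarith : 0 ≤ 1 + σ)
  have h2 := mul_le_mul_of_nonneg_left hP0 (by linarith : 0 ≤ 1 + σ)
  have h3 := mul_le_mul_of_nonneg_left hP1 hσ0
  refine le_of_mul_le_mul_left ?_ (by positivity : 0 < κ / 2)
  refine le_trans ?_ hgap
  linarith

/-- The entropy of the density `(1 + t) cauchyWeight a` is at most a weighted square norm of the
relative error `t`, and is positive unless `t` vanishes. -/
lemma entropy_bounds {a m : ℝ} (hm : 0 < m) (hm1 : m < 1) (ha : a = 1 / (1 - m))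
    (had : (d : ℝ) / 2 + 1 < a) {ε : ℝ} (hε : ε ≤ 1 / 2) {t v : 𝔼 → ℝ}
    (htm : AEStronglyMeasurable t volume) (ht : ∀ᵐ x, |t x| ≤ ε)
    (hv : ∀ x, v x = cauchyWeight a x * (1 + t x)) :
    Integrable (entropyDensity m v) ∧
      relEntropy m v ≤ (1 - m) / 2 * (1 / (1 - ε)) * (∫ x, t x ^ 2 * cauchyWeight (a - 1) x) ∧
      (¬ t =ᵐ[volume] 0 → 0 < relEntropy m v) := by
  have hd0 : (0 : ℝ) ≤ d := d.cast_nonneg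
  have hwp := fun (p : ℝ) (x : 𝔼) => cauchyWeight_pos p x
  have hwm := fun p : ℝ =>
    (continuous_cauchyWeight (V := 𝔼) p).aestronglyMeasurable (μ := volume)
  have hwi : Integrable fun x : 𝔼 => cauchyWeight (a - 1) x :=
    integrable_cauchyWeight (by simp; linarith)
  have hm1' : 1 - m ≠ 0 := by linarith
  have e1 : a * (m - 1) = -1 := by rw [ha]; field_simp; ring
  have e2 : a * m = a - 1 := by linarith
  set k : ℝ → ℝ := fun s => s - ((1 + s) ^ m - 1) / m with hk
  have hdens : ∀ᵐ x, entropyDensity m v x = k (t x) * cauchyWeight (a - 1) x := by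
    filter_upwards [ht] with x hx
    have h0 : 0 ≤ 1 + t x := by linarith [(abs_le.1 hx).1]
    have h1 := cauchyWeight_succ_mul (a - 1) x
    rw [sub_add_cancel] at h1
    rw [entropyDensity, barenblatt_eq_cauchyWeight, ← ha, hv, mul_rpow (hwp a x).le h0,
      cauchyWeight_rpow, cauchyWeight_rpow, e1, e2, cauchyWeight_neg_one, ← h1]
    simp only [hk]
    ring
  have hk0 : ∀ᵐ x, 0 ≤ k (t x) := by
    filter_upwards [ht] with x hx
    rcases eq_or_ne (t x) 0 with h0 | h0
    · simp [hk, h0]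
    · exact (entropy_pos hm hm1 (by linarith [(abs_le.1 hx).1]) h0).le
  have hkle : ∀ᵐ x, k (t x) * cauchyWeight (a - 1) x ≤
      (1 - m) / 2 * (1 / (1 - ε)) * (t x ^ 2 * cauchyWeight (a - 1) x) := by
    filter_upwards [ht] with x hx
    have := mul_le_mul_of_nonneg_right (entropy_le_sq hm hm1 (by linarith) hx)
      (hwp (a - 1) x).le
    linarith
  have hS : Integrable fun x => t x ^ 2 * cauchyWeight (a - 1) x := by
    refine hwi.mono' ((htm.pow 2).mul (hwm _)) ?_
    filter_upwards [ht] with x hx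
    rw [norm_of_nonneg (mul_nonneg (sq_nonneg _) (hwp _ x).le)]
    refine mul_le_of_le_one_left (hwp _ x).le ?_
    rw [← sq_abs]
    exact pow_le_one₀ (abs_nonneg _) (by linarith)
  have hkm : AEStronglyMeasurable (fun x => k (t x) * cauchyWeight (a - 1) x) volume := by
    have hkc : Continuous k := by
      have : Continuous fun s : ℝ => (1 + s) ^ m :=
        (continuous_const.add continuous_id).rpow_const fun s => Or.inr hm.le
      fun_prop
    exact (hkc.comp_aestronglyMeasurable htm).mul (hwm _)
  have hki : Integrable fun x => k (t x) * cauchyWeight (a - 1) x := by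
    refine (hS.const_mul ((1 - m) / 2 * (1 / (1 - ε)))).mono' hkm ?_
    filter_upwards [hkle, hk0] with x hx h0
    rwa [norm_of_nonneg (mul_nonneg h0 (hwp _ x).le)]
  have hrel : relEntropy m v = ∫ x, k (t x) * cauchyWeight (a - 1) x := integral_congr_ae hdens
  refine ⟨hki.congr (hdens.mono fun x hx => hx.symm), ?_, fun hne => ?_⟩
  · rw [hrel, ← integral_const_mul]
    exact integral_mono_ae hki (hS.const_mul _) hkle
  · have h0 : 0 ≤ᵐ[volume] fun x => k (t x) * cauchyWeight (a - 1) x :=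
      hk0.mono fun x hx => mul_nonneg hx (hwp _ x).le
    rw [hrel]
    refine lt_of_le_of_ne (integral_nonneg_of_ae h0) fun heq => hne ?_
    have h1 := (integral_eq_zero_iff_of_nonneg_ae h0 hki).1 heq.symm
    filter_upwards [h1, ht] with x hx htx
    by_contra hx0
    have h2 := entropy_pos hm hm1 (by linarith [(abs_le.1 htx).1]) hx0
    exact (mul_pos h2 (hwp (a - 1) x)).ne' hx

/-- The relative error of a density with the mass and the center of mass of the profile is
orthogonal to affine functions. -/
lemma relative_error_moments {a : ℝ} (had : (d : ℝ) / 2 + 1 < a) {ε : ℝ} (hε : ε ≤ 1)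
    {t v : 𝔼 → ℝ} (htm : AEStronglyMeasurable t volume) (ht : ∀ᵐ x, |t x| ≤ ε)
    (hv : ∀ x, v x = cauchyWeight a x * (1 + t x))
    (hmass : ∫ x, v x = ∫ x : 𝔼, cauchyWeight a x) (hcenter : ∫ x, v x • x = 0) :
    ∫ x, t x * cauchyWeight a x = 0 ∧ ∀ i, ∫ x, t x * x i * cauchyWeight a x = 0 := by
  have hd0 : (0 : ℝ) ≤ d := d.cast_nonneg
  have hwp := fun (p : ℝ) (x : 𝔼) => cauchyWeight_pos p x
  have hwm := fun p : ℝ =>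
    (continuous_cauchyWeight (V := 𝔼) p).aestronglyMeasurable (μ := volume)
  have hwi0 : Integrable fun x : 𝔼 => cauchyWeight a x :=
    integrable_cauchyWeight (by simp; linarith)
  have hwx : Integrable fun x : 𝔼 => cauchyWeight a x • x := by
    have hwi : Integrable fun x : 𝔼 => cauchyWeight (a - 1) x :=
      integrable_cauchyWeight (by simp; linarith)
    refine hwi.mono' ((hwm a).smul aestronglyMeasurable_id) (Eventually.of_forall fun x => ?_)
    have h1 := cauchyWeight_succ_mul (a - 1) x
    rw [sub_add_cancel] at h1
    rw [norm_smul, norm_of_nonneg (hwp a x).le, ← h1]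
    refine mul_le_mul_of_nonneg_left ?_ (hwp a x).le
    nlinarith [sq_nonneg (‖x‖ - 1), norm_nonneg x]
  have hti : Integrable fun x => t x * cauchyWeight a x := by
    refine hwi0.mono' (htm.mul (hwm _)) ?_
    filter_upwards [ht] with x hx
    rw [norm_mul, norm_of_nonneg (hwp _ x).le, norm_eq_abs]
    exact mul_le_of_le_one_left (hwp _ x).le (by linarith)
  have htx : Integrable fun x => (t x * cauchyWeight a x) • x := by
    refine hwx.norm.mono' ((htm.mul (hwm a)).smul aestronglyMeasurable_id) ?_
    filter_upwards [ht] with x hx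
    rw [mul_smul, norm_smul, norm_eq_abs]
    exact mul_le_of_le_one_left (norm_nonneg _) (by linarith)
  constructor
  · have e : ∀ x, v x = cauchyWeight a x + t x * cauchyWeight a x := fun x => by rw [hv]; ring
    simp_rw [e] at hmass
    rw [integral_add hwi0 hti] at hmass
    linarith
  · have h0 : ∫ x : 𝔼, cauchyWeight a x • x = 0 := by
      have h1 := integral_neg_eq_self (fun x : 𝔼 => cauchyWeight a x • x) volume
      simp only [cauchyWeight, norm_neg, smul_neg, integral_neg] at h1 ⊢
      exact (smul_eq_zero.1 ((two_smul ℝ _).trans (neg_eq_iff_add_eq_zero.1 h1))).resolve_left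
        two_ne_zero
    have e : ∀ x, v x • x = cauchyWeight a x • x + (t x * cauchyWeight a x) • x := fun x => by
      rw [hv, ← add_smul]; congr 1; ring
    simp_rw [e] at hcenter
    rw [integral_add hwx htx, h0, zero_add] at hcenter
    intro i
    have h2 := (EuclideanSpace.proj i : 𝔼 →L[ℝ] ℝ).integral_comp_comm htx
    rw [hcenter, map_zero] at h2
    rw [← h2]
    congr 1 with x
    simp
    ring

/-- The entropy - entropy production inequality with an improved constant for densities close to
the profile. -/
theorem mul_relEntropy_le_relFisher {m : ℝ} (hm : 0 < m) (hm1 : m < 1) {a : ℝ}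
    (ha : a = 1 / (1 - m)) (had : AdmissibleExponent d a) {σ : ℝ}
    (hσ : σ = 2 / 3 * (1 - d / a)) {ε : ℝ} (hε0 : 0 < ε) (hε : ε < 3 * σ / 266) {t v : 𝔼 → ℝ}
    (htm : AEStronglyMeasurable t volume) (ht : ∀ᵐ x, |t x| ≤ ε)
    (hv : ∀ x, v x = cauchyWeight a x * (1 + t x))
    (hmass : ∫ x, v x = ∫ x : 𝔼, cauchyWeight a x) (hcenter : ∫ x, v x • x = 0) :
    ENNReal.ofReal ((4 + 3 * σ) * relEntropy m v) ≤ relFisher m v := by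
  have hd0 : (0 : ℝ) < d := by exact_mod_cast had.one_le
  have hlt := had.half_lt
  have ha0 : 0 < a := hd0.trans had.lt
  have hσ0 : 0 < σ := by linarith
  have hσ1 : σ < 2 / 3 := by
    have : 0 < (d : ℝ) / a := by positivity
    rw [hσ]; linarith
  have hε2 : ε ≤ 1 / 2 := by linarith
  have hκ : 1 - m = 1 / a := by rw [ha, one_div_one_div]
  have hwp := fun (p : ℝ) (x : 𝔼) => cauchyWeight_pos p x
  obtain ⟨ht0, ht1⟩ := relative_error_moments hlt (by linarith) htm ht hv hmass hcenter
  obtain ⟨-, hent, -⟩ := entropy_bounds hm hm1 ha hlt hε2 htm ht hv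
  refine le_iInf₂ fun H hH => ?_
  have hG := hH.sub hasWeakGradient_one_add_norm_sq
  set G : 𝔼 → 𝔼 := fun x => H x - (2 : ℝ) • x with hGd
  have hf : ∀ᵐ x, v x ^ (m - 1) - (1 + ‖x‖ ^ 2) =
      (1 + ‖x‖ ^ 2) * ((1 + t x) ^ (-(1 - m)) - 1) := by
    filter_upwards [ht] with x hx
    have h0 : 0 ≤ 1 + t x := by linarith [(abs_le.1 hx).1]
    have e1 : a * (m - 1) = -1 := by
      have : 1 - m ≠ 0 := by linarith
      rw [ha]; field_simp; ring
    rw [hv, mul_rpow (hwp a x).le h0, cauchyWeight_rpow, e1, cauchyWeight_neg_one, neg_sub]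
    ring
  have hvle : ∀ᵐ x, (1 - ε) * cauchyWeight a x ≤ v x := by
    filter_upwards [ht] with x hx
    rw [hv, mul_comm]
    exact mul_le_mul_of_nonneg_left (by linarith [(abs_le.1 hx).1]) (hwp a x).le
  have hGm : AEStronglyMeasurable G volume := hG.locallyIntegrable_grad.aestronglyMeasurable
  have hvm : AEStronglyMeasurable v volume := by
    rw [funext hv]
    exact (continuous_cauchyWeight a).aestronglyMeasurable.mul (htm.const_add 1)
  have hIm : AEStronglyMeasurable (fun x => v x * ‖G x‖ ^ 2) volume :=
    hvm.mul (hGm.norm.pow 2)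
  have hI0 : ∀ᵐ x, 0 ≤ v x * ‖G x‖ ^ 2 := by
    filter_upwards [hvle] with x hx
    exact mul_nonneg ((mul_pos (by linarith) (hwp a x)).le.trans hx) (sq_nonneg _)
  by_cases htop : ∫⁻ x, ENNReal.ofReal (v x * ‖G x‖ ^ 2) = ⊤
  · rw [htop]; exact le_top
  have hI : Integrable fun x => v x * ‖G x‖ ^ 2 :=
    (lintegral_ofReal_ne_top_iff_integrable hIm hI0).1 htop
  rw [← ofReal_integral_eq_lintegral_ofReal hI hI0]
  refine ENNReal.ofReal_le_ofReal ?_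
  have hle : ∀ᵐ x, (1 - ε) * (‖G x‖ ^ 2 * cauchyWeight a x) ≤ v x * ‖G x‖ ^ 2 := by
    filter_upwards [hvle] with x hx
    have := mul_le_mul_of_nonneg_right hx (sq_nonneg ‖G x‖)
    linarith
  have hE : Integrable fun x => ‖G x‖ ^ 2 * cauchyWeight a x := by
    have h1 : Integrable fun x => (1 - ε) * (‖G x‖ ^ 2 * cauchyWeight a x) := by
      refine hI.mono' (((hGm.norm.pow 2).mul
        (continuous_cauchyWeight a).aestronglyMeasurable).const_mul _) ?_
      filter_upwards [hle] with x hx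
      rwa [norm_of_nonneg (mul_nonneg (by linarith) (mul_nonneg (sq_nonneg _) (hwp a x).le))]
    refine (h1.const_mul (1 - ε)⁻¹).congr (Eventually.of_forall fun x => ?_)
    exact inv_mul_cancel_left₀ (by linarith : 1 - ε ≠ 0) _
  have hgap := hG.pressure_gap had hκ hσ hσ0.le hε2 htm ht hf ht0 ht1 hE
  have hS : 0 ≤ ∫ x, t x ^ 2 * cauchyWeight (a - 1) x :=
    integral_nonneg fun x => mul_nonneg (sq_nonneg _) (hwp _ x).le
  set S := ∫ x, t x ^ 2 * cauchyWeight (a - 1) x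
  have hnum := gap_constant_nonlinear hσ0 hσ1 hε0 hε
  calc (4 + 3 * σ) * relEntropy m v
      ≤ (4 + 3 * σ) * ((1 - m) / 2 * (1 / (1 - ε)) * S) :=
        mul_le_mul_of_nonneg_left hent (by linarith)
    _ = (4 + 3 * σ) * (1 / (1 - ε)) * ((1 - m) / 2 * S) := by ring
    _ ≤ _ := mul_le_mul_of_nonneg_right hnum (mul_nonneg (by linarith) hS)
    _ = (1 - ε) * (2 * (1 - m) * ((1 + σ) * (1 - ε / (1 - ε)) ^ 2 -
          (1 + 2 * σ) * (ε / (1 - ε)) ^ 2) * S) := by ring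
    _ ≤ (1 - ε) * ∫ x, ‖G x‖ ^ 2 * cauchyWeight a x :=
        mul_le_mul_of_nonneg_left hgap (by linarith)
    _ = ∫ x, (1 - ε) * (‖G x‖ ^ 2 * cauchyWeight a x) := (integral_const_mul _ _).symm
    _ ≤ _ := integral_mono_ae (hE.const_mul _) hI hle

end Nonlinear

/-! ### The quotient -/

lemma admissibleExponent_of_mOne_lt {d : ℕ} (hd : 1 ≤ d) {m : ℝ} (hm : mOne d < m)
    (hm1 : m < 1) (hm_dim_one : d = 1 → 1 / 3 < m) : AdmissibleExponent d (1 / (1 - m)) := by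
  have hd0 : (0 : ℝ) < d := by exact_mod_cast hd
  have hm1' : 0 < 1 - m := by linarith
  refine ⟨hd, ?_, fun h => ?_⟩
  · rw [mOne, div_lt_iff₀ hd0] at hm
    rw [lt_div_iff₀ hm1']
    linarith
  · rw [lt_div_iff₀ hm1']
    linarith [hm_dim_one h]

lemma gapEta_eq {d : ℕ} (hd : 1 ≤ d) (m : ℝ) :
    gapEta d m = 3 * (2 / 3 * (1 - d / (1 / (1 - m)))) := by
  have hd0 : (d : ℝ) ≠ 0 := by positivity
  rw [gapEta, mOne]
  field_simp
  ring

end FastDiffusion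

theorem mainTheorem8 (d : ℕ) (hd : 1 ≤ d) (m : ℝ)
    (hm : FastDiffusion.mOne d < m) (hm_one : m < 1) (hm_dim_one : d = 1 → 1 / 3 < m) :
    (0 < FastDiffusion.gapChi m ∧ FastDiffusion.gapChi m < 1) ∧
    ∀ (v : EuclideanSpace ℝ (Fin d) → ℝ) (ε : ℝ),
      AEStronglyMeasurable v volume →
      (∫ x, v x = ∫ x, FastDiffusion.barenblatt d m x) →
      (∫ x, v x • x = 0) →
      0 < ε → ε < FastDiffusion.gapChi m * FastDiffusion.gapEta d m →
      (∀ᵐ x, (1 - ε) * FastDiffusion.barenblatt d m x ≤ v x ∧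
        v x ≤ (1 + ε) * FastDiffusion.barenblatt d m x) →
      ¬ (v =ᵐ[volume] FastDiffusion.barenblatt d m) →
      Integrable (FastDiffusion.entropyDensity m v) volume ∧
      0 < FastDiffusion.relEntropy m v ∧
      ENNReal.ofReal (4 + FastDiffusion.gapEta d m) ≤ FastDiffusion.quotient m v := by
  open FastDiffusion in
  have hd1 : (1 : ℝ) ≤ d := by exact_mod_cast hd
  have hm0 : 0 < m := by
    refine lt_of_le_of_lt ?_ hm
    exact div_nonneg (by linarith) (by linarith)
  have hden : 0 < 266 + 56 * m := by linarith
  have hχ1 : gapChi m < 1 / 266 := by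
    rw [gapChi, div_lt_div_iff₀ hden (by norm_num)]
    nlinarith
  refine ⟨⟨div_pos hm0 hden, by linarith⟩, fun v ε hvm hmass hcenter hε0 hε hv hne => ?_⟩
  have had := admissibleExponent_of_mOne_lt hd hm hm_one hm_dim_one
  rw [gapEta_eq hd] at hε ⊢
  rw [barenblatt_eq_cauchyWeight] at hmass hv hne
  obtain ⟨a, ha⟩ : ∃ a, a = 1 / (1 - m) := ⟨_, rfl⟩
  obtain ⟨σ, hσ⟩ : ∃ σ, σ = 2 / 3 * (1 - d / a) := ⟨_, rfl⟩
  rw [← ha] at had hε hmass hv hne ⊢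
  rw [← hσ] at hε ⊢
  have ha0 : 0 < a := by linarith [had.lt]
  have hσ0 : 0 < σ := by
    have : (d : ℝ) / a < 1 := (div_lt_one ha0).2 had.lt
    rw [hσ]; linarith
  have hσ1 : σ < 2 / 3 := by
    have : 0 < (d : ℝ) / a := by positivity
    rw [hσ]; linarith
  have hε' : ε < 3 * σ / 266 := by nlinarith
  have hwp := fun x : EuclideanSpace ℝ (Fin d) => cauchyWeight_pos a x
  -- the relative error
  set t : EuclideanSpace ℝ (Fin d) → ℝ := fun x => v x / cauchyWeight a x - 1 with ht
  have hvt : ∀ x, v x = cauchyWeight a x * (1 + t x) := fun x => by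
    simp only [ht, add_sub_cancel, mul_div_cancel₀ _ (hwp x).ne']
  have htm : AEStronglyMeasurable t volume := by
    have hc : Continuous fun x : EuclideanSpace ℝ (Fin d) => (cauchyWeight a x)⁻¹ :=
      (continuous_cauchyWeight a).inv₀ fun x => (hwp x).ne'
    simpa only [ht, div_eq_mul_inv, sub_eq_add_neg, Pi.mul_apply] using
      (hvm.mul hc.aestronglyMeasurable).add_const (-1)
  have htε : ∀ᵐ x, |t x| ≤ ε := by
    filter_upwards [hv] with x hx
    rw [hvt, mul_comm (1 - ε), mul_comm (1 + ε)] at hx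
    have h1 := le_of_mul_le_mul_left hx.1 (hwp x)
    have h2 := le_of_mul_le_mul_left hx.2 (hwp x)
    exact abs_le.2 ⟨by linarith, by linarith⟩
  have htne : ¬ t =ᵐ[volume] 0 := fun h0 => hne <| h0.mono fun x hx => by
    rw [hvt, hx]; simp
  obtain ⟨hint, -, hpos⟩ := entropy_bounds hm0 hm_one ha had.half_lt (by linarith) htm htε hvt
  have hF := hpos htne
  refine ⟨hint, hF, ?_⟩
  rw [quotient, ENNReal.le_div_iff_mul_le (Or.inl (by simpa using hF)) (Or.inl (by simp)),
    ← ENNReal.ofReal_mul (by linarith)]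
  exact mul_relEntropy_le_relFisher hm0 hm_one ha had hσ hε0 hε' htm htε hvt hmass hcenter
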